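/- **Setting.** Let $0=t_0<t_1<\cdots$ be real numbers, $l\ge 1$ an integer with $t_{j+l+1}-t_{j+l}=t_{j+1}-t_j$ for all $j\ge 0$, $\tau:=t_l$, $A_j:=[t_{j-1},t_j)$ and $\mathfrak D_j:=\bigcup_{k\ge0}A_{j+kl}$ ($1\le j\le l$). Let $(N(t))_{t\ge0}$ be a Poisson process with a locally integrable, non-negative, $\tau$-periodic intensity $\lambda$, $\Lambda(t)=\int_0^t\lambda(u)\,du$, with arrival times $\Upsilon_1\le\Upsilon_2\le\cdots$. Let $Z_n^j$ be independent random variables, independent of $N$, with $Z_n^j\sim F_j$, $\int z^2F_j(dz)<\infty$, and put $Z_n=\sum_{j=1}^l Z_n^j\mathbf 1_{\{\Upsilon_n\in\mathfrak D_j\}}$. Let $D$ be a deterministic continuous $\tau$-periodic function of locally bounded variation with $D_0=0$. The simple semi-Lévy process is $S_t=D_t+\sum_{n=1}^{N(t)}Z_n$; write $\nu_s:=\lambda(s)F_j$ for $s\in\mathfrak D_j$. Let $q\ge p\ge1$, $\alpha_0>0$, $\alpha_p\ne0$, $\alpha_{p+1}=\dots=\alpha_q=0$, $\beta_q\neq0$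 be real parameters, $\mathbf a=(\alpha_1,\dots,\alpha_q)'$, $\mathbf e=(0,\dots,0,1)'$, and let $B$ be the $q\times q$ companion matrix with ones on the superdiagonal, last row $(-\beta_q,\dots,-\beta_1)$, and zeros elsewhere. Let the state process $(\mathbf Y_t)_{t\ge0}$ be a càdlàg solution of $$d\mathbf Y_t=B\mathbf Y_{t-}\,dt+\mathbf e(\alpha_0+\mathbf a'\mathbf Y_{t-})\,d[S,S]_t,$$ with $\mathbf Y_0$ independent of $S$, where $[S,S]_t=\sum_{0<u\le t}(\Delta S_u)^2$. For $0\le s\le t$ put $\mathfrak J_{s,t}=e^{B(t-s)}$ and $\mathfrak K_{s,t}=0$ if $N(s)=N(t)$, and otherwise, with $Q_n=(I+Z_n^2\mathbf e\mathbf a')e^{B(\Upsilon_n-\Upsilon_{n-1})}$ and $R_n=\alpha_0Z_n^2\mathbf e$, $$\mathfrak J_{s,t}=e^{B(t-\Upsilon_{N(t)})}Q_{N(t)}\cdots Q_{N(s)+2}\,(I+Z_{N(s)+1}^2\mathbf e\mathbf a')\,e^{B(\Upsilon_{N(s)+1}-s)},$$ $$\mathfrak K_{s,t}=e^{B(t-\Upsilon_{N(t)})}\big(R_{N(t)}+Q_{N(t)}R_{N(t)-1}+\dots+Q_{N(t)}\cdots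 Q_{N(s)+2}R_{N(s)+1}\big).$$ **Assumptions.** (i) There is an invertible complex matrix $T$ such that $T^{-1}BT$ is diagonal, the eigenvalues $\eta_1,\dots,\eta_q$ of $B$ have strictly negative real parts, and with $\eta=\max_i\operatorname{Re}\eta_i$ there is an $r\in[1,\infty]$ such that $$\int_{\mathbb R}\log\big(1+\|T^{-1}\mathbf e\mathbf a'T\|_r\,z^2\big)\,\nu_s(dz)<-\frac{\nu_s(\mathbb R)\,\eta\,\tau}{\Lambda(s+\tau)-\Lambda(s)}\qquad\text{for all }s\in[0,\tau),$$ where $\|\cdot\|_r$ is the operator norm induced by the $\ell^r$ norm on $\mathbb C^q$. (ii) $\mathbf U$ is a random vector with $\mathbf U\overset d=\mathfrak J_{0,\tau}\mathbf U+\mathfrak K_{0,\tau}$, where on the right $\mathbf U$ is independent of $(\mathfrak J_{0,\tau},\mathfrak K_{0,\tau})$, and $\mathbf Y_0\overset d=\mathbf U$. (iii) $E\|\mathbf Y_0\|<\infty$, $E\|\mathbf Y_0\|^2<\infty$, and $E(S_t^2)<\infty$ for all $t\ge0$. **Lemma 4.2.** The expectations of $\mathbf U$ and of $\mathfrak J_{0,s},\mathfrak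 K_{0,s}$, $s\in[0,\tau]$, exist, and the matrix $E(\mathfrak J_{0,\tau})$ is invertible. If moreover $E(S_t^4)<\infty$ for all $t\ge 0$, then $\mathbf U$, $\mathbf Y_t$ ($t\ge0$) and $\mathfrak J_{0,s},\mathfrak K_{0,s}$ ($s\in[0,\tau]$) have finite second moments. For all $t,h\ge0$ there are $m,n\in\{0,1,2,\dots\}$ and $t_1,t_2\in[0,\tau)$ (so here $t_1,t_2$ are no longer partition points) with $t\in[m\tau,(m+1)\tau)$, $t+h\in[n\tau,(n+1)\tau)$, $t=t_1+m\tau$, $t+h=t_2+n\tau$, such that $\mathbf Y_t$ is integrable, $$E(\mathbf Y_t)=E(\mathfrak J_{0,t_1})E(\mathbf U)+E(\mathfrak K_{0,t_1}),$$ and, if $E(S_u^4)<\infty$ for all $u\ge0$, then with $\operatorname{cov}(\mathbf Y_t,\mathbf Y_{t+h}):=E(\mathbf Y_{t+h}\mathbf Y_t')-E(\mathbf Y_{t+h})E(\mathbf Y_t')$, $$\begin{aligned}\operatorname{cov}(\mathbf Y_t,\mathbf Y_{t+h})=E(\mathfrak J_{0,t_2})\big(E(\mathfrak J_{0,\tau})\big)^{n-m-1}\Big[&E\big(\mathfrak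 J_{0,\tau}E(\mathbf U\mathbf U')\mathfrak J_{0,t_1}'\big)-E(\mathfrak J_{0,\tau})E(\mathbf U)E(\mathbf U')E(\mathfrak J_{0,t_1}')\\&+E\big(\mathfrak J_{0,\tau}E(\mathbf U)\mathfrak K_{0,t_1}'\big)-E(\mathfrak J_{0,\tau})E(\mathbf U)E(\mathfrak K_{0,t_1}')\\&+E\big(\mathfrak K_{0,\tau}E(\mathbf U')\mathfrak J_{0,t_1}'\big)-E(\mathfrak K_{0,\tau})E(\mathbf U')E(\mathfrak J_{0,t_1}')\\&+E(\mathfrak K_{0,\tau}\mathfrak K_{0,t_1}')-E(\mathfrak K_{0,\tau})E(\mathfrak K_{0,t_1}')\Big].\end{aligned}$$ For $m=n$ the exponent is $-1$ and denotes the matrix inverse. -/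

import Mathlib

open MeasureTheory ProbabilityTheory Filter Topology Set
open scoped NNReal ENNReal Matrix

noncomputable section

namespace SSCogarch

/-- The jump `f u - f (u-)` of a path at time `u`. -/
def jump (f : ℝ → ℝ) (u : ℝ) : ℝ := f u - Function.leftLim f u

/-- Entrywise expectation of a random vector. -/
def vecE {Ω : Type*} [MeasurableSpace Ω] {q : ℕ} (P : Measure Ω) (X : Ω → Fin q → ℝ) :
    Fin q → ℝ :=
  fun i => ∫ ω, X ω i ∂P

/-- Entrywise expectation of a random matrix. -/
def matE {Ω : Type*} [MeasurableSpace Ω] {q : ℕ} (P : Measure Ω)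
    (A : Ω → Matrix (Fin q) (Fin q) ℝ) : Matrix (Fin q) (Fin q) ℝ :=
  Matrix.of fun i j => ∫ ω, A ω i j ∂P

/-- The matrix `E[(X - E X) (Y - E Y)']` of the covariances `cov(X_i, Y_j)`. -/
def crossCov {Ω : Type*} [MeasurableSpace Ω] {q : ℕ} (P : Measure Ω) (X Y : Ω → Fin q → ℝ) :
    Matrix (Fin q) (Fin q) ℝ :=
  Matrix.of fun i j => covariance (fun ω => X ω i) (fun ω => Y ω j) P

/-- The operator norm `sup_{c ≠ 0} ‖C c‖_r / ‖c‖_r` of a complex matrix for the `ℓ^r` norm. -/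
def matLpNorm {q : ℕ} (r : ℝ≥0∞) (C : Matrix (Fin q) (Fin q) ℂ) : ℝ :=
  ⨆ c : {c : Fin q → ℂ // c ≠ 0}, ‖WithLp.toLp r (C *ᵥ c.1)‖ / ‖WithLp.toLp r c.1‖

/-- The data of a simple semi-Lévy process (a compound Poisson process with periodic intensity
and periodic jump laws, plus a periodic drift) on a probability space `(Ω, P)`.
Times are real numbers, and only times `≥ 0` matter.  The index `j : Fin l` stands for the
`(j+1)`-st interval of a period, and the arrivals are numbered from `1`. -/
structure SimpleSemiLevy (Ω : Type*) [MeasurableSpace Ω] (P : Measure Ω) where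
  /-- the number of partition intervals in one period -/
  l : ℕ
  l_pos : 0 < l
  /-- the partition points `0 = t_0 < t_1 < ⋯` -/
  part : ℕ → ℝ
  part_zero : part 0 = 0
  part_strictMono : StrictMono part
  part_periodic : ∀ j, part (j + l + 1) - part (j + l) = part (j + 1) - part j
  /-- the intensity -/
  lam : ℝ → ℝ
  lam_nonneg : ∀ t, 0 ≤ t → 0 ≤ lam t
  /-- `part l` is the sum of the lengths of the first `l` intervals, i.e. the period -/
  lam_periodic : ∀ t, 0 ≤ t → lam (t + part l) = lam t
  lam_integrable : ∀ t, 0 ≤ t → IntervalIntegrable lam volume 0 t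
  /-- the counting process -/
  N : ℝ → Ω → ℕ
  N_measurable : ∀ t, 0 ≤ t → Measurable (N t)
  N_zero : ∀ ω, N 0 ω = 0
  N_mono : ∀ ω s t, 0 ≤ s → s ≤ t → N s ω ≤ N t ω
  N_rightCont : ∀ ω t, 0 ≤ t → ContinuousWithinAt (fun u => N u ω) (Ici t) t
  N_indep : HasIndepIncrements (fun (t : ℝ≥0) ω => N t ω) P
  N_law : ∀ s t, 0 ≤ s → s ≤ t →
    P.map (fun ω => N t ω - N s ω) = poissonMeasure (∫ u in s..t, lam u).toNNReal
  /-- the laws of the jump sizes in the intervals of a period -/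
  F : Fin l → Measure ℝ
  F_prob : ∀ j, IsProbabilityMeasure (F j)
  F_sq : ∀ j, Integrable (fun z => z ^ 2) (F j)
  /-- `Z n j` is the size of the `n`-th jump if that jump falls into an interval of type `j` -/
  Z : ℕ → Fin l → Ω → ℝ
  Z_measurable : ∀ n j, Measurable (Z n j)
  Z_law : ∀ n j, P.map (Z n j) = F j
  Z_indep : iIndepFun (fun (x : ℕ × Fin l) => Z x.1 x.2) P
  N_Z_indep : IndepFun (fun ω (t : ℝ≥0) => N t ω) (fun ω (x : ℕ × Fin l) => Z x.1 x.2 ω) P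
  /-- the deterministic drift -/
  D : ℝ → ℝ
  D_zero : D 0 = 0
  D_periodic : ∀ t, 0 ≤ t → D (t + part l) = D t
  D_cont : ContinuousOn D (Ici 0)
  D_bv : LocallyBoundedVariationOn D (Ici 0)

namespace SimpleSemiLevy

variable {Ω : Type*} [MeasurableSpace Ω] {P : Measure Ω} (L : SimpleSemiLevy Ω P)

/-- The period. -/
def tau : ℝ := L.part L.l

/-- The mean function `Λ` of the counting process. -/
def Lam (t : ℝ) : ℝ := ∫ u in (0 : ℝ)..t, L.lam u

/-- The union of the partition intervals of type `j`. -/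
def cell (j : Fin L.l) : Set ℝ :=
  ⋃ k : ℕ, Ico (L.part (j + k * L.l)) (L.part (j + k * L.l + 1))

/-- The time of the `n`-th arrival (it is used only for `n ≤ N t`). -/
def arrival (n : ℕ) (ω : Ω) : ℝ := sInf {t | 0 ≤ t ∧ n ≤ L.N t ω}

open Classical in
/-- The size of the `n`-th jump. -/
def jumpSize (n : ℕ) (ω : Ω) : ℝ :=
  ∑ j : Fin L.l, if L.arrival n ω ∈ L.cell j then L.Z n j ω else 0

/-- The simple semi-Lévy process. -/
def S (t : ℝ) (ω : Ω) : ℝ := L.D t + ∑ n ∈ Finset.Icc 1 (L.N t ω), L.jumpSize n ω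

open Classical in
/-- The local Lévy measure at time `s`, i.e. `λ(s) F_j` if `s` lies in an interval of type `j`. -/
def localLevy (s : ℝ) : Measure ℝ :=
  ∑ j : Fin L.l, if s ∈ L.cell j then ENNReal.ofReal (L.lam s) • L.F j else 0

end SimpleSemiLevy

/-- The parameters of a COGARCH(p,q) process; `a i` is `α_{i+1}` and `β i` is `β_{i+1}`. -/
structure Params (q : ℕ) where
  p : ℕ
  one_le_p : 1 ≤ p
  p_le_q : p ≤ q
  α₀ : ℝ
  α₀_pos : 0 < α₀
  a : Fin q → ℝ
  a_p : ∀ i : Fin q, (i : ℕ) + 1 = p → a i ≠ 0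
  a_zero : ∀ i : Fin q, p ≤ (i : ℕ) → a i = 0
  β : Fin q → ℝ
  β_q : ∀ i : Fin q, (i : ℕ) + 1 = q → β i ≠ 0

namespace Params

variable {q : ℕ} (C : Params q)

/-- The companion matrix, with last row `(-β_q, …, -β_1)`. -/
def B : Matrix (Fin q) (Fin q) ℝ :=
  Matrix.of fun i j =>
    if (i : ℕ) + 1 = q then -C.β j.rev else if (j : ℕ) = (i : ℕ) + 1 then 1 else 0

/-- The last unit vector. -/
def e (_C : Params q) : Fin q → ℝ := fun i => if (i : ℕ) + 1 = q then 1 else 0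

/-- The matrix `e a'`. -/
def ea : Matrix (Fin q) (Fin q) ℝ := Matrix.vecMulVec C.e C.a

end Params

section Coefficients

variable {Ω : Type*} [MeasurableSpace Ω] {P : Measure Ω} (L : SimpleSemiLevy Ω P)
  {q : ℕ} (C : Params q)

/-- The `k`-th event time after time `s`: `s` itself for `k = 0`, and the time of the arrival
number `N(s) + k` for `k ≥ 1`. -/
def eventTime (s : ℝ) (ω : Ω) (k : ℕ) : ℝ :=
  if k = 0 then s else L.arrival (L.N s ω + k) ω

/-- The matrix `(I + Z² e a') e^{B(θ_k - θ_{k-1})} ⋯ (I + Z² e a') e^{B(θ_1 - θ_0)}` of the first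
`k` arrivals after time `s`, where `θ` are the event times. -/
def stepJ (s : ℝ) (ω : Ω) : ℕ → Matrix (Fin q) (Fin q) ℝ
  | 0 => 1
  | k + 1 => (1 + L.jumpSize (L.N s ω + (k + 1)) ω ^ 2 • C.ea)
      * NormedSpace.exp ((eventTime L s ω (k + 1) - eventTime L s ω k) • C.B) * stepJ s ω k

/-- The inhomogeneous part after the first `k` arrivals after time `s`:
`K_k = (I + Z² e a') e^{B(θ_k - θ_{k-1})} K_{k-1} + α₀ Z² e`, `K_0 = 0`. -/
def stepK (s : ℝ) (ω : Ω) : ℕ → Fin q → ℝ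
  | 0 => 0
  | k + 1 => ((1 + L.jumpSize (L.N s ω + (k + 1)) ω ^ 2 • C.ea)
      * NormedSpace.exp ((eventTime L s ω (k + 1) - eventTime L s ω k) • C.B)) *ᵥ stepK s ω k
      + (C.α₀ * L.jumpSize (L.N s ω + (k + 1)) ω ^ 2) • C.e

/-- The random matrix `𝔍_{s,t}`. -/
def J (s t : ℝ) (ω : Ω) : Matrix (Fin q) (Fin q) ℝ :=
  NormedSpace.exp ((t - eventTime L s ω (L.N t ω - L.N s ω)) • C.B)
    * stepJ L C s ω (L.N t ω - L.N s ω)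

/-- The random vector `𝔎_{s,t}`. -/
def K (s t : ℝ) (ω : Ω) : Fin q → ℝ :=
  NormedSpace.exp ((t - eventTime L s ω (L.N t ω - L.N s ω)) • C.B)
    *ᵥ stepK L C s ω (L.N t ω - L.N s ω)

/-- `Y` is a state process, i.e. a càdlàg solution of
`dY_t = B Y_{t-} dt + e (α₀ + a' Y_{t-}) d[S,S]_t` whose initial value is independent of `S`.
The paths of `S` have locally finite variation and finitely many jumps in bounded time, so
`[S,S]_t` is the sum of `(ΔS_u)²` over `0 < u ≤ t`, and an integral against `d[S,S]` is
the corresponding sum over the jumps. -/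
structure IsStateProcess (Y : ℝ → Ω → Fin q → ℝ) : Prop where
  measurable : ∀ t, 0 ≤ t → Measurable (Y t)
  indep : IndepFun (Y 0) (fun ω (t : ℝ≥0) => L.S t ω) P
  rightCont : ∀ᵐ ω ∂P, ∀ t, 0 ≤ t → ContinuousWithinAt (fun u => Y u ω) (Ici t) t
  leftLimits : ∀ᵐ ω ∂P, ∀ t, 0 < t → ∃ y, Tendsto (fun u => Y u ω) (𝓝[<] t) (𝓝 y)
  sde : ∀ᵐ ω ∂P, ∀ t, 0 ≤ t →
    Y t ω = Y 0 ω + (∫ s in (0 : ℝ)..t, C.B *ᵥ Function.leftLim (fun u => Y u ω) s)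
      + ∑' u : Ioc (0 : ℝ) t,
          ((C.α₀ + C.a ⬝ᵥ Function.leftLim (fun v => Y v ω) u)
            * jump (fun v => L.S v ω) u ^ 2) • C.e

/-- The stability condition: `B` is diagonalized by a complex matrix `T`, its eigenvalues have
negative real parts with maximum `η`, and for some `r ∈ [1,∞]` and all `s ∈ [0,τ)`,
`∫ log(1 + ‖T⁻¹ e a' T‖_r z²) ν_s(dz) < - ν_s(ℝ) η τ / (Λ(s+τ) - Λ(s))`. -/
def IsStable : Prop :=
  ∃ (T : Matrix (Fin q) (Fin q) ℂ) (η : Fin q → ℂ),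
    IsUnit T.det ∧ T⁻¹ * C.B.map Complex.ofReal * T = Matrix.diagonal η ∧
    (∀ i, (η i).re < 0) ∧
    ∃ r : ℝ≥0∞, 1 ≤ r ∧ ∀ s ∈ Ico 0 L.tau,
      ∫ z, Real.log (1 + matLpNorm r (T⁻¹ * C.ea.map Complex.ofReal * T) * z ^ 2)
          ∂(L.localLevy s)
        < -(1 / (L.Lam (s + L.tau) - L.Lam s)) * (L.localLevy s).real univ
            * (⨆ i, (η i).re) * L.tau

/-- The law of `U` solves the random equation `U = 𝔍_{0,τ} U + 𝔎_{0,τ}` in distribution, with `U`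
on the right independent of `(𝔍_{0,τ}, 𝔎_{0,τ})` (realized on the product space). -/
def SolvesRandomEquation {Ω' : Type*} [MeasurableSpace Ω'] (P' : Measure Ω')
    (U : Ω' → Fin q → ℝ) : Prop :=
  IdentDistrib U (fun x : Ω' × Ω => J L C 0 L.tau x.2 *ᵥ U x.1 + K L C 0 L.tau x.2)
    P' (P'.prod P)

end Coefficients

end SSCogarch

end

open SSCogarch

noncomputable section

/-! The pair (𝔍, 𝔎) over an interval is an affine map, so in homogeneous coordinates it is a single
matrix `Phi`. This matrix is a multiplicative functional (`flow`) of the jump part X of S: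
exponential drift between arrivals and a factor 1 + Z² c at each arrival (`flow_aug`). Everything
needed about 𝔍 and 𝔎 is therefore proved once, for `flow`.

Three facts about `flow` carry the argument. It is a cocycle in time (`flow_mul`). It is almost
surely the limit of Euler products in the increments of X (`tendsto_euler`), hence a measurable
functional of the path before a given time, or of the increments after it. Since X has independent
increments with τ-periodic laws (`indepFun_pastX_futureX`, `identDistrib_futureX`), flows over
adjacent intervals are independent, and their laws do not change under a shift by whole periods.
Finally, it is dominated by a deterministic exponential times a product over the arrivals of i.i.d.
factors, whose mean is given by the Poisson generating function (`integrable_prod_jumps`). This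
gives first moments, and second moments once the F_j have fourth moments. The latter follow from
those of S, because each cell contains exactly one arrival with positive probability
(`integrable_F_pow_four`); the positivity of λ used there comes from the stability condition.

The mean of 𝔍 is multiplicative in time and close to the identity on short intervals, so it is a
product of invertible matrices (`isUnit_meanFlow`).

Solving the state equation from arrival to arrival gives Y_t = 𝔍 Y_0 + 𝔎 (`state_eq`), so Y_t is an
affine image of Y_s whose coefficients are independent of the state up to s. The fixed point
equation then propagates the law of U to all times mτ (`identDistrib_periods`), and starting at mτ
gives the mean. For the covariance, expanding Y_{(m+1)τ} and Y_t from time mτ yields the bracket,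
and moving the later time from s to t multiplies a covariance by the mean of 𝔍_{s,t}
(`crossCov_mul`). For m < n this is applied forward from (m+1)τ. For m = n the time (m+1)τ lies
after t+h, and the same relation is inverted. -/

/-! ### Elements of a normed ring that are close to one -/

/-- `‖x - 1‖ ≤ a - 1`, a bound that is stable under products. -/
def NearOne {𝔸 : Type*} [NormedRing 𝔸] (x : 𝔸) (a : ℝ) : Prop := ‖x - 1‖ ≤ a - 1

namespace NearOne

variable {𝔸 : Type*} [NormedRing 𝔸]

lemma one_le {x : 𝔸} {a : ℝ} (h : NearOne x a) : 1 ≤ a := by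
  have := (norm_nonneg _).trans h
  linarith

lemma one : NearOne (1 : 𝔸) 1 := by simp [NearOne]

lemma mul {x y : 𝔸} {a b : ℝ} (hx : NearOne x a) (hy : NearOne y b) :
    NearOne (x * y) (a * b) := by
  have ha := hx.one_le
  have hb := hy.one_le
  unfold NearOne at *
  have e : x * y - 1 = (x - 1) * (y - 1) + (x - 1) + (y - 1) := by noncomm_ring
  rw [e]
  have h1 : ‖(x - 1) * (y - 1)‖ ≤ (a - 1) * (b - 1) :=
    (norm_mul_le _ _).trans (mul_le_mul hx hy (norm_nonneg _) (by linarith))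
  have h2 := norm_add₃_le (a := (x - 1) * (y - 1)) (b := x - 1) (c := y - 1)
  nlinarith

lemma norm_le [NormOneClass 𝔸] {x : 𝔸} {a : ℝ} (h : NearOne x a) : ‖x‖ ≤ a := by
  have h1 : ‖x‖ ≤ ‖x - 1‖ + ‖(1 : 𝔸)‖ := by simpa using norm_add_le (x - 1) 1
  rw [norm_one] at h1
  unfold NearOne at h
  linarith

lemma mono {x : 𝔸} {a b : ℝ} (h : NearOne x a) (hab : a ≤ b) : NearOne x b := by
  unfold NearOne at *; linarith

lemma one_add_smul [NormedAlgebra ℝ 𝔸] (c : 𝔸) {r : ℝ} (hr : 0 ≤ r) :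
    NearOne (1 + r • c) (1 + r * ‖c‖) := by
  simp [NearOne, norm_smul, abs_of_nonneg hr]

/-- Termwise comparison of the two exponential series after removing the constant term. Only
positive powers remain, so nothing about the norm of 1 is needed. -/
lemma exp [NormedAlgebra ℝ 𝔸] [CompleteSpace 𝔸] (x : 𝔸) :
    NearOne (NormedSpace.exp x) (Real.exp ‖x‖) := by
  unfold NearOne
  have h1 : HasSum (fun n : ℕ => ((n.factorial : ℝ)⁻¹) • x ^ n) (NormedSpace.exp x) :=
    NormedSpace.exp_series_hasSum_exp' (𝕂 := ℝ) x
  have h2 : HasSum (fun n : ℕ => ((n.factorial : ℝ)⁻¹) • ‖x‖ ^ n) (Real.exp ‖x‖) := by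
    rw [Real.exp_eq_exp_ℝ]
    exact NormedSpace.exp_series_hasSum_exp' (𝕂 := ℝ) ‖x‖
  have h3 := (hasSum_nat_add_iff' 1).2 h1
  have h4 := (hasSum_nat_add_iff' 1).2 h2
  simp only [Finset.range_one, Finset.sum_singleton, Nat.factorial_zero, Nat.cast_one, inv_one,
    pow_zero, one_smul] at h3 h4
  refine h3.norm_le_of_bounded h4 fun n => ?_
  rw [norm_smul, smul_eq_mul, norm_inv, Real.norm_natCast]
  gcongr
  exact norm_pow_le' _ (Nat.succ_pos n)

lemma exp_smul [NormedAlgebra ℝ 𝔸] [CompleteSpace 𝔸] (b : 𝔸) {r : ℝ} (hr : 0 ≤ r) :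
    NearOne (NormedSpace.exp (r • b)) (Real.exp (r * ‖b‖)) := by
  have := exp (r • b)
  rwa [norm_smul, Real.norm_of_nonneg hr] at this

end NearOne

/-! ### Ordered products and their perturbation -/

/-- The product `A (n-1) * ⋯ * A 1 * A 0`. -/
def revProd {𝔸 : Type*} [Monoid 𝔸] (A : ℕ → 𝔸) : ℕ → 𝔸
  | 0 => 1
  | n + 1 => A n * revProd A n

/-- Replacing the factors one at a time. The error of a factor is measured relative to its bound a
i, so the product of all bounds comes out as a common factor and only the sum of the relative errors
remains. -/
lemma norm_revProd_sub_le {𝔸 : Type*} [NormedRing 𝔸] [NormOneClass 𝔸] {A B : ℕ → 𝔸}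
    {a d : ℕ → ℝ} {n : ℕ} (hA : ∀ i < n, NearOne (A i) (a i)) (hB : ∀ i < n, NearOne (B i) (a i))
    (hd : ∀ i < n, ‖A i - B i‖ ≤ a i * d i) :
    ‖revProd A n - revProd B n‖ ≤ (∏ i ∈ Finset.range n, a i) * ∑ i ∈ Finset.range n, d i := by
  induction n with
  | zero => simp [revProd]
  | succ n ih =>
    have ih := ih (fun i hi => hA i (by omega)) (fun i hi => hB i (by omega))
      (fun i hi => hd i (by omega))
    have e : revProd A (n + 1) - revProd B (n + 1)
        = A n * (revProd A n - revProd B n) + (A n - B n) * revProd B n := by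
      simp only [revProd]; noncomm_ring
    have hBn : ‖revProd B n‖ ≤ ∏ i ∈ Finset.range n, a i := by
      have key : ∀ k ≤ n, NearOne (revProd B k) (∏ i ∈ Finset.range k, a i) := by
        intro k hk
        induction k with
        | zero => simpa [revProd] using NearOne.one
        | succ k ihk =>
          rw [Finset.prod_range_succ, mul_comm]
          exact (hB k (by omega)).mul (ihk (by omega))
      exact (key n le_rfl).norm_le
    have hAn := (hA n (by omega)).norm_le
    have han : 0 ≤ a n := by linarith [(hA n (by omega)).one_le]
    rw [e, Finset.prod_range_succ, Finset.sum_range_succ]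
    refine (norm_add_le _ _).trans ?_
    have h1 : ‖A n * (revProd A n - revProd B n)‖
        ≤ a n * ((∏ i ∈ Finset.range n, a i) * ∑ i ∈ Finset.range n, d i) :=
      (norm_mul_le _ _).trans (mul_le_mul hAn ih (norm_nonneg _) han)
    have h2 : ‖(A n - B n) * revProd B n‖ ≤ (a n * d n) * ∏ i ∈ Finset.range n, a i :=
      (norm_mul_le _ _).trans (mul_le_mul (hd n (by omega)) hBn (norm_nonneg _)
        ((norm_nonneg _).trans (hd n (by omega))))
    linarith

/-! ### Euler factors and the cost of moving a jump inside a step -/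

section Exp

variable {𝔸 : Type*} [NormedRing 𝔸] [NormedAlgebra ℝ 𝔸]

/-- The Euler product of a path `x` over `n` intervals of equal length. -/
def euler (b c : 𝔸) (s t : ℝ) (n : ℕ) (x : ℝ → ℝ) : 𝔸 :=
  revProd (fun i => (1 + (x (s + (i + 1 : ℕ) * ((t - s) / n)) - x (s + i * ((t - s) / n))) ^ 2 • c)
    * NormedSpace.exp (((t - s) / n) • b)) n

variable [CompleteSpace 𝔸]

lemma exp_add_smul (b : 𝔸) (x y : ℝ) :
    NormedSpace.exp ((x + y) • b) = NormedSpace.exp (x • b) * NormedSpace.exp (y • b) := by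
  rw [add_smul]
  let _ : NormedAlgebra ℚ 𝔸 := NormedAlgebra.restrictScalars ℚ ℝ 𝔸
  exact NormedSpace.exp_add_of_commute (((Commute.refl b).smul_left x).smul_right y)

/-- The first product is the exact flow over a step with a jump after time α, the second is the
Euler factor, where the jump sits at the end of the step. Their difference is the commutator of
exp(βb) - 1 with 1 + rc, followed by exp(αb), and exp(βb) - 1 is small with the step. -/
lemma norm_exp_mul_sub_le [NormOneClass 𝔸] (b c : 𝔸) {α β r : ℝ} (hα : 0 ≤ α) (hβ : 0 ≤ β)
    (hr : 0 ≤ r) :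
    ‖NormedSpace.exp (β • b) * ((1 + r • c) * NormedSpace.exp (α • b))
      - (1 + r • c) * NormedSpace.exp ((β + α) • b)‖
      ≤ (Real.exp ((β + α) * ‖b‖) * (1 + r * ‖c‖)) * (2 * (Real.exp ((β + α) * ‖b‖) - 1)) := by
  rw [exp_add_smul]
  have e : NormedSpace.exp (β • b) * ((1 + r • c) * NormedSpace.exp (α • b))
      - (1 + r • c) * (NormedSpace.exp (β • b) * NormedSpace.exp (α • b))
      = (NormedSpace.exp (β • b) - 1) * (1 + r • c) * NormedSpace.exp (α • b)
        - (1 + r • c) * (NormedSpace.exp (β • b) - 1) * NormedSpace.exp (α • b) := by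
    simp only [sub_mul, mul_sub, one_mul, mul_one, mul_assoc]
    abel
  rw [e]
  have h1 : ‖NormedSpace.exp (β • b) - 1‖ ≤ Real.exp (β * ‖b‖) - 1 := NearOne.exp_smul b hβ
  have h2 := (NearOne.one_add_smul c hr).norm_le
  have h3 := (NearOne.exp_smul b hα).norm_le
  have h4 : Real.exp (β * ‖b‖) - 1 ≤ Real.exp ((β + α) * ‖b‖) - 1 := by gcongr; linarith
  have h5 : Real.exp (α * ‖b‖) ≤ Real.exp ((β + α) * ‖b‖) := by gcongr; linarith
  set E := Real.exp ((β + α) * ‖b‖)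
  have h6 : 0 ≤ E - 1 := (norm_nonneg _).trans (h1.trans h4)
  have h7 : 0 ≤ 1 + r * ‖c‖ := by positivity
  have g1 : ‖(NormedSpace.exp (β • b) - 1) * (1 + r • c) * NormedSpace.exp (α • b)‖
      ≤ (E - 1) * (1 + r * ‖c‖) * E := by
    refine (norm_mul₃_le).trans ?_
    gcongr
    · exact h1.trans h4
    · exact h3.trans h5
  have g2 : ‖(1 + r • c) * (NormedSpace.exp (β • b) - 1) * NormedSpace.exp (α • b)‖
      ≤ (1 + r * ‖c‖) * (E - 1) * E := by
    refine (norm_mul₃_le).trans ?_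
    gcongr
    · exact h1.trans h4
    · exact h3.trans h5
  refine (norm_sub_le _ _).trans ?_
  linarith

end Exp

namespace SSCogarch.SimpleSemiLevy

variable {Ω : Type*} [MeasurableSpace Ω] {P : Measure Ω} (L : SimpleSemiLevy Ω P)

/-! ### Arrival times -/

lemma arrival_nonneg (n : ℕ) (ω : Ω) : 0 ≤ L.arrival n ω :=
  Real.sInf_nonneg fun _ h => h.1

lemma arrival_le {n : ℕ} {ω : Ω} {t : ℝ} (ht : 0 ≤ t) (h : n ≤ L.N t ω) : L.arrival n ω ≤ t :=
  csInf_le ⟨0, fun _ h => h.1⟩ ⟨ht, h⟩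

lemma eventually_N_eq (ω : Ω) {t : ℝ} (ht : 0 ≤ t) : ∀ᶠ u in 𝓝[≥] t, L.N u ω = L.N t ω := by
  have hc := L.N_rightCont ω t ht
  rwa [ContinuousWithinAt, nhds_discrete, tendsto_pure] at hc

/-- The infimum that defines the arrival time is attained, because N is right continuous and integer
valued. The time T with at least n arrivals keeps the set nonempty; otherwise the infimum would be
the default value 0. -/
lemma le_N_arrival {n : ℕ} {ω : Ω} {T : ℝ} (hT : 0 ≤ T) (h : n ≤ L.N T ω) :
    n ≤ L.N (L.arrival n ω) ω := by
  have h0 := L.arrival_nonneg n ω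
  have hc' := L.eventually_N_eq ω h0
  obtain ⟨u, hu, hsub⟩ := mem_nhdsGE_iff_exists_Ico_subset.1 hc'
  obtain ⟨v, hv, hvu⟩ := exists_lt_of_csInf_lt (s := {t | 0 ≤ t ∧ n ≤ L.N t ω}) ⟨T, hT, h⟩ hu
  have hle : L.arrival n ω ≤ v := L.arrival_le hv.1 hv.2
  have := hsub ⟨hle, hvu⟩
  simp only [mem_ofPred_eq] at this
  rw [← this]; exact hv.2

lemma arrival_le_iff {n : ℕ} {ω : Ω} {t T : ℝ} (ht : 0 ≤ t) (hT : 0 ≤ T) (h : n ≤ L.N T ω) :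
    L.arrival n ω ≤ t ↔ n ≤ L.N t ω :=
  ⟨fun hle => (L.le_N_arrival hT h).trans (L.N_mono ω _ _ (L.arrival_nonneg n ω) hle),
    L.arrival_le ht⟩

lemma arrival_mono {n m : ℕ} {ω : Ω} {T : ℝ} (hT : 0 ≤ T) (hnm : n ≤ m) (h : m ≤ L.N T ω) :
    L.arrival n ω ≤ L.arrival m ω :=
  L.arrival_le (L.arrival_nonneg _ _) (hnm.trans (L.le_N_arrival hT h))

lemma lt_arrival {n : ℕ} {ω : Ω} {t T : ℝ} (ht : 0 ≤ t) (hT : 0 ≤ T) (h : n ≤ L.N T ω)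
    (hn : L.N t ω < n) : t < L.arrival n ω := by
  by_contra! hle
  exact absurd ((L.arrival_le_iff ht hT h).1 hle) (by omega)

/-- The jump part of the process. -/
def X (t : ℝ) (ω : Ω) : ℝ := ∑ n ∈ Finset.Icc 1 (L.N t ω), L.jumpSize n ω

lemma X_sub {u v : ℝ} (hu : 0 ≤ u) (huv : u ≤ v) (ω : Ω) :
    L.X v ω - L.X u ω = ∑ n ∈ Finset.Ioc (L.N u ω) (L.N v ω), L.jumpSize n ω := by
  have h := L.N_mono ω u v hu huv
  have e : ∀ k, Finset.Icc 1 k = Finset.Ioc 0 k := fun k => by ext; simp; omega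
  simp only [X, e]
  rw [← Finset.sum_Ioc_consecutive _ (Nat.zero_le _) h]
  ring

/-! ### Paths of the multiplicative functional -/

lemma eventTime_le {s t : ℝ} (hs : 0 ≤ s) (hst : s ≤ t) {ω : Ω} {k : ℕ}
    (hk : k ≤ L.N t ω - L.N s ω) : eventTime L s ω k ≤ t := by
  have h := L.N_mono ω s t hs hst
  unfold eventTime
  split_ifs with h0
  · exact hst
  · exact L.arrival_le (hs.trans hst) (by omega)

lemma eventTime_le_succ {s t : ℝ} (hs : 0 ≤ s) (hst : s ≤ t) {ω : Ω} {k : ℕ}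
    (hk : k + 1 ≤ L.N t ω - L.N s ω) : eventTime L s ω k ≤ eventTime L s ω (k + 1) := by
  have h := L.N_mono ω s t hs hst
  unfold eventTime
  rw [if_neg (Nat.succ_ne_zero k)]
  split_ifs with h0
  · exact (L.lt_arrival hs (hs.trans hst) (by omega) (by omega)).le
  · exact L.arrival_mono (hs.trans hst) (by omega) (by omega)

variable {𝔸 : Type*} [NormedRing 𝔸] [NormedAlgebra ℝ 𝔸]

/-- The product over the first `k` arrivals after time `s`, in a general Banach algebra. -/
def flowStep (b c : 𝔸) (s : ℝ) (ω : Ω) : ℕ → 𝔸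
  | 0 => 1
  | k + 1 => (1 + L.jumpSize (L.N s ω + (k + 1)) ω ^ 2 • c)
      * NormedSpace.exp ((eventTime L s ω (k + 1) - eventTime L s ω k) • b) * flowStep b c s ω k

/-- The multiplicative functional with drift `b` and jump coefficient `c`. -/
def flow (b c : 𝔸) (s t : ℝ) (ω : Ω) : 𝔸 :=
  NormedSpace.exp ((t - eventTime L s ω (L.N t ω - L.N s ω)) • b)
    * L.flowStep b c s ω (L.N t ω - L.N s ω)

lemma flow_self (b c : 𝔸) (s : ℝ) (ω : Ω) : L.flow b c s s ω = 1 := by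
  simp [flow, flowStep, eventTime]

lemma flow_of_N_eq (b c : 𝔸) {s t : ℝ} {ω : Ω} (h : L.N t ω = L.N s ω) :
    L.flow b c s t ω = NormedSpace.exp ((t - s) • b) := by
  simp [flow, flowStep, eventTime, h]

lemma flow_of_N_eq_succ (b c : 𝔸) {s t : ℝ} {ω : Ω} (h : L.N t ω = L.N s ω + 1) :
    L.flow b c s t ω = NormedSpace.exp ((t - L.arrival (L.N t ω) ω) • b)
      * ((1 + L.jumpSize (L.N t ω) ω ^ 2 • c)
        * NormedSpace.exp ((L.arrival (L.N t ω) ω - s) • b)) := by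
  simp [flow, flowStep, eventTime, h]

variable [CompleteSpace 𝔸]

/-- The (k+i+1)-st arrival after s is the (i+1)-st arrival after u, where k arrivals fall into (s,
u]. The only discrepancy is at the seam: the last event before u is an arrival (or s) on one side
and u itself on the other, which the semigroup law of the exponential absorbs. -/
lemma flow_mul (b c : 𝔸) {s u t : ℝ} (hs : 0 ≤ s) (hsu : s ≤ u) (hut : u ≤ t) (ω : Ω) :
    L.flow b c s t ω = L.flow b c u t ω * L.flow b c s u ω := by
  have h1 := L.N_mono ω s u hs hsu
  have h2 := L.N_mono ω u t (hs.trans hsu) hut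
  obtain ⟨k, hk⟩ := Nat.exists_eq_add_of_le h1
  obtain ⟨m, hm⟩ := Nat.exists_eq_add_of_le h2
  have ev : ∀ i, eventTime L s ω (k + (i + 1)) = eventTime L u ω (i + 1) := fun i => by
    unfold eventTime
    rw [if_neg (by omega), if_neg (by omega), hk, add_assoc]
  -- The index starts at i + 1, since before the first arrival after u the two recursions have
  -- different event times.
  have key : ∀ i, L.flowStep b c s ω (k + (i + 1)) = L.flowStep b c u ω (i + 1)
      * NormedSpace.exp ((u - eventTime L s ω k) • b) * L.flowStep b c s ω k := by
    intro i
    induction i with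
    | zero =>
      have e0 : eventTime L u ω 0 = u := by simp [eventTime]
      have e1 := ev 0
      simp only [zero_add] at e1 ⊢
      simp only [flowStep, e1, e0, mul_one, hk, add_assoc, zero_add]
      rw [← sub_add_sub_cancel (eventTime L u ω 1) u (eventTime L s ω k), exp_add_smul]
      simp only [mul_assoc]
    | succ i ih =>
      rw [← add_assoc k (i + 1) 1, flowStep, ih, add_assoc k (i + 1) 1, ev (i + 1), ev i]
      conv_rhs => rw [flowStep]
      simp only [mul_assoc, hk, add_assoc]
  have d1 : L.N t ω - L.N s ω = k + m := by omega
  have d2 : L.N u ω - L.N s ω = k := by omega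
  have d3 : L.N t ω - L.N u ω = m := by omega
  unfold flow
  rw [d1, d2, d3]
  cases m with
  | zero =>
    simp only [add_zero, flowStep, mul_one, eventTime, if_true]
    rw [← mul_assoc, ← exp_add_smul, sub_add_sub_cancel]
  | succ i =>
    rw [key, ev]
    simp only [mul_assoc]

lemma flow_nearOne (b c : 𝔸) {s t : ℝ} (hs : 0 ≤ s) (hst : s ≤ t) (ω : Ω) :
    NearOne (L.flow b c s t ω) (Real.exp ((t - s) * ‖b‖)
      * ∏ n ∈ Finset.Ioc (L.N s ω) (L.N t ω), (1 + L.jumpSize n ω ^ 2 * ‖c‖)) := by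
  have h1 := L.N_mono ω s t hs hst
  have key : ∀ k ≤ L.N t ω - L.N s ω, NearOne (L.flowStep b c s ω k)
      (Real.exp ((eventTime L s ω k - s) * ‖b‖)
        * ∏ n ∈ Finset.Ioc (L.N s ω) (L.N s ω + k), (1 + L.jumpSize n ω ^ 2 * ‖c‖)) := by
    intro k hk
    induction k with
    | zero => simpa [flowStep, eventTime] using NearOne.one
    | succ k ih =>
      have h2 := ((NearOne.one_add_smul c (sq_nonneg (L.jumpSize (L.N s ω + (k + 1)) ω))).mul
        (NearOne.exp_smul b (sub_nonneg.2 (L.eventTime_le_succ hs hst hk)))).mul (ih (by omega))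
      refine h2.mono (le_of_eq ?_)
      rw [← add_assoc, Finset.prod_Ioc_succ_top (by omega),
        ← sub_add_sub_cancel (eventTime L s ω (k + 1)) (eventTime L s ω k) s,
        add_mul (eventTime L s ω (k + 1) - eventTime L s ω k), Real.exp_add]
      ring
  have h2 := (NearOne.exp_smul b (sub_nonneg.2 (L.eventTime_le (ω := ω) hs hst le_rfl))).mul
    (key _ le_rfl)
  refine h2.mono (le_of_eq ?_)
  rw [Nat.add_sub_cancel' h1, ← sub_add_sub_cancel t (eventTime L s ω (L.N t ω - L.N s ω)) s,
    add_mul, Real.exp_add, mul_assoc]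

/-! ### Euler products -/

/-- The arrivals are simple, uniformly on bounded intervals. -/
def Simple (ω : Ω) : Prop :=
  ∀ T : ℝ, ∃ ε > 0, ∀ u v, 0 ≤ u → u ≤ v → v ≤ T → v - u < ε → L.N v ω ≤ L.N u ω + 1

lemma flow_eq_revProd (b c : 𝔸) {w : ℕ → ℝ} (hw : Monotone w) (h0 : 0 ≤ w 0) (ω : Ω) (n : ℕ) :
    L.flow b c (w 0) (w n) ω = revProd (fun i => L.flow b c (w i) (w (i + 1)) ω) n := by
  induction n with
  | zero => simp [revProd, flow_self]
  | succ n ih =>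
    rw [revProd, ← ih]
    exact L.flow_mul b c h0 (hw (Nat.zero_le n)) (hw (Nat.le_succ n)) ω

/-- Steps shorter than ε contain at most one arrival. Steps without an arrival contribute no error,
and a step with one arrival contributes a relative error 2(e^{δ‖b‖} - 1) by `norm_exp_mul_sub_le`.
The number of arrivals is fixed while δ tends to 0, so the total error vanishes. -/
lemma tendsto_euler [NormOneClass 𝔸] (b c : 𝔸) {s t : ℝ} (hs : 0 ≤ s) (hst : s ≤ t) {ω : Ω}
    (hω : L.Simple ω) :
    Tendsto (fun n => euler b c s t n (fun u => L.X u ω)) atTop (𝓝 (L.flow b c s t ω)) := by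
  obtain ⟨ε, hε, hsimple⟩ := hω t
  have hδ : Tendsto (fun n : ℕ => (t - s) / n) atTop (𝓝 0) :=
    tendsto_const_div_atTop_nhds_zero_nat _
  set M : ℝ := Real.exp ((t - s) * ‖b‖)
      * ∏ n ∈ Finset.Ioc (L.N s ω) (L.N t ω), (1 + L.jumpSize n ω ^ 2 * ‖c‖) with hM
  have hlim : Tendsto (fun n : ℕ => M * (2 * (Real.exp ((t - s) / n * ‖b‖) - 1)
      * ((L.N t ω : ℝ) - L.N s ω))) atTop (𝓝 0) := by
    have : Tendsto (fun n : ℕ => M * (2 * (Real.exp ((t - s) / n * ‖b‖) - 1)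
      * ((L.N t ω : ℝ) - L.N s ω))) atTop (𝓝 (M * (2 * (Real.exp (0 * ‖b‖) - 1)
      * ((L.N t ω : ℝ) - L.N s ω)))) := by
      refine Tendsto.const_mul _ (Tendsto.mul_const _ (Tendsto.const_mul _ ?_))
      exact ((Real.continuous_exp.tendsto _).comp (hδ.mul_const _)).sub_const 1
    simpa using this
  rw [tendsto_iff_norm_sub_tendsto_zero]
  refine squeeze_zero' (Eventually.of_forall fun _ => norm_nonneg _) ?_ hlim
  filter_upwards [hδ.eventually (gt_mem_nhds hε), eventually_gt_atTop 0] with n hn hn0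
  set δ := (t - s) / n with hδdef
  have hn0' : (0 : ℝ) < n := by exact_mod_cast hn0
  have hδ0 : 0 ≤ δ := div_nonneg (by linarith) hn0'.le
  have hnδ : n * δ = t - s := by rw [hδdef]; field_simp
  set w : ℕ → ℝ := fun i => s + i * δ with hw
  have hwsucc : ∀ i, w (i + 1) = w i + δ := fun i => by simp only [hw]; push_cast; ring
  have hwm : Monotone w := monotone_nat_of_le_succ fun i => by rw [hwsucc]; linarith
  have hw0 : w 0 = s := by simp [hw]
  have hwn : w n = t := by simp only [hw, hnδ]; ring
  have hwnn : ∀ i, 0 ≤ w i := fun i => hs.trans (hw0 ▸ hwm (Nat.zero_le i))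
  have hflow := L.flow_eq_revProd b c hwm (hwnn 0) ω n
  rw [hw0, hwn] at hflow
  have heul : euler b c s t n (fun u => L.X u ω)
      = revProd (fun i => (1 + (L.X (w (i + 1)) ω - L.X (w i) ω) ^ 2 • c)
        * NormedSpace.exp (δ • b)) n := rfl
  set a : ℕ → ℝ := fun i => Real.exp (δ * ‖b‖)
    * ∏ k ∈ Finset.Ioc (L.N (w i) ω) (L.N (w (i + 1)) ω), (1 + L.jumpSize k ω ^ 2 * ‖c‖) with ha
  set d : ℕ → ℝ := fun i => 2 * (Real.exp (δ * ‖b‖) - 1)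
    * ((L.N (w (i + 1)) ω : ℝ) - L.N (w i) ω) with hd
  have hNm : ∀ i, L.N (w i) ω ≤ L.N (w (i + 1)) ω := fun i =>
    L.N_mono ω _ _ (hwnn i) (hwm i.le_succ)
  -- The bounds of the individual steps multiply to a constant that does not depend on the number of
  -- steps.
  have hprod : ∏ i ∈ Finset.range n, a i = M := by
    have : ∀ k, ∏ i ∈ Finset.range k, a i = Real.exp (k * δ * ‖b‖)
        * ∏ j ∈ Finset.Ioc (L.N (w 0) ω) (L.N (w k) ω), (1 + L.jumpSize j ω ^ 2 * ‖c‖) := by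
      intro k
      induction k with
      | zero => simp
      | succ k ih =>
        rw [Finset.prod_range_succ, ih, ← Finset.prod_Ioc_consecutive _
          (L.N_mono ω _ _ (hwnn 0) (hwm (Nat.zero_le k))) (hNm k)]
        push_cast
        rw [add_mul, add_mul, Real.exp_add, one_mul]
        ring
    rw [this, hw0, hwn, hnδ]
  have hsum : ∑ i ∈ Finset.range n, d i
      = 2 * (Real.exp (δ * ‖b‖) - 1) * ((L.N t ω : ℝ) - L.N s ω) := by
    rw [← Finset.mul_sum, Finset.sum_range_sub (fun i => (L.N (w i) ω : ℝ)), hw0, hwn]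
  rw [heul, hflow, norm_sub_rev, ← hprod, ← hsum]
  have hcase : ∀ i < n, L.N (w (i + 1)) ω = L.N (w i) ω ∨ L.N (w (i + 1)) ω = L.N (w i) ω + 1 := by
    intro i hi
    have h1 := hNm i
    have h2 := hsimple (w i) (w (i + 1)) (hwnn i) (hwm i.le_succ) (hwn ▸ hwm hi)
      (by rw [hwsucc]; linarith)
    omega
  have hX : ∀ i, L.X (w (i + 1)) ω - L.X (w i) ω
      = ∑ k ∈ Finset.Ioc (L.N (w i) ω) (L.N (w (i + 1)) ω), L.jumpSize k ω := fun i =>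
    L.X_sub (hwnn i) (hwm i.le_succ) ω
  have hΔ : ∀ i, w (i + 1) - w i = δ := fun i => by rw [hwsucc]; ring
  refine norm_revProd_sub_le (fun i _ => ?_) (fun i hi => ?_) (fun i hi => ?_)
  · have := L.flow_nearOne b c (hwnn i) (hwm i.le_succ) ω
    rwa [hΔ] at this
  · rcases hcase i hi with h | h
    · simp only [hX, ha, h, Finset.Ioc_self, Finset.sum_empty, Finset.prod_empty, mul_one]
      simpa using NearOne.exp_smul b hδ0
    · simp only [hX, ha, h, Nat.Ioc_succ_singleton, Finset.sum_singleton, Finset.prod_singleton]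
      rw [mul_comm (Real.exp _)]
      exact (NearOne.one_add_smul c (sq_nonneg _)).mul (NearOne.exp_smul b hδ0)
  · rcases hcase i hi with h | h
    · rw [L.flow_of_N_eq b c h, hΔ]
      simp [hX, hd, h]
    · rw [L.flow_of_N_eq_succ b c h]
      have hx : L.X (w (i + 1)) ω - L.X (w i) ω = L.jumpSize (L.N (w (i + 1)) ω) ω := by
        rw [hX]; simp only [h, Nat.Ioc_succ_singleton, Finset.sum_singleton]
      have hpr : a i = Real.exp (δ * ‖b‖)
          * (1 + L.jumpSize (L.N (w (i + 1)) ω) ω ^ 2 * ‖c‖) := by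
        simp only [ha, h, Nat.Ioc_succ_singleton, Finset.prod_singleton]
      have hdi : d i = 2 * (Real.exp (δ * ‖b‖) - 1) := by
        simp only [hd, h]; push_cast; ring
      rw [hx, hpr, hdi]
      set θ := L.arrival (L.N (w (i + 1)) ω) ω
      have hθ1 : θ ≤ w (i + 1) := L.arrival_le (hwnn _) le_rfl
      have hθ2 : w i ≤ θ := (L.lt_arrival (hwnn i) (hwnn (i + 1)) le_rfl (by omega)).le
      have hs : (w (i + 1) - θ) + (θ - w i) = δ := by rw [← hΔ i]; ring
      rw [← hs]
      exact norm_exp_mul_sub_le b c (sub_nonneg.2 hθ2) (sub_nonneg.2 hθ1) (sq_nonneg _)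

end SSCogarch.SimpleSemiLevy

/-! ### Càdlàg paths -/

section Cadlag

variable {E : Type*} [NormedAddCommGroup E]

/-- One-sided limits bound the path near each point, and compactness of the interval makes the bound
uniform. -/
lemma exists_norm_le_of_cadlag {y : ℝ → E} (hr : ∀ t, 0 ≤ t → ContinuousWithinAt y (Ici t) t)
    (hl : ∀ t, 0 < t → ∃ z, Tendsto y (𝓝[<] t) (𝓝 z)) (T : ℝ) :
    ∃ C, ∀ t ∈ Icc 0 T, ‖y t‖ ≤ C := by
  have h : Bornology.IsBounded (y '' Icc 0 T) := by
    refine isCompact_Icc.induction_on (p := fun s => Bornology.IsBounded (y '' s)) (by simp)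
      (fun s t hst ht => ht.subset (image_mono hst))
      (fun s t hs ht => by rw [image_union]; exact hs.union ht) fun x hx => ?_
    have key : ∀ (f : Filter ℝ) (z : E), Tendsto y f (𝓝 z) →
        ∃ s ∈ f, Bornology.IsBounded (y '' s) := fun f z hf =>
      ⟨y ⁻¹' Metric.ball z 1, hf (Metric.ball_mem_nhds z one_pos),
        Metric.isBounded_ball.subset (image_preimage_subset _ _)⟩
    obtain ⟨s, hs, hsb⟩ := key _ _ (hr x hx.1)
    rcases hx.1.eq_or_lt with h0 | h0
    · exact ⟨s, nhdsWithin_mono _ (fun u hu => h0 ▸ hu.1) hs, hsb⟩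
    · obtain ⟨z, hz⟩ := hl x h0
      obtain ⟨s', hs', hsb'⟩ := key _ _ hz
      refine ⟨s' ∪ s, mem_nhdsWithin_of_mem_nhds ?_, by rw [image_union]; exact hsb'.union hsb⟩
      rw [← nhdsLT_sup_nhdsGE]
      exact ⟨mem_of_superset hs' subset_union_left, mem_of_superset hs subset_union_right⟩
  obtain ⟨C, hC⟩ := h.exists_norm_le
  exact ⟨C, fun t ht => hC _ (mem_image_of_mem _ ht)⟩

/-- The sequence consists of the largest points of the grid with mesh 1/(n+1) that lie strictly left
of s. Sampling a path there exhibits its left limits as limits of functions that are constant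
between grid points. -/
lemma tendsto_grid_left (s : ℝ) :
    Tendsto (fun n : ℕ => ((⌈((n : ℝ) + 1) * s⌉ - 1 : ℤ) : ℝ) / ((n : ℝ) + 1)) atTop (𝓝[<] s) := by
  refine tendsto_nhdsWithin_iff.2 ⟨?_, Eventually.of_forall fun n => ?_⟩
  · have h1 : Tendsto (fun n : ℕ => s - 1 / ((n : ℝ) + 1)) atTop (𝓝 s) := by
      simpa using tendsto_one_div_add_atTop_nhds_zero_nat.const_sub s
    refine tendsto_of_tendsto_of_tendsto_of_le_of_le h1 tendsto_const_nhds (fun n => ?_)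
      fun n => ?_
    · have hn : (0 : ℝ) < (n : ℝ) + 1 := by positivity
      rw [le_div_iff₀ hn, sub_mul, one_div, inv_mul_cancel₀ hn.ne']
      have := Int.le_ceil (((n : ℝ) + 1) * s)
      push_cast
      linarith
    · have hn : (0 : ℝ) < (n : ℝ) + 1 := by positivity
      rw [div_le_iff₀ hn]
      have := Int.ceil_lt_add_one (((n : ℝ) + 1) * s)
      push_cast
      linarith
  · have hn : (0 : ℝ) < (n : ℝ) + 1 := by positivity
    rw [mem_Iio, div_lt_iff₀ hn]
    have := Int.ceil_lt_add_one (((n : ℝ) + 1) * s)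
    push_cast
    linarith

lemma intervalIntegrable_leftLim [SecondCountableTopology E] {y : ℝ → E}
    (hr : ∀ t, 0 ≤ t → ContinuousWithinAt y (Ici t) t)
    (hl : ∀ t, 0 < t → ∃ z, Tendsto y (𝓝[<] t) (𝓝 z)) {a b : ℝ} (ha : 0 ≤ a) (hab : a ≤ b) :
    IntervalIntegrable (Function.leftLim y) volume a b := by
  borelize E
  obtain ⟨C, hC⟩ := exists_norm_le_of_cadlag hr hl b
  rw [intervalIntegrable_iff_integrableOn_Ioc_of_le hab]
  refine IntegrableOn.of_bound (C := C) (by simp) ?_ ?_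
  · refine aestronglyMeasurable_of_tendsto_ae (μ := volume.restrict (Ioc a b)) atTop
      (f := fun (n : ℕ) s => y (((⌈((n : ℝ) + 1) * s⌉ - 1 : ℤ) : ℝ) / ((n : ℝ) + 1))) (fun n => ?_) ?_
    -- The sampled path factors through an integer, so it is measurable without any measurability of
    -- y.
    · refine Measurable.aestronglyMeasurable ?_
      exact (measurable_from_top (f := fun k : ℤ => y (((k - 1 : ℤ) : ℝ) / ((n : ℝ) + 1)))).comp
        (Int.measurable_ceil.comp (measurable_id.const_mul _))
    · filter_upwards [ae_restrict_mem measurableSet_Ioc] with s hs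
      exact (tendsto_leftLim_of_tendsto (hl s (ha.trans_lt hs.1))).comp (tendsto_grid_left s)
  · filter_upwards [ae_restrict_mem measurableSet_Ioc] with s hs
    have hs0 := ha.trans_lt hs.1
    refine le_of_tendsto (tendsto_leftLim_of_tendsto (hl s hs0)).norm ?_
    filter_upwards [Ioo_mem_nhdsLT hs0] with u hu
    exact hC u ⟨hu.1.le, hu.2.le.trans hs.2⟩

end Cadlag

/-! ### Linear equations written with left limits -/

section LinearODE

attribute [local instance] Matrix.linftyOpNormedRing Matrix.linftyOpNormedAlgebra

variable {ι : Type*} [Fintype ι] [DecidableEq ι]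

/-- A path with `y u = y a + ∫ₐᵘ M y(s-) ds` on `[a, b]` is `exp ((u - a) M) (y a)`. -/
lemma eq_exp_mulVec_of_integral_leftLim {M : Matrix ι ι ℝ} {y : ℝ → ι → ℝ} {a b : ℝ}
    (hint : IntervalIntegrable (Function.leftLim y) volume a b)
    (h : ∀ u ∈ Icc a b, y u = y a + ∫ s in a..u, M *ᵥ Function.leftLim y s) :
    ∀ u ∈ Icc a b, y u = NormedSpace.exp ((u - a) • M) *ᵥ y a := by
  intro u₀ hu₀
  have hab : a ≤ b := hu₀.1.trans hu₀.2
  let Mc : (ι → ℝ) →L[ℝ] (ι → ℝ) := (Matrix.mulVecLin M).toContinuousLinearMap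
  have hMc : ∀ x, Mc x = M *ᵥ x := fun x => rfl
  have hint' : IntegrableOn (fun s => M *ᵥ Function.leftLim y s) (uIcc a b) volume := by
    rw [uIcc_of_le hab, integrableOn_Icc_iff_integrableOn_Ioc,
      ← intervalIntegrable_iff_integrableOn_Ioc_of_le hab]
    exact ⟨Mc.integrable_comp hint.1, Mc.integrable_comp hint.2⟩
  have hcont : ContinuousOn y (Icc a b) := by
    have := intervalIntegral.continuousOn_primitive_interval hint'
    rw [uIcc_of_le hab] at this
    exact (continuousOn_const.add this).congr h
  -- The integral equation makes y continuous on [a, b], so left limits inside are plain values. At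
  -- a itself they may differ, which does not affect the integral.
  have hleft : ∀ s ∈ Ioc a b, Function.leftLim y s = y s := by
    intro s hs
    refine leftLim_eq_of_tendsto ?_
    have h1 := hcont s ⟨hs.1.le, hs.2⟩
    refine h1.mono_left (nhdsWithin_le_of_mem ?_)
    exact mem_of_superset (Ioo_mem_nhdsLT hs.1) fun v hv => ⟨hv.1.le, hv.2.le.trans hs.2⟩
  -- Freezing y outside [a, b] gives a continuous integrand on the whole line, so the primitive F is
  -- differentiable everywhere. It agrees with y on [a, b], and uniqueness for the linear equation
  -- identifies it with the exponential.
  set V : ℝ → ι → ℝ := fun s => y (max a (min b s)) with hV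
  have hproj : ∀ s ∈ Icc a b, max a (min b s) = s := fun s hs => by
    rw [min_eq_right hs.2, max_eq_right hs.1]
  have hVc : Continuous V := by
    refine hcont.comp_continuous (by fun_prop) fun s => ⟨le_max_left _ _, max_le hab (min_le_left _ _)⟩
  set F : ℝ → ι → ℝ := fun u => y a + ∫ s in a..u, M *ᵥ V s with hF
  have hMV : Continuous fun s => M *ᵥ V s := Mc.continuous.comp hVc
  have hFy : ∀ u ∈ Icc a b, F u = y u := by
    intro u hu
    rw [h u hu, hF]
    dsimp only
    congr 1
    refine intervalIntegral.integral_congr_ae (Eventually.of_forall fun s hs => ?_)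
    rw [uIoc_of_le hu.1] at hs
    have hs' : s ∈ Ioc a b := ⟨hs.1, hs.2.trans hu.2⟩
    rw [hleft s hs', hV]
    dsimp only
    rw [hproj s ⟨hs'.1.le, hs'.2⟩]
  have hFd : ∀ u, HasDerivAt F (M *ᵥ V u) u := fun u =>
    (intervalIntegral.integral_hasDerivAt_right (hMV.intervalIntegrable _ _)
      (hMV.stronglyMeasurableAtFilter _ _) hMV.continuousAt).const_add _
  set G : ℝ → ι → ℝ := fun u => NormedSpace.exp ((u - a) • M) *ᵥ y a with hG
  have hGd : ∀ u, HasDerivAt G (M *ᵥ G u) u := by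
    intro u
    have h1 : HasDerivAt (fun u : ℝ => NormedSpace.exp ((u - a) • M))
        (M * NormedSpace.exp ((u - a) • M)) u := by
      have := (hasDerivAt_exp_smul_const' (𝕂 := ℝ) M (u - a)).scomp u ((hasDerivAt_id u).sub_const a)
      rw [one_smul] at this
      exact this
    have h2 := ((Matrix.mulVecBilin ℝ ℝ).flip (y a)).toContinuousLinearMap.hasFDerivAt.comp_hasDerivAt u h1
    have e : M *ᵥ G u = (M * NormedSpace.exp ((u - a) • M)) *ᵥ y a := by
      rw [hG]; exact Matrix.mulVec_mulVec _ _ _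
    rw [e]
    exact h2
  have huniq : EqOn F G (Icc a b) := by
    refine ODE_solution_unique (v := fun _ x => M *ᵥ x) (K := ‖Mc‖₊) (fun _ => Mc.lipschitz)
      (fun u _ => (hFd u).continuousAt.continuousWithinAt) (fun u hu => ?_)
      (fun u _ => (hGd u).continuousAt.continuousWithinAt) (fun u _ => (hGd u).hasDerivWithinAt) ?_
    · have hu' : u ∈ Icc a b := ⟨hu.1, hu.2.le⟩
      have e : V u = F u := by rw [hFy u hu', hV]; dsimp only; rw [hproj u hu']
      have := (hFd u).hasDerivWithinAt (s := Ici u)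
      rwa [e] at this
    · simp [hF, hG]
  rw [← hFy u₀ hu₀, huniq hu₀]

end LinearODE

namespace SSCogarch.SimpleSemiLevy

variable {Ω : Type*} [MeasurableSpace Ω] {P : Measure Ω} (L : SimpleSemiLevy Ω P)

/-! ### Jumps of the paths -/

/-- On [0, u) the values of N are integers bounded by N(u), so the maximum is attained, and from
there on monotonicity keeps N constant. -/
lemma exists_N_eq_left {ω : Ω} {u : ℝ} (hu : 0 < u) :
    ∃ r ∈ Ico 0 u, ∀ v ∈ Ico r u, L.N v ω = L.N r ω := by
  have hne : ∃ m, m ∈ (fun v => L.N v ω) '' Ico 0 u := ⟨_, mem_image_of_mem _ ⟨le_rfl, hu⟩⟩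
  have hbdd : ∀ m ∈ (fun v => L.N v ω) '' Ico 0 u, m ≤ L.N u ω := by
    rintro _ ⟨v, hv, rfl⟩
    exact L.N_mono ω v u hv.1 hv.2.le
  obtain ⟨r, hr, hmax⟩ := Nat.sSup_mem hne ⟨_, hbdd⟩
  refine ⟨r, hr, fun v hv => le_antisymm ?_ (L.N_mono ω r v hr.1 hv.1)⟩
  dsimp only at hmax
  rw [hmax]
  exact le_csSup ⟨_, hbdd⟩ (mem_image_of_mem _ ⟨hr.1.trans hv.1, hv.2⟩)

lemma S_eq (t : ℝ) (ω : Ω) : L.S t ω = L.D t + L.X t ω := rfl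

lemma X_eq_of_N_eq {u v : ℝ} {ω : Ω} (h : L.N u ω = L.N v ω) : L.X u ω = L.X v ω := by
  simp [X, h]

lemma jump_S_eq {ω : Ω} {r u : ℝ} (hr : r ∈ Ico 0 u) (h : ∀ v ∈ Ico r u, L.N v ω = L.N r ω) :
    jump (fun v => L.S v ω) u = L.X u ω - L.X r ω := by
  have hlim : Tendsto (fun v => L.S v ω) (𝓝[<] u) (𝓝 (L.D u + L.X r ω)) := by
    have hD : Tendsto L.D (𝓝[<] u) (𝓝 (L.D u)) := by
      refine (L.D_cont u (hr.1.trans hr.2.le)).mono_left (nhdsWithin_le_of_mem ?_)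
      exact mem_of_superset (Ioo_mem_nhdsLT hr.2) fun v hv => hr.1.trans hv.1.le
    refine (hD.add_const (L.X r ω)).congr' ?_
    filter_upwards [Ioo_mem_nhdsLT hr.2] with v hv
    rw [S_eq, L.X_eq_of_N_eq (h v ⟨hv.1.le, hv.2⟩)]
  rw [jump, leftLim_eq_of_tendsto hlim, S_eq]
  ring

/-- Just before the arrival time fewer than n arrivals have occurred, and simplicity allows at most
one more at that time. -/
lemma N_arrival {ω : Ω} (hω : L.Simple ω) {n : ℕ} {T : ℝ} (hT : 0 ≤ T) (hn1 : 1 ≤ n)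
    (hn : n ≤ L.N T ω) : L.N (L.arrival n ω) ω = n := by
  have hge := L.le_N_arrival hT hn
  have hpos : 0 < L.arrival n ω := L.lt_arrival le_rfl hT hn (by rw [L.N_zero]; omega)
  obtain ⟨r, hr, hconst⟩ := L.exists_N_eq_left (ω := ω) hpos
  obtain ⟨ε, hε, hs⟩ := hω (L.arrival n ω)
  set v := max r (L.arrival n ω - ε / 2)
  have hv1 : v < L.arrival n ω := max_lt hr.2 (by linarith)
  have hv0 : 0 ≤ v := hr.1.trans (le_max_left _ _)
  have h1 := hs v _ hv0 hv1.le le_rfl (by have := le_max_right r (L.arrival n ω - ε / 2); linarith)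
  have h2 : L.N v ω < n := by
    by_contra! h
    exact absurd (L.arrival_le hv0 h) (not_le.2 hv1)
  omega

lemma jump_S_arrival {ω : Ω} (hω : L.Simple ω) {n : ℕ} {T : ℝ} (hT : 0 ≤ T) (hn1 : 1 ≤ n)
    (hn : n ≤ L.N T ω) : jump (fun v => L.S v ω) (L.arrival n ω) = L.jumpSize n ω := by
  have hN := L.N_arrival hω hT hn1 hn
  have hpos : 0 < L.arrival n ω := L.lt_arrival le_rfl hT hn (by rw [L.N_zero]; omega)
  obtain ⟨r, hr, hconst⟩ := L.exists_N_eq_left (ω := ω) hpos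
  obtain ⟨ε, hε, hs⟩ := hω (L.arrival n ω)
  set v := max r (L.arrival n ω - ε / 2)
  have hv1 : v < L.arrival n ω := max_lt hr.2 (by linarith)
  have hv0 : 0 ≤ v := hr.1.trans (le_max_left _ _)
  have h1 := hs v _ hv0 hv1.le le_rfl (by have := le_max_right r (L.arrival n ω - ε / 2); linarith)
  have h2 : L.N v ω < n := by
    by_contra! h
    exact absurd (L.arrival_le hv0 h) (not_le.2 hv1)
  have h3 : L.N r ω = n - 1 := by rw [← hconst v ⟨le_max_left _ _, hv1⟩]; omega
  rw [L.jump_S_eq hr hconst, L.X_sub hr.1 hr.2.le, hN, h3]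
  obtain ⟨m, rfl⟩ : ∃ m, n = m + 1 := ⟨n - 1, by omega⟩
  simp

lemma exists_arrival_of_jump_ne_zero {ω : Ω} {u : ℝ} (hu : 0 < u)
    (h : jump (fun v => L.S v ω) u ≠ 0) : ∃ n ∈ Finset.Icc 1 (L.N u ω), L.arrival n ω = u := by
  obtain ⟨r, hr, hconst⟩ := L.exists_N_eq_left (ω := ω) hu
  rw [L.jump_S_eq hr hconst] at h
  have hlt : L.N r ω < L.N u ω := by
    refine lt_of_le_of_ne (L.N_mono ω r u hr.1 hr.2.le) fun he => h ?_
    rw [L.X_eq_of_N_eq he, sub_self]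
  refine ⟨L.N u ω, Finset.mem_Icc.2 ⟨by omega, le_rfl⟩, le_antisymm (L.arrival_le hu.le le_rfl) ?_⟩
  refine le_of_forall_lt fun v hv => ?_
  have hv' : max v r < u := max_lt hv hr.2
  have h0 : 0 ≤ max v r := hr.1.trans (le_max_right _ _)
  refine (le_max_left v r).trans_lt (L.lt_arrival h0 hu.le le_rfl ?_)
  rwa [hconst _ ⟨le_max_right _ _, hv'⟩]

/-- Since D is continuous, S can jump only at arrivals, so the sum over all times has finite
support. An arrival whose jump size is zero contributes zero on both sides, and distinct arrivals
have distinct times by `N_arrival`. -/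
lemma tsum_jump_sq {ω : Ω} (hω : L.Simple ω) {E : Type*} [AddCommGroup E] [TopologicalSpace E]
    [Module ℝ E] (g : ℝ → ℝ) (e : E) {t : ℝ} (ht : 0 ≤ t) :
    ∑' u : Ioc (0 : ℝ) t, (g u * jump (fun v => L.S v ω) u ^ 2) • e
      = ∑ n ∈ Finset.Icc 1 (L.N t ω), (g (L.arrival n ω) * L.jumpSize n ω ^ 2) • e := by
  have hinj : Set.InjOn (fun n => L.arrival n ω) (Finset.Icc 1 (L.N t ω)) := by
    intro n hn m hm h
    rw [Finset.mem_coe, Finset.mem_Icc] at hn hm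
    rw [← L.N_arrival hω ht hn.1 hn.2, ← L.N_arrival hω ht hm.1 hm.2]
    exact congrArg (fun x => L.N x ω) h
  rw [tsum_subtype (Ioc 0 t) (fun u => (g u * jump (fun v => L.S v ω) u ^ 2) • e),
    tsum_eq_sum (s := (Finset.Icc 1 (L.N t ω)).image fun n => L.arrival n ω),
    Finset.sum_image hinj]
  · refine Finset.sum_congr rfl fun n hn => ?_
    rw [Finset.mem_Icc] at hn
    have hpos : 0 < L.arrival n ω := L.lt_arrival le_rfl ht hn.2 (by rw [L.N_zero]; omega)
    rw [indicator_of_mem (show L.arrival n ω ∈ Ioc 0 t from ⟨hpos, L.arrival_le ht hn.2⟩),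
      L.jump_S_arrival hω ht hn.1 hn.2]
  · intro u hu
    by_cases hmem : u ∈ Ioc 0 t
    · rw [indicator_of_mem hmem]
      by_contra hne
      have hj : jump (fun v => L.S v ω) u ≠ 0 := fun h0 => hne (by simp [h0])
      obtain ⟨n, hn, rfl⟩ := L.exists_arrival_of_jump_ne_zero hmem.1 hj
      refine hu (Finset.mem_image.2 ⟨n, ?_, rfl⟩)
      rw [Finset.mem_Icc] at hn ⊢
      exact ⟨hn.1, hn.2.trans (L.N_mono ω _ _ hmem.1.le hmem.2)⟩
    · rw [indicator_of_notMem hmem]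

end SSCogarch.SimpleSemiLevy

namespace SSCogarch

variable {Ω : Type*} [MeasurableSpace Ω] {P : Measure Ω} (L : SimpleSemiLevy Ω P)
  {q : ℕ} (C : Params q)

/-! ### The solution of the state equation -/

lemma ea_mulVec (v : Fin q → ℝ) : C.ea *ᵥ v = (C.a ⬝ᵥ v) • C.e := by
  rw [Params.ea, Matrix.vecMulVec_mulVec]
  ext i; simp [mul_comm]

/-- Induction over the arrivals. Between two arrivals the jump sum is constant and the state solves
a linear equation, hence moves by the matrix exponential. At an arrival the jump term adds (α₀ +
a'Y_-) Z² e to the left limit, which is exactly the recursion defining `stepJ` and `stepK`. -/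
lemma state_eq {y : ℝ → Fin q → ℝ} {ω : Ω} (hω : L.Simple ω)
    (hr : ∀ t, 0 ≤ t → ContinuousWithinAt y (Ici t) t)
    (hl : ∀ t, 0 < t → ∃ z, Tendsto y (𝓝[<] t) (𝓝 z))
    (hsde : ∀ t, 0 ≤ t → y t = y 0 + (∫ s in (0 : ℝ)..t, C.B *ᵥ Function.leftLim y s)
      + ∑' u : Ioc (0 : ℝ) t, ((C.α₀ + C.a ⬝ᵥ Function.leftLim y u)
            * jump (fun v => L.S v ω) u ^ 2) • C.e) {t : ℝ} (ht : 0 ≤ t) :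
    y t = J L C 0 t ω *ᵥ y 0 + K L C 0 t ω := by
  have hint : ∀ {a b : ℝ}, 0 ≤ a → a ≤ b → IntervalIntegrable (Function.leftLim y) volume a b :=
    fun ha hab => intervalIntegrable_leftLim hr hl ha hab
  have hintB : ∀ {a b : ℝ}, 0 ≤ a → a ≤ b →
      IntervalIntegrable (fun s => C.B *ᵥ Function.leftLim y s) volume a b := fun ha hab => by
    let Mc : (Fin q → ℝ) →L[ℝ] (Fin q → ℝ) := (Matrix.mulVecLin C.B).toContinuousLinearMap
    exact ⟨Mc.integrable_comp (hint ha hab).1, Mc.integrable_comp (hint ha hab).2⟩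
  set g : ℝ → ℝ := fun u => C.α₀ + C.a ⬝ᵥ Function.leftLim y u with hg
  have hsde' : ∀ t, 0 ≤ t → y t = y 0 + (∫ s in (0 : ℝ)..t, C.B *ᵥ Function.leftLim y s)
      + ∑ n ∈ Finset.Icc 1 (L.N t ω), (g (L.arrival n ω) * L.jumpSize n ω ^ 2) • C.e := by
    intro t ht
    rw [hsde t ht, L.tsum_jump_sq hω g C.e ht]
  have hdiff : ∀ {a b : ℝ}, 0 ≤ a → a ≤ b → y b = y a
      + (∫ s in a..b, C.B *ᵥ Function.leftLim y s)
      + ∑ n ∈ Finset.Ioc (L.N a ω) (L.N b ω), (g (L.arrival n ω) * L.jumpSize n ω ^ 2) • C.e := by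
    intro a b ha hab
    have e : ∀ k, Finset.Icc 1 k = Finset.Ioc 0 k := fun k => by ext; simp; omega
    rw [hsde' b (ha.trans hab), hsde' a ha,
      ← intervalIntegral.integral_add_adjacent_intervals (hintB le_rfl ha) (hintB ha hab)]
    simp only [e]
    rw [← Finset.sum_Ioc_consecutive _ (Nat.zero_le _) (L.N_mono ω a b ha hab)]
    abel
  have hflow : ∀ {a b : ℝ}, 0 ≤ a → a ≤ b → L.N b ω = L.N a ω →
      y b = NormedSpace.exp ((b - a) • C.B) *ᵥ y a := by
    intro a b ha hab hN
    refine eq_exp_mulVec_of_integral_leftLim (hint ha hab) (fun u hu => ?_) b ⟨hab, le_rfl⟩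
    have h1 := L.N_mono ω a u ha hu.1
    have h2 := L.N_mono ω u b (ha.trans hu.1) hu.2
    rw [hdiff ha hu.1, show L.N u ω = L.N a ω by omega]
    simp
  have hev0 : ∀ k, 0 ≤ eventTime L 0 ω k := fun k => by
    unfold eventTime; split_ifs; exacts [le_rfl, L.arrival_nonneg _ _]
  have hNev : ∀ k ≤ L.N t ω, L.N (eventTime L 0 ω k) ω = k := by
    intro k hk
    unfold eventTime
    split_ifs with h0
    · rw [h0, L.N_zero]
    · rw [L.N_zero, zero_add]
      exact L.N_arrival hω ht (by omega) hk
  have key : ∀ k ≤ L.N t ω,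
      y (eventTime L 0 ω k) = stepJ L C 0 ω k *ᵥ y 0 + stepK L C 0 ω k := by
    intro k hk
    induction k with
    | zero => simp [eventTime, stepJ, stepK]
    | succ k ih =>
      have ih := ih (by omega)
      set a := eventTime L 0 ω k with ha
      have hb : eventTime L 0 ω (k + 1) = L.arrival (k + 1) ω := by
        simp [eventTime, L.N_zero]
      have hNa : L.N a ω = k := hNev k (by omega)
      have hNb := hNev (k + 1) hk
      rw [hb] at hNb
      have hab : a < L.arrival (k + 1) ω := L.lt_arrival (hev0 k) ht hk (by omega)
      have hconst : ∀ u ∈ Ico a (L.arrival (k + 1) ω), L.N u ω = L.N a ω := by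
        intro u hu
        have h1 := L.N_mono ω a u (hev0 k) hu.1
        have h2 : ¬ (k + 1 ≤ L.N u ω) := fun h =>
          absurd (L.arrival_le ((hev0 k).trans hu.1) h) (not_le.2 hu.2)
        omega
      have hlimY : Function.leftLim y (L.arrival (k + 1) ω)
          = NormedSpace.exp ((L.arrival (k + 1) ω - a) • C.B) *ᵥ y a := by
        have hcont : Continuous fun u : ℝ => NormedSpace.exp ((u - a) • C.B) *ᵥ y a := by
          have h1 : Continuous fun u : ℝ => NormedSpace.exp ((u - a) • C.B) := by
            let _ := Matrix.linftyOpNormedRing (n := Fin q) (α := ℝ)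
            let _ := Matrix.linftyOpNormedAlgebra (n := Fin q) (R := ℝ) (α := ℝ)
            have h0 : Continuous fun u : ℝ => NormedSpace.exp (u • C.B) :=
              continuous_iff_continuousAt.2 fun u =>
                (hasDerivAt_exp_smul_const' (𝕂 := ℝ) C.B u).continuousAt
            exact h0.comp (continuous_sub_right a)
          exact h1.matrix_mulVec continuous_const
        refine leftLim_eq_of_tendsto ((hcont.tendsto _).mono_left nhdsWithin_le_nhds |>.congr' ?_)
        filter_upwards [Ioo_mem_nhdsLT hab] with u hu
        exact (hflow (hev0 k) hu.1.le (hconst u ⟨hu.1.le, hu.2⟩)).symm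
      -- The same left limit, now from the integral form. It identifies the continuous part of the
      -- increment up to the arrival, so the state at the arrival is the left limit plus the jump.
      have hlimY' : Function.leftLim y (L.arrival (k + 1) ω)
          = y a + ∫ s in a..L.arrival (k + 1) ω, C.B *ᵥ Function.leftLim y s := by
        have hc : ContinuousOn (fun u => y a + ∫ s in a..u, C.B *ᵥ Function.leftLim y s)
            (Icc a (L.arrival (k + 1) ω)) := by
          refine continuousOn_const.add ?_
          have := intervalIntegral.continuousOn_primitive_interval (a := a)
            (b := L.arrival (k + 1) ω) (f := fun s => C.B *ᵥ Function.leftLim y s) (μ := volume) (by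
              rw [uIcc_of_le hab.le, integrableOn_Icc_iff_integrableOn_Ioc,
                ← intervalIntegrable_iff_integrableOn_Ioc_of_le hab.le]
              exact hintB (hev0 k) hab.le)
          rwa [uIcc_of_le hab.le] at this
        have h1 := hc _ (right_mem_Icc.2 hab.le)
        have h2 := h1.mono_left (nhdsWithin_le_of_mem (s := Icc a (L.arrival (k + 1) ω))
          (t := Iio (L.arrival (k + 1) ω))
          (mem_of_superset (Ioo_mem_nhdsLT hab) fun v hv => ⟨hv.1.le, hv.2.le⟩))
        refine leftLim_eq_of_tendsto (h2.congr' ?_)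
        filter_upwards [Ioo_mem_nhdsLT hab] with u hu
        have h3 := hdiff (hev0 k) hu.1.le
        rw [hconst u ⟨hu.1.le, hu.2⟩, Finset.Ioc_self, Finset.sum_empty, add_zero] at h3
        exact h3.symm
      have hy := hdiff (hev0 k) hab.le
      rw [hNa, hNb, Nat.Ioc_succ_singleton, Finset.sum_singleton, ← hlimY', hg] at hy
      dsimp only at hy
      rw [hb, hy, hlimY, ih, stepJ, stepK, hb, ← ha]
      simp only [L.N_zero, zero_add]
      set x := NormedSpace.exp ((L.arrival (k + 1) ω - a) • C.B)
        *ᵥ (stepJ L C 0 ω k *ᵥ y 0 + stepK L C 0 ω k) with hx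
      have e1 : ∀ v, ((1 + L.jumpSize (k + 1) ω ^ 2 • C.ea)
          * NormedSpace.exp ((L.arrival (k + 1) ω - a) • C.B)) *ᵥ v
          = NormedSpace.exp ((L.arrival (k + 1) ω - a) • C.B) *ᵥ v
            + (L.jumpSize (k + 1) ω ^ 2 * (C.a ⬝ᵥ
              (NormedSpace.exp ((L.arrival (k + 1) ω - a) • C.B) *ᵥ v))) • C.e := by
        intro v
        rw [← Matrix.mulVec_mulVec, Matrix.add_mulVec, Matrix.one_mulVec, Matrix.smul_mulVec,
          ea_mulVec, smul_smul]
      rw [← Matrix.mulVec_mulVec, ← add_assoc, ← Matrix.mulVec_add, e1, ← hx]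
      rw [add_mul, add_smul, add_assoc, add_comm ((C.α₀ * _) • C.e), mul_comm (C.a ⬝ᵥ x)]
  have hfin := key _ le_rfl
  have hNe := hNev _ (le_refl (L.N t ω))
  have hle : eventTime L 0 ω (L.N t ω) ≤ t :=
    L.eventTime_le le_rfl ht (by rw [L.N_zero]; omega)
  rw [hflow (hev0 _) hle hNe.symm, hfin, Matrix.mulVec_add, Matrix.mulVec_mulVec]
  simp only [J, K, L.N_zero, Nat.sub_zero]

end SSCogarch

/-! ### Tails of the Poisson law -/

lemma poissonMeasure_real_one_le (r : ℝ≥0) : (poissonMeasure r).real {n | 1 ≤ n} ≤ r := by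
  have h : {n : ℕ | 1 ≤ n} = {0}ᶜ := by ext n; simp; omega
  rw [h, probReal_compl_eq_one_sub (measurableSet_singleton 0), poissonMeasure_real_singleton]
  have := Real.add_one_le_exp (-(r : ℝ))
  simp
  linarith

/-- The bound reduces to (1 + r) e^{-r} ≥ (1 + r)(1 - r) = 1 - r². -/
lemma poissonMeasure_real_two_le (r : ℝ≥0) : (poissonMeasure r).real {n | 2 ≤ n} ≤ (r : ℝ) ^ 2 := by
  have h : {n : ℕ | 2 ≤ n} = {0, 1}ᶜ := by ext n; simp; omega
  have h2 : ({0, 1} : Set ℕ) = {0} ∪ {1} := rfl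
  rw [h, probReal_compl_eq_one_sub (MeasurableSet.of_discrete), h2,
    measureReal_union (by simp) (measurableSet_singleton 1), poissonMeasure_real_singleton,
    poissonMeasure_real_singleton]
  have h3 := Real.add_one_le_exp (-(r : ℝ))
  have h4 : (0 : ℝ) ≤ r := r.2
  simp
  nlinarith

namespace SSCogarch.SimpleSemiLevy

variable {Ω : Type*} [MeasurableSpace Ω] {P : Measure Ω} (L : SimpleSemiLevy Ω P)

/-! ### The partition -/

lemma part_nonneg (i : ℕ) : 0 ≤ L.part i := L.part_zero ▸ L.part_strictMono.monotone (Nat.zero_le i)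

lemma tau_pos : 0 < L.tau := by
  have := L.part_strictMono L.l_pos
  rwa [L.part_zero] at this

lemma part_add_l (j : ℕ) : L.part (j + L.l) = L.part j + L.tau := by
  induction j with
  | zero => simp [tau, L.part_zero]
  | succ j ih =>
    have := L.part_periodic j
    rw [show j + 1 + L.l = j + L.l + 1 by ring]
    linarith

lemma part_add_mul_l (j k : ℕ) : L.part (j + k * L.l) = L.part j + k * L.tau := by
  induction k with
  | zero => simp
  | succ k ih =>
    rw [show j + (k + 1) * L.l = j + k * L.l + L.l by ring, part_add_l, ih]
    push_cast; ring

lemma exists_lt_part (t : ℝ) : ∃ i, t < L.part i := by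
  obtain ⟨k, hk⟩ := exists_nat_gt (t / L.tau)
  refine ⟨0 + k * L.l, ?_⟩
  rw [part_add_mul_l, L.part_zero, zero_add]
  rwa [div_lt_iff₀ L.tau_pos] at hk

lemma exists_mem_Ico_part {t : ℝ} (ht : 0 ≤ t) : ∃ i, t ∈ Ico (L.part i) (L.part (i + 1)) := by
  classical
  have h := L.exists_lt_part t
  have h0 : Nat.find h ≠ 0 := fun h0 => by
    have := Nat.find_spec h
    rw [h0, L.part_zero] at this
    linarith
  refine ⟨Nat.find h - 1, ?_, ?_⟩
  · exact not_lt.1 (Nat.find_min h (by omega))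
  · rw [Nat.sub_add_cancel (by omega)]
    exact Nat.find_spec h

lemma eq_of_mem_Ico_part {t : ℝ} {i j : ℕ} (hi : t ∈ Ico (L.part i) (L.part (i + 1)))
    (hj : t ∈ Ico (L.part j) (L.part (j + 1))) : i = j := by
  have h1 := L.part_strictMono.lt_iff_lt.1 (hi.1.trans_lt hj.2)
  have h2 := L.part_strictMono.lt_iff_lt.1 (hj.1.trans_lt hi.2)
  omega

/-- The type of the `i`-th partition interval. -/
def cellType (i : ℕ) : Fin L.l := ⟨i % L.l, Nat.mod_lt _ L.l_pos⟩

lemma mem_cell_iff {t : ℝ} {i : ℕ} (hi : t ∈ Ico (L.part i) (L.part (i + 1))) (j : Fin L.l) :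
    t ∈ L.cell j ↔ L.cellType i = j := by
  constructor
  · intro h
    obtain ⟨k, hk⟩ := mem_iUnion.1 h
    have := L.eq_of_mem_Ico_part hi hk
    rw [Fin.ext_iff, cellType, this]
    simp [Nat.mod_eq_of_lt j.2]
  · rintro rfl
    refine mem_iUnion.2 ⟨i / L.l, ?_⟩
    have e : (L.cellType i : ℕ) + i / L.l * L.l = i := Nat.mod_add_div' i L.l
    rwa [e]

lemma jumpSize_eq {n : ℕ} {ω : Ω} {i : ℕ}
    (hi : L.arrival n ω ∈ Ico (L.part i) (L.part (i + 1))) :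
    L.jumpSize n ω = L.Z n (L.cellType i) ω := by
  simp [jumpSize, L.mem_cell_iff hi]

/-! ### Measurability -/

lemma measurable_arrival (n : ℕ) : Measurable (L.arrival n) := by
  refine measurable_of_Iic fun t => ?_
  rcases lt_or_ge t 0 with ht | ht
  · convert MeasurableSet.empty
    ext ω
    simpa using ht.trans_le (L.arrival_nonneg n ω)
  -- The second set collects the outcomes with fewer than n arrivals in all, where the infimum of
  -- the empty set is 0 and thus at most t.
  · have e : L.arrival n ⁻¹' Iic t
        = {ω | n ≤ L.N t ω} ∪ ⋂ k : ℕ, {ω | L.N k ω < n} := by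
      ext ω
      simp only [mem_preimage, mem_Iic, mem_union, mem_iInter]
      by_cases h : ∃ k : ℕ, n ≤ L.N k ω
      · obtain ⟨k, hk⟩ := h
        rw [L.arrival_le_iff ht k.cast_nonneg hk]
        refine ⟨Or.inl, ?_⟩
        rintro (h | h)
        · exact h
        · exact absurd (h k) (not_lt.2 hk)
      · push Not at h
        refine iff_of_true ?_ (Or.inr h)
        have : {t | 0 ≤ t ∧ n ≤ L.N t ω} = ∅ := by
          ext u
          simp only [mem_ofPred_eq, mem_empty_iff_false, iff_false]
          rintro ⟨hu, hn⟩
          obtain ⟨k, hk⟩ := exists_nat_ge u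
          exact absurd (hn.trans (L.N_mono ω u k hu hk)) (not_le.2 (h k))
        rw [arrival, this, Real.sInf_empty]
        exact ht
    rw [e]
    refine (measurableSet_le measurable_const (L.N_measurable t ht)).union
      (MeasurableSet.iInter fun k => measurableSet_lt (L.N_measurable k k.cast_nonneg)
        measurable_const)

lemma measurableSet_cell (j : Fin L.l) : MeasurableSet (L.cell j) :=
  MeasurableSet.iUnion fun _ => measurableSet_Ico

lemma measurable_jumpSize (n : ℕ) : Measurable (L.jumpSize n) := by
  classical
  refine Finset.measurable_sum _ fun j _ => Measurable.ite
    (L.measurable_arrival n (L.measurableSet_cell j)) (L.Z_measurable n j) measurable_const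

lemma measurable_X {t : ℝ} (ht : 0 ≤ t) : Measurable (L.X t) := by
  let f : ℕ × Ω → ℝ := fun p => ∑ n ∈ Finset.Icc 1 p.1, L.jumpSize n p.2
  have h : Measurable f := by
    refine measurable_from_prod_countable_right fun k => ?_
    dsimp only [f]
    exact Finset.measurable_sum (Finset.Icc 1 k) fun n _ => L.measurable_jumpSize n
  have e : L.X t = fun ω => f (L.N t ω, ω) := rfl
  rw [e]
  exact h.comp ((L.N_measurable t ht).prodMk measurable_id)

/-! ### The mean function -/

lemma integral_lam {s t : ℝ} (hs : 0 ≤ s) (ht : 0 ≤ t) :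
    ∫ u in s..t, L.lam u = L.Lam t - L.Lam s :=
  (intervalIntegral.integral_interval_sub_left (L.lam_integrable t ht) (L.lam_integrable s hs)).symm

lemma integral_lam_nonneg {s t : ℝ} (hs : 0 ≤ s) (hst : s ≤ t) : 0 ≤ ∫ u in s..t, L.lam u :=
  intervalIntegral.integral_nonneg hst fun u hu => L.lam_nonneg u (hs.trans hu.1)

lemma Lam_mono {s t : ℝ} (hs : 0 ≤ s) (hst : s ≤ t) : L.Lam s ≤ L.Lam t := by
  have := L.integral_lam_nonneg hs hst
  rw [L.integral_lam hs (hs.trans hst)] at this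
  linarith

lemma continuousOn_Lam (T : ℝ) : ContinuousOn L.Lam (Icc 0 T) := by
  rcases lt_or_ge T 0 with hT | hT
  · rw [Icc_eq_empty (by linarith)]; exact continuousOn_empty _
  have := intervalIntegral.continuousOn_primitive_interval (f := L.lam) (a := 0) (b := T)
    (μ := volume) (by
      rw [uIcc_of_le hT, integrableOn_Icc_iff_integrableOn_Ioc,
        ← intervalIntegrable_iff_integrableOn_Ioc_of_le hT]
      exact L.lam_integrable T hT)
  rwa [uIcc_of_le hT] at this

/-- The mean number of arrivals in `(s, t]`. -/
def meanN (s t : ℝ) : ℝ≥0 := (∫ u in s..t, L.lam u).toNNReal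

lemma coe_meanN {s t : ℝ} (hs : 0 ≤ s) (hst : s ≤ t) : (L.meanN s t : ℝ) = L.Lam t - L.Lam s := by
  rw [meanN, Real.coe_toNNReal _ (L.integral_lam_nonneg hs hst),
    L.integral_lam hs (hs.trans hst)]

lemma lam_periodic_nat {t : ℝ} (ht : 0 ≤ t) (m : ℕ) : L.lam (t + m * L.tau) = L.lam t := by
  induction m with
  | zero => simp
  | succ m ih =>
    rw [← ih, ← L.lam_periodic (t + m * L.tau) (by have := L.tau_pos; positivity)]
    congr 1
    push_cast [tau]; ring

lemma meanN_shift {s t : ℝ} (hs : 0 ≤ s) (hst : s ≤ t) (m : ℕ) :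
    L.meanN (s + m * L.tau) (t + m * L.tau) = L.meanN s t := by
  unfold meanN
  rw [← intervalIntegral.integral_comp_add_right]
  congr 1
  refine intervalIntegral.integral_congr fun u hu => ?_
  rw [uIcc_of_le hst] at hu
  exact L.lam_periodic_nat (hs.trans hu.1) m

lemma measurable_N_sub {s t : ℝ} (hs : 0 ≤ s) (ht : 0 ≤ t) :
    Measurable fun ω => L.N t ω - L.N s ω :=
  (measurable_of_countable fun p : ℕ × ℕ => p.1 - p.2).comp
    ((L.N_measurable t ht).prodMk (L.N_measurable s hs))

lemma measureReal_one_le_N_sub {s t : ℝ} (hs : 0 ≤ s) (hst : s ≤ t) :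
    P.real {ω | 1 ≤ L.N t ω - L.N s ω} ≤ L.Lam t - L.Lam s := by
  have h := poissonMeasure_real_one_le (L.meanN s t)
  rw [L.coe_meanN hs hst, meanN, ← L.N_law s t hs hst,
    map_measureReal_apply (L.measurable_N_sub hs (hs.trans hst)) MeasurableSet.of_discrete] at h
  exact h

lemma measureReal_two_le_N_sub {s t : ℝ} (hs : 0 ≤ s) (hst : s ≤ t) :
    P.real {ω | 2 ≤ L.N t ω - L.N s ω} ≤ (L.Lam t - L.Lam s) ^ 2 := by
  have h := poissonMeasure_real_two_le (L.meanN s t)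
  rw [L.coe_meanN hs hst, meanN, ← L.N_law s t hs hst,
    map_measureReal_apply (L.measurable_N_sub hs (hs.trans hst)) MeasurableSet.of_discrete] at h
  exact h

/-! ### Almost sure properties of the arrivals -/

variable [IsProbabilityMeasure P]

/-- An arrival at the fixed time t would lie in (r, t] for all r < t. The probability of that is at
most Λ(t) - Λ(r), which tends to 0 by continuity of Λ. -/
lemma ae_exists_N_eq_left {t : ℝ} (ht : 0 < t) : ∀ᵐ ω ∂P, ∃ r ∈ Ico 0 t, L.N r ω = L.N t ω := by
  have hlim : Tendsto (fun n : ℕ => t - t * (1 / ((n : ℝ) + 1))) atTop (𝓝 t) := by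
    simpa using (tendsto_one_div_add_atTop_nhds_zero_nat.const_mul t).const_sub t
  have hr : ∀ n : ℕ, t - t * (1 / ((n : ℝ) + 1)) ∈ Ico 0 t := fun n => by
    have h1 : (0 : ℝ) < 1 / ((n : ℝ) + 1) := by positivity
    have h2 : 1 / ((n : ℝ) + 1) ≤ 1 := by
      rw [div_le_one (by positivity)]; linarith [n.cast_nonneg (α := ℝ)]
    constructor <;> nlinarith
  have hLam : Tendsto (fun n : ℕ => L.Lam t - L.Lam (t - t * (1 / ((n : ℝ) + 1)))) atTop (𝓝 0) := by
    have h1 := L.continuousOn_Lam t t ⟨ht.le, le_rfl⟩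
    have h2 : Tendsto (fun n : ℕ => t - t * (1 / ((n : ℝ) + 1))) atTop (𝓝[Icc 0 t] t) :=
      tendsto_nhdsWithin_iff.2 ⟨hlim, Eventually.of_forall fun n => ⟨(hr n).1, (hr n).2.le⟩⟩
    simpa using (h1.tendsto.comp h2).const_sub (L.Lam t)
  have hz : P.real {ω | ¬ ∃ r ∈ Ico 0 t, L.N r ω = L.N t ω} ≤ 0 := by
    refine ge_of_tendsto' hLam fun n => ?_
    refine le_trans (measureReal_mono fun ω hω => ?_)
      (L.measureReal_one_le_N_sub (hr n).1 (hr n).2.le)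
    simp only [mem_ofPred_eq] at hω ⊢
    by_contra hlt
    have := L.N_mono ω _ _ (hr n).1 (hr n).2.le
    exact hω ⟨_, hr n, by omega⟩
  rw [ae_iff]
  exact (measureReal_eq_zero_iff).1 (le_antisymm hz measureReal_nonneg)

/-- A short interval with two arrivals lies in some window [iδ, (i+2)δ] with two arrivals. Such a
window has probability at most (ΔΛ)², which is at most η ΔΛ once δ is small, by uniform continuity
of Λ. The increments over the overlapping windows telescope to at most 2Λ(3T), and η is arbitrary.
-/
lemma ae_exists_simple (T : ℝ) (hT : 0 < T) : ∀ᵐ ω ∂P, ∃ ε > 0, ∀ u v, 0 ≤ u → u ≤ v → v ≤ T →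
    v - u < ε → L.N v ω ≤ L.N u ω + 1 := by
  set bad : Set Ω := {ω | ¬ ∃ ε > 0, ∀ u v, 0 ≤ u → u ≤ v → v ≤ T →
    v - u < ε → L.N v ω ≤ L.N u ω + 1} with hbad
  have hgrid : ∀ n : ℕ, 0 < n → bad ⊆ ⋃ i ∈ Finset.range (n + 1),
      {ω | 2 ≤ L.N ((i + 2 : ℕ) * (T / n)) ω - L.N (i * (T / n)) ω} := by
    intro n hn ω hω
    by_contra hno
    simp only [mem_iUnion, mem_ofPred_eq, not_exists, not_le, Finset.mem_range] at hno
    have hn' : (0 : ℝ) < n := by exact_mod_cast hn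
    have hδ : 0 < T / n := by positivity
    refine hω ⟨T / n, hδ, fun u v hu huv hvT hlt => ?_⟩
    have hi1 : (⌊u / (T / n)⌋₊ : ℝ) ≤ u / (T / n) := Nat.floor_le (by positivity)
    have hi2 := Nat.lt_floor_add_one (u / (T / n))
    set i := ⌊u / (T / n)⌋₊
    rw [le_div_iff₀ hδ] at hi1
    rw [div_lt_iff₀ hδ] at hi2
    have hin : i < n + 1 := by
      have : (i : ℝ) * (T / n) ≤ n * (T / n) := by
        rw [mul_div_cancel₀ _ hn'.ne']; linarith
      have := le_of_mul_le_mul_right this hδ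
      exact Nat.lt_succ_of_le (by exact_mod_cast this)
    have h1 := L.N_mono ω _ _ (by positivity) hi1
    have hv : v ≤ (i + 2 : ℕ) * (T / n) := by push_cast; linarith
    have h2 := L.N_mono ω _ _ (hu.trans huv) hv
    have h3 := hno i hin
    omega
  have hnn : 0 ≤ L.Lam (3 * T) := by
    have := L.Lam_mono le_rfl (by positivity : 0 ≤ 3 * T)
    simpa [Lam] using this
  have hreal : ∀ η > 0, P.real bad ≤ η * (2 * L.Lam (3 * T)) := by
    intro η hη
    -- The windows overshoot T by up to two steps of length at most T, hence the interval [0, 3T].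
    have huc := isCompact_Icc.uniformContinuousOn_of_continuous (L.continuousOn_Lam (3 * T))
    obtain ⟨d, hd, hdist⟩ := Metric.uniformContinuousOn_iff.1 huc η hη
    obtain ⟨n, hn⟩ := exists_nat_gt (max 1 (2 * T / d))
    have hn1 : (1 : ℝ) < n := (le_max_left _ _).trans_lt hn
    have hn2 : 2 * T / d < n := (le_max_right _ _).trans_lt hn
    have hn0 : 0 < n := by
      have : (0 : ℝ) < n := by linarith
      exact_mod_cast this
    set δ := T / n with hδdef
    have hδ : 0 < δ := by positivity
    have hnδ : n * δ = T := by rw [hδdef]; field_simp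
    have h2δ : 2 * δ < d := by
      rw [div_lt_iff₀ hd] at hn2
      have hn' : (0 : ℝ) < n := by linarith
      rw [hδdef, ← mul_div_assoc, div_lt_iff₀ hn']; linarith
    have hmem : ∀ i : ℕ, i ≤ n + 2 → (i : ℝ) * δ ∈ Icc 0 (3 * T) := by
      intro i hi
      refine ⟨by positivity, ?_⟩
      have : (i : ℝ) ≤ n + 2 := by exact_mod_cast hi
      nlinarith
    have hle : ∀ i : ℕ, (i : ℝ) * δ ≤ (i + 1 : ℕ) * δ := fun i => by push_cast; nlinarith
    have hle2 : ∀ i : ℕ, (i : ℝ) * δ ≤ (i + 2 : ℕ) * δ := fun i => by push_cast; nlinarith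
    have hterm : ∀ i ∈ Finset.range (n + 1),
        P.real {ω | 2 ≤ L.N ((i + 2 : ℕ) * δ) ω - L.N (i * δ) ω}
          ≤ η * (L.Lam ((i + 2 : ℕ) * δ) - L.Lam (i * δ)) := by
      intro i hi
      rw [Finset.mem_range] at hi
      have h0 : 0 ≤ (i : ℝ) * δ := by positivity
      refine (L.measureReal_two_le_N_sub h0 (hle2 i)).trans ?_
      have h1 := L.Lam_mono h0 (hle2 i)
      have h2 := hdist _ (hmem (i + 2) (by omega)) _ (hmem i (by omega)) (by
        rw [Real.dist_eq]
        have : ((i + 2 : ℕ) : ℝ) * δ - i * δ = 2 * δ := by push_cast; ring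
        rw [this, abs_of_pos (by positivity)]; exact h2δ)
      rw [Real.dist_eq] at h2
      have h3 := le_abs_self (L.Lam ((i + 2 : ℕ) * δ) - L.Lam (i * δ))
      nlinarith
    refine (measureReal_mono (hgrid n hn0) (measure_ne_top P _)).trans ((measureReal_biUnion_finset_le _ _).trans
      ((Finset.sum_le_sum hterm).trans ?_))
    rw [← Finset.mul_sum]
    refine mul_le_mul_of_nonneg_left ?_ hη.le
    have hsplit : ∀ i : ℕ, L.Lam ((i + 2 : ℕ) * δ) - L.Lam (i * δ)
        = (L.Lam ((i + 1 + 1 : ℕ) * δ) - L.Lam ((i + 1 : ℕ) * δ))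
          + (L.Lam ((i + 1 : ℕ) * δ) - L.Lam (i * δ)) := fun i => by ring
    simp only [hsplit]
    rw [Finset.sum_add_distrib, Finset.sum_range_sub (fun i : ℕ => L.Lam ((i + 1 : ℕ) * δ)),
      Finset.sum_range_sub (fun i : ℕ => L.Lam (i * δ))]
    have g1 : 0 ≤ L.Lam ((0 + 1 : ℕ) * δ) := by
      have := L.Lam_mono le_rfl (hmem (0 + 1) (by omega)).1
      simpa [Lam] using this
    have g2 : L.Lam ((0 : ℕ) * δ) = 0 := by simp [Lam]
    have g3 := L.Lam_mono (hmem (n + 1 + 1) (by omega)).1 (hmem (n + 1 + 1) (by omega)).2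
    have g4 := L.Lam_mono (hmem (n + 1) (by omega)).1 (hmem (n + 1) (by omega)).2
    linarith
  have hz : P.real bad ≤ 0 := by
    have hlim : Tendsto (fun η : ℝ => η * (2 * L.Lam (3 * T))) (𝓝[>] 0) (𝓝 0) := by
      have : Tendsto (fun η : ℝ => η * (2 * L.Lam (3 * T))) (𝓝 0) (𝓝 (0 * (2 * L.Lam (3 * T)))) :=
        tendsto_id.mul_const _
      rw [zero_mul] at this
      exact this.mono_left nhdsWithin_le_nhds
    exact ge_of_tendsto hlim (by filter_upwards [self_mem_nhdsWithin] with η hη using hreal η hη)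
  rw [ae_iff]
  exact (measureReal_eq_zero_iff).1 (le_antisymm hz measureReal_nonneg)

lemma ae_simple : ∀ᵐ ω ∂P, L.Simple ω := by
  have h : ∀ᵐ ω ∂P, ∀ m : ℕ, ∃ ε > 0, ∀ u v, 0 ≤ u → u ≤ v → v ≤ (m + 1 : ℝ) →
      v - u < ε → L.N v ω ≤ L.N u ω + 1 :=
    ae_all_iff.2 fun m => L.ae_exists_simple _ (by positivity)
  filter_upwards [h] with ω hω T
  obtain ⟨m, hm⟩ := exists_nat_ge T
  obtain ⟨ε, hε, hs⟩ := hω m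
  exact ⟨ε, hε, fun u v hu huv hv => hs u v hu huv (hv.trans (by linarith))⟩

/-- Cells are closed on the left, whereas increments of N count arrivals in intervals closed on the
right. Excluding arrivals at partition points reconciles the two. -/
lemma ae_arrival_ne_part : ∀ᵐ ω ∂P, ∀ i n : ℕ, 1 ≤ n → n ≤ L.N (L.part i) ω →
    L.arrival n ω ≠ L.part i := by
  refine ae_all_iff.2 fun i => ?_
  rcases (L.part_nonneg i).eq_or_lt with h0 | h0
  · refine Eventually.of_forall fun ω n h1 hn => ?_
    rw [← h0, L.N_zero] at hn
    omega
  · filter_upwards [L.ae_exists_N_eq_left h0] with ω hω n h1 hn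
    obtain ⟨r, hr, hN⟩ := hω
    exact ((L.arrival_le hr.1 (hN ▸ hn)).trans_lt hr.2).ne

end SSCogarch.SimpleSemiLevy

/-! ### Independence of blocks -/

/-- Induction on the number of blocks: a new block is independent of the union of the others, and an
event in those blocks is an event of their union. -/
lemma iIndepFun_blocks {Ω ι κ : Type*} [MeasurableSpace Ω] {μ : Measure Ω} {β : ι → Type*}
    [∀ i, MeasurableSpace (β i)] {f : (i : ι) → Ω → β i} (hf : ∀ i, Measurable (f i))
    (hi : iIndepFun f μ) (T : κ → Finset ι) (hT : Pairwise (Function.onFun Disjoint T)) :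
    iIndepFun (fun k ω (i : T k) => f i ω) μ := by
  classical
  rw [iIndepFun_iff_measure_inter_preimage_eq_mul]
  intro S sets hsets
  induction S using Finset.induction_on with
  | empty =>
    have := hi.isProbabilityMeasure
    simp
  | insert a S ha ih =>
    rw [Finset.prod_insert ha, ← ih fun i hi => hsets i (Finset.mem_insert_of_mem hi),
      Finset.set_biInter_insert]
    have hdisj : Disjoint (T a) (S.biUnion T) := by
      rw [Finset.disjoint_biUnion_right]
      intro i hiS
      exact hT fun h => ha (h ▸ hiS)
    have hind := hi.indepFun_finset (T a) (S.biUnion T) hdisj hf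
    let pr : (k : S) → ((i : (S.biUnion T : Finset ι)) → β i) → ((i : T k) → β i) := fun k x i =>
      x ⟨i, Finset.mem_biUnion.2 ⟨k, k.2, i.2⟩⟩
    have hpr : ∀ k, Measurable (pr k) := fun k => measurable_pi_lambda _ fun i => measurable_pi_apply _
    have h := hind.measure_inter_preimage_eq_mul (sets a) (⋂ k : S, pr k ⁻¹' sets k)
      (hsets a (Finset.mem_insert_self _ _))
      (MeasurableSet.iInter fun k => hpr k (hsets k (Finset.mem_insert_of_mem k.2)))
    have e : (fun ω (i : (S.biUnion T : Finset ι)) => f i ω) ⁻¹' (⋂ k : S, pr k ⁻¹' sets k)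
        = ⋂ k ∈ S, (fun ω (i : T k) => f i ω) ⁻¹' sets k := by
      ext ω
      simp only [mem_preimage, mem_iInter, Subtype.forall]
      rfl
    rw [e] at h
    exact h

namespace SSCogarch.SimpleSemiLevy

variable {Ω : Type*} [MeasurableSpace Ω] {P : Measure Ω} (L : SimpleSemiLevy Ω P)

/-! ### Sums of jumps between two times -/

lemma iIndepFun_sum_Z {a : ℕ → ℕ} (ha : Monotone a) (j : ℕ → Fin L.l) :
    iIndepFun (fun k ω => ∑ n ∈ Finset.Ioc (a k) (a (k + 1)), L.Z n (j k) ω) P := by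
  have hb := iIndepFun_blocks (fun x : ℕ × Fin L.l => L.Z_measurable x.1 x.2) L.Z_indep
    (fun k => Finset.Ioc (a k) (a (k + 1)) ×ˢ ({j k} : Finset (Fin L.l))) (by
      have : ∀ k m, k < m → Disjoint (Finset.Ioc (a k) (a (k + 1)) ×ˢ ({j k} : Finset (Fin L.l)))
          (Finset.Ioc (a m) (a (m + 1)) ×ˢ ({j m} : Finset (Fin L.l))) := by
        intro k m hkm
        rw [Finset.disjoint_left]
        rintro ⟨n, i⟩ h1 h2
        simp only [Finset.mem_product, Finset.mem_Ioc] at h1 h2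
        have := ha (show k + 1 ≤ m from hkm)
        omega
      intro k m hkm
      rcases lt_or_gt_of_ne hkm with h | h
      · exact this k m h
      · exact (this m k h).symm)
  have hc := hb.comp (fun k x => ∑ n : Finset.Ioc (a k) (a (k + 1)),
    x ⟨(n, j k), by simp⟩) fun k =>
      Finset.measurable_sum _ fun n _ => measurable_pi_apply _
  convert hc using 2 with k
  ext ω
  exact (Finset.sum_coe_sort (Finset.Ioc (a k) (a (k + 1))) fun n => L.Z n (j k) ω).symm

/-- The law of the sum of `c` jumps of type `j`. -/
def blockLaw (j : Fin L.l) (c : ℕ) : Measure ℝ :=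
  P.map fun ω => ∑ k ∈ Finset.range c, L.Z k j ω

/-- The jump sizes of one type are i.i.d., so the law of a sum of consecutive ones depends only on
their number. -/
lemma map_sum_Z (j : Fin L.l) (a b : ℕ) :
    P.map (fun ω => ∑ n ∈ Finset.Ioc a b, L.Z n j ω) = L.blockLaw j (b - a) := by
  have hinj : ∀ m, Function.Injective fun k : ℕ => (m + k, j) := fun m x y h => by
    simpa using congrArg Prod.fst h
  have hid : IdentDistrib (fun ω (k : ℕ) => L.Z (a + 1 + k) j ω) (fun ω (k : ℕ) => L.Z (0 + k) j ω)
      P P := by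
    refine IdentDistrib.pi (fun k => ⟨(L.Z_measurable _ _).aemeasurable,
      (L.Z_measurable _ _).aemeasurable, by rw [L.Z_law, L.Z_law]⟩)
      (L.Z_indep.precomp (hinj (a + 1))) (L.Z_indep.precomp (hinj 0))
  have hm : Measurable fun x : ℕ → ℝ => ∑ k ∈ Finset.range (b - a), x k :=
    Finset.measurable_sum _ fun k _ => measurable_pi_apply k
  have h := (hid.comp hm).map_eq
  simp only [Function.comp_def, zero_add] at h
  rw [blockLaw, ← h]
  congr 1
  ext ω
  have e : Finset.Ioc a b = Finset.Ico (a + 1) (b + 1) := by ext; simp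
  rw [e, Finset.sum_Ico_eq_sum_range]
  congr 2
  omega

variable [IsProbabilityMeasure P]

/-- Independence of N and Z in the form of Tonelli's theorem: the counting path may be frozen while
the jump sizes are integrated. -/
lemma lintegral_N_Z {G : (ℝ≥0 → ℕ) × (ℕ × Fin L.l → ℝ) → ℝ≥0∞} (hG : Measurable G) :
    ∫⁻ ω, G (fun t => L.N t ω, fun x => L.Z x.1 x.2 ω) ∂P
      = ∫⁻ ω, ∫⁻ ω', G (fun t => L.N t ω, fun x => L.Z x.1 x.2 ω') ∂P ∂P := by
  have hN : Measurable fun ω (t : ℝ≥0) => L.N t ω :=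
    measurable_pi_lambda _ fun t => L.N_measurable t t.2
  have hZ : Measurable fun ω (x : ℕ × Fin L.l) => L.Z x.1 x.2 ω :=
    measurable_pi_lambda _ fun x => L.Z_measurable x.1 x.2
  have h := (indepFun_iff_map_prod_eq_prod_map_map hN.aemeasurable hZ.aemeasurable).1 L.N_Z_indep
  have := Measure.isProbabilityMeasure_map (μ := P) hZ.aemeasurable
  rw [← lintegral_map (f := G) hG (hN.prodMk hZ), h, lintegral_prod _ hG.aemeasurable,
    lintegral_map hG.lintegral_prod_right' hN]
  refine lintegral_congr fun ω => ?_
  exact lintegral_map (hG.comp measurable_prodMk_left) hZ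

/-- The expectation of `f` of the sum of the jumps between two times, if all jumps are of type `j`,
as a function of the number of jumps. -/
lemma lintegral_prod_sum_Z {w : ℕ → ℝ≥0} (hw : Monotone w) (j : ℕ → Fin L.l) (S : Finset ℕ)
    {f : ℕ → ℝ → ℝ≥0∞} (hf : ∀ k, Measurable (f k)) :
    ∫⁻ ω, ∏ k ∈ S, f k (∑ n ∈ Finset.Ioc (L.N (w k) ω) (L.N (w (k + 1)) ω), L.Z n (j k) ω) ∂P
      = ∏ k ∈ S, ∫⁻ c, ∫⁻ x, f k x ∂(L.blockLaw (j k) c)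
          ∂(poissonMeasure (L.meanN (w k) (w (k + 1)))) := by
  have hsum : ∀ k, Measurable fun p : (ℕ × ℕ) × (ℕ × Fin L.l → ℝ) =>
      f k (∑ n ∈ Finset.Ioc p.1.1 p.1.2, p.2 (n, j k)) := fun k => (hf k).comp <| by
    refine measurable_from_prod_countable_right fun m => ?_
    exact Finset.measurable_sum (Finset.Ioc m.1 m.2) fun n _ => measurable_pi_apply _
  have hG : Measurable fun p : (ℝ≥0 → ℕ) × (ℕ × Fin L.l → ℝ) =>
      ∏ k ∈ S, f k (∑ n ∈ Finset.Ioc (p.1 (w k)) (p.1 (w (k + 1))), p.2 (n, j k)) := by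
    refine Finset.measurable_prod _ fun k _ => ?_
    have h : Measurable fun p : (ℝ≥0 → ℕ) × (ℕ × Fin L.l → ℝ) =>
        ((p.1 (w k), p.1 (w (k + 1))), p.2) := by fun_prop
    exact (hsum k).comp h
  rw [L.lintegral_N_Z hG]
  -- For a frozen counting path the sums run over disjoint ranges of indices, hence are independent.
  -- What remains is a product of functions of the increments of N, which are independent in turn.
  have hinner : ∀ ω, ∫⁻ ω', ∏ k ∈ S, f k (∑ n ∈ Finset.Ioc (L.N (w k) ω) (L.N (w (k + 1)) ω),
      L.Z n (j k) ω') ∂P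
      = ∏ k ∈ S, ∫⁻ x, f k x ∂(L.blockLaw (j k) (L.N (w (k + 1)) ω - L.N (w k) ω)) := by
    intro ω
    have ha : Monotone fun k => L.N (w k) ω := fun k m h =>
      L.N_mono ω _ _ (w k).2 (NNReal.coe_le_coe.2 (hw h))
    have hZm : ∀ k, Measurable fun ω' => ∑ n ∈ Finset.Ioc (L.N (w k) ω) (L.N (w (k + 1)) ω),
        L.Z n (j k) ω' := fun k => Finset.measurable_sum _ fun n _ => L.Z_measurable _ _
    have hi := (L.iIndepFun_sum_Z ha j).comp f hf
    have h1 := lintegral_prod_eq_prod_lintegral_of_indepFun S _ hi fun k => (hf k).comp (hZm k)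
    refine h1.trans (Finset.prod_congr rfl fun k _ => ?_)
    rw [← L.map_sum_Z, lintegral_map (hf k) (hZm k)]
    rfl
  simp only [hinner]
  have hNi := L.N_indep.nat hw
  have hNi' := hNi.comp (fun k c => ∫⁻ x, f k x ∂(L.blockLaw (j k) c))
    fun k => measurable_of_countable _
  have h2 := lintegral_prod_eq_prod_lintegral_of_indepFun S _ hNi' fun k =>
    (measurable_of_countable _).comp (L.measurable_N_sub (w k).2 (w (k + 1)).2)
  refine h2.trans (Finset.prod_congr rfl fun k _ => ?_)
  rw [meanN, ← L.N_law (w k) (w (k + 1)) (w k).2 (NNReal.coe_le_coe.2 (hw (Nat.le_add_right k 1)))]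
  have hm : Measurable fun ω => L.N (w (k + 1)) ω - L.N (w k) ω :=
    L.measurable_N_sub (w k).2 (w (k + 1)).2
  exact (lintegral_map (f := fun c => ∫⁻ x, f k x ∂(L.blockLaw (j k) c))
    (measurable_of_countable _) hm).symm

end SSCogarch.SimpleSemiLevy

namespace SSCogarch.SimpleSemiLevy

variable {Ω : Type*} [MeasurableSpace Ω] {P : Measure Ω} (L : SimpleSemiLevy Ω P)

/-! ### Grids that refine the partition -/

/-- A monotone sequence of times such that each interval between consecutive times lies in one
interval of the partition. -/
structure Grid where
  /-- the times -/
  w : ℕ → ℝ≥0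
  mono : Monotone w
  /-- the partition interval of each step -/
  i : ℕ → ℕ
  part_le : ∀ k, L.part (i k) ≤ w k
  le_part : ∀ k, (w (k + 1) : ℝ) ≤ L.part (i k + 1)

/-- The grid enumerates, in increasing order, the prescribed times together with all partition
points up to one beyond them. -/
lemma exists_grid (T : Finset ℝ≥0) : ∃ G : L.Grid, G.w 0 = 0 ∧ ∀ t ∈ T, ∃ k, G.w k = t := by
  classical
  obtain ⟨M, hM⟩ : ∃ M, ∀ t ∈ T, (t : ℝ) < L.part M := by
    induction T using Finset.induction_on with
    | empty => exact ⟨0, by simp⟩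
    | insert a T ha ih =>
      obtain ⟨M, hM⟩ := ih
      obtain ⟨M', hM'⟩ := L.exists_lt_part a
      refine ⟨max M M', fun t ht => ?_⟩
      rcases Finset.mem_insert.1 ht with rfl | h
      · exact hM'.trans_le (L.part_strictMono.monotone (le_max_right _ _))
      · exact (hM t h).trans_le (L.part_strictMono.monotone (le_max_left _ _))
  let pt : ℕ → ℝ≥0 := fun i => ⟨L.part i, L.part_nonneg i⟩
  set T' : Finset ℝ≥0 := T ∪ (Finset.range (M + 1)).image pt with hT'
  have h0 : (0 : ℝ≥0) ∈ T' := by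
    refine Finset.mem_union_right _ (Finset.mem_image.2 ⟨0, by simp, ?_⟩)
    exact Subtype.ext L.part_zero
  have hne : 0 < T'.card := Finset.card_pos.2 ⟨0, h0⟩
  let emb := T'.orderEmbOfFin rfl
  have hlt : ∀ k : ℕ, min k (T'.card - 1) < T'.card := fun k => by omega
  -- After the last point the sequence stays constant, so it is only weakly monotone.
  let w : ℕ → ℝ≥0 := fun k => emb ⟨min k (T'.card - 1), hlt k⟩
  have hw : Monotone w := fun a b h => emb.monotone (Fin.mk_le_mk.2 (by omega))
  have hsurj : ∀ t ∈ T', ∃ k, w k = t := by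
    intro t ht
    have : t ∈ range emb := by rw [Finset.range_orderEmbOfFin]; exact ht
    obtain ⟨k, hk⟩ := this
    refine ⟨k, ?_⟩
    rw [← hk]
    have := k.2
    exact congrArg emb (Fin.ext (show min (k : ℕ) (T'.card - 1) = k by omega))
  have hwle : ∀ k, (w k : ℝ) ≤ L.part M := by
    intro k
    have : w k ∈ T' := T'.orderEmbOfFin_mem rfl _
    rcases Finset.mem_union.1 this with h | h
    · exact (hM _ h).le
    · obtain ⟨i, hi, he⟩ := Finset.mem_image.1 h
      rw [← he]
      exact L.part_strictMono.monotone (by simpa [Nat.lt_succ_iff] using hi)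
  choose i hi using fun k => L.exists_mem_Ico_part (w k).coe_nonneg
  refine ⟨⟨w, hw, i, fun k => (hi k).1, fun k => ?_⟩, ?_, fun t ht => hsurj t (Finset.mem_union_left _ ht)⟩
  -- A partition point strictly inside a step would itself be a grid point w m with k < m < k + 1.
  · by_contra! hlt'
    have hiM : i k + 1 < M := L.part_strictMono.lt_iff_lt.1 (hlt'.trans_le (hwle (k + 1)))
    obtain ⟨m, hm⟩ := hsurj (pt (i k + 1)) (Finset.mem_union_right _
      (Finset.mem_image_of_mem _ (by simp; omega)))
    have h1 : w k < w m := by rw [hm]; exact (hi k).2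
    have h2 : w m < w (k + 1) := by rw [hm]; exact hlt'
    have h3 := hw.reflect_lt h1
    have h4 := hw.reflect_lt h2
    omega
  · obtain ⟨k, hk⟩ := hsurj 0 h0
    exact le_antisymm (hk ▸ hw (Nat.zero_le k)) zero_le

/-- The path after time `s`. -/
def futureX (s : ℝ≥0) (ω : Ω) (t : ℝ≥0) : ℝ := L.X (s + t : ℝ≥0) ω - L.X s ω

/-- The path up to time `s`. -/
def pastX (s : ℝ≥0) (ω : Ω) (t : ℝ≥0) : ℝ := L.X (min t s : ℝ≥0) ω

lemma measurable_futureX (s : ℝ≥0) : Measurable (L.futureX s) :=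
  measurable_pi_lambda _ fun t => (L.measurable_X (s + t).coe_nonneg).sub (L.measurable_X s.coe_nonneg)

lemma measurable_pastX (s : ℝ≥0) : Measurable (L.pastX s) :=
  measurable_pi_lambda _ fun t => L.measurable_X (min t s).coe_nonneg

/-- `m` periods. -/
def periods (m : ℕ) : ℝ≥0 := (m * L.tau).toNNReal

lemma coe_periods (m : ℕ) : (L.periods m : ℝ) = m * L.tau :=
  Real.coe_toNNReal _ (mul_nonneg m.cast_nonneg L.tau_pos.le)

variable {L}

/-- The grid shifted by `m` periods. -/
def Grid.shift (G : L.Grid) (m : ℕ) : L.Grid where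
  w k := G.w k + L.periods m
  mono := fun a b h => add_le_add_left (G.mono h) _
  i k := G.i k + m * L.l
  part_le k := by
    rw [part_add_mul_l]
    have := G.part_le k
    push_cast
    rw [coe_periods]
    linarith
  le_part k := by
    rw [show G.i k + m * L.l + 1 = G.i k + 1 + m * L.l by ring, part_add_mul_l]
    have := G.le_part k
    push_cast
    rw [coe_periods]
    linarith

lemma cellType_add (i m : ℕ) : L.cellType (i + m * L.l) = L.cellType i := by
  simp [cellType]

lemma Grid.measurable_X_sub (G : L.Grid) (k : ℕ) :
    Measurable fun ω => L.X (G.w (k + 1)) ω - L.X (G.w k) ω :=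
  (L.measurable_X (G.w (k + 1)).coe_nonneg).sub (L.measurable_X (G.w k).coe_nonneg)

lemma Grid.X_eq_sum (G : L.Grid) (h0 : G.w 0 = 0) (k : ℕ) (ω : Ω) :
    L.X (G.w k) ω = ∑ i ∈ Finset.range k, (L.X (G.w (i + 1)) ω - L.X (G.w i) ω) := by
  rw [Finset.sum_range_sub (fun i => L.X (G.w i) ω), h0]
  simp [X, L.N_zero]

variable [IsProbabilityMeasure P]

/-- All arrivals counted in a step lie in one partition interval, the right end point being almost
surely no arrival. So all jumps of the step have the same type, and the random choice of type in
`jumpSize` disappears. -/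
lemma Grid.ae_X_sub (G : L.Grid) : ∀ᵐ ω ∂P, ∀ k, L.X (G.w (k + 1)) ω - L.X (G.w k) ω
    = ∑ n ∈ Finset.Ioc (L.N (G.w k) ω) (L.N (G.w (k + 1)) ω), L.Z n (L.cellType (G.i k)) ω := by
  filter_upwards [L.ae_arrival_ne_part] with ω hω k
  have hle : (G.w k : ℝ) ≤ G.w (k + 1) := NNReal.coe_le_coe.2 (G.mono k.le_succ)
  rw [L.X_sub (G.w k).coe_nonneg hle]
  refine Finset.sum_congr rfl fun n hn => L.jumpSize_eq ?_
  rw [Finset.mem_Ioc] at hn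
  have h1 : (G.w k : ℝ) < L.arrival n ω := L.lt_arrival (G.w k).coe_nonneg (G.w (k + 1)).coe_nonneg hn.2 hn.1
  have h2 : L.arrival n ω ≤ G.w (k + 1) := L.arrival_le (G.w (k + 1)).coe_nonneg hn.2
  refine ⟨(G.part_le k).trans h1.le, lt_of_le_of_ne (h2.trans (G.le_part k)) ?_⟩
  exact hω _ n (by omega) (hn.2.trans (L.N_mono ω _ _ (G.w (k + 1)).coe_nonneg (G.le_part k)))

lemma Grid.lintegral_prod (G : L.Grid) (S : Finset ℕ) {f : ℕ → ℝ → ℝ≥0∞}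
    (hf : ∀ k, Measurable (f k)) :
    ∫⁻ ω, ∏ k ∈ S, f k (L.X (G.w (k + 1)) ω - L.X (G.w k) ω) ∂P
      = ∏ k ∈ S, ∫⁻ c, ∫⁻ x, f k x ∂(L.blockLaw (L.cellType (G.i k)) c)
          ∂(poissonMeasure (L.meanN (G.w k) (G.w (k + 1)))) := by
  rw [← L.lintegral_prod_sum_Z G.mono (fun k => L.cellType (G.i k)) S hf]
  refine lintegral_congr_ae ?_
  filter_upwards [G.ae_X_sub] with ω hω
  exact Finset.prod_congr rfl fun k _ => by rw [hω]

lemma Grid.lintegral_comp (G : L.Grid) (k : ℕ) {f : ℝ → ℝ≥0∞} (hf : Measurable f) :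
    ∫⁻ ω, f (L.X (G.w (k + 1)) ω - L.X (G.w k) ω) ∂P
      = ∫⁻ c, ∫⁻ x, f x ∂(L.blockLaw (L.cellType (G.i k)) c)
          ∂(poissonMeasure (L.meanN (G.w k) (G.w (k + 1)))) := by
  simpa using G.lintegral_prod {k} (f := fun _ => f) fun _ => hf

lemma Grid.iIndepFun_X_sub (G : L.Grid) :
    iIndepFun (fun k ω => L.X (G.w (k + 1)) ω - L.X (G.w k) ω) P := by
  rw [iIndepFun_iff_measure_inter_preimage_eq_mul]
  intro S sets hsets
  classical
  -- Sets outside S are filled in with the whole line, so that the product formula for functions can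
  -- be applied to indicators.
  set s' : ℕ → Set ℝ := fun k => if k ∈ S then sets k else univ with hs'
  have hs'm : ∀ k, MeasurableSet (s' k) := fun k => by
    simp only [hs']; split_ifs with h; exacts [hsets k h, MeasurableSet.univ]
  have hs'e : ∀ k ∈ S, s' k = sets k := fun k hk => by simp [hs', hk]
  have hf : ∀ k, Measurable ((s' k).indicator (fun _ => (1 : ℝ≥0∞))) := fun k =>
    measurable_const.indicator (hs'm k)
  have hone : ∀ k, ∫⁻ ω, (s' k).indicator (fun _ => (1 : ℝ≥0∞))
      (L.X (G.w (k + 1)) ω - L.X (G.w k) ω) ∂P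
      = P ((fun ω => L.X (G.w (k + 1)) ω - L.X (G.w k) ω) ⁻¹' s' k) := by
    intro k
    rw [← lintegral_indicator_one (G.measurable_X_sub k (hs'm k))]
    rfl
  have h := G.lintegral_prod S hf
  simp only [← G.lintegral_comp _ (hf _), hone] at h
  rw [Finset.prod_congr rfl fun k hk => by rw [hs'e k hk]] at h
  rw [← h, ← lintegral_indicator_one
    (Finset.measurableSet_biInter S fun k hk => G.measurable_X_sub k (hsets k hk))]
  refine lintegral_congr fun ω => ?_
  simp only [Set.indicator_apply, Pi.one_apply, mem_iInter, mem_preimage, Finset.prod_ite_zero,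
    Finset.prod_const_one]
  congr 1
  exact propext (forall₂_congr fun k hk => by rw [hs'e k hk])

/-- The law of an increment depends only on the type of its cell and on the mean number of arrivals,
and both are periodic. Independence of the increments lifts this to the whole sequence. -/
lemma Grid.identDistrib_X_sub (G : L.Grid) (m : ℕ) :
    IdentDistrib (fun ω k => L.X (G.w (k + 1)) ω - L.X (G.w k) ω)
      (fun ω k => L.X ((G.shift m).w (k + 1)) ω - L.X ((G.shift m).w k) ω) P P := by
  refine IdentDistrib.pi (fun k => ⟨(G.measurable_X_sub k).aemeasurable,
    ((G.shift m).measurable_X_sub k).aemeasurable, ?_⟩) G.iIndepFun_X_sub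
      (G.shift m).iIndepFun_X_sub
  ext s hs
  rw [Measure.map_apply (G.measurable_X_sub k) hs,
    Measure.map_apply ((G.shift m).measurable_X_sub k) hs]
  have hf : Measurable (s.indicator (fun _ => (1 : ℝ≥0∞))) := measurable_const.indicator hs
  rw [← lintegral_indicator_one (G.measurable_X_sub k hs),
    ← lintegral_indicator_one ((G.shift m).measurable_X_sub k hs)]
  refine (G.lintegral_comp k hf).trans (Eq.trans ?_ ((G.shift m).lintegral_comp k hf).symm)
  have e1 : L.cellType ((G.shift m).i k) = L.cellType (G.i k) := cellType_add _ _
  have e2 : L.meanN ((G.shift m).w k) ((G.shift m).w (k + 1)) = L.meanN (G.w k) (G.w (k + 1)) := by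
    have := L.meanN_shift (G.w k).coe_nonneg (NNReal.coe_le_coe.2 (G.mono (Nat.le_add_right k 1))) m
    rw [← this]
    simp only [Grid.shift, NNReal.coe_add, coe_periods]
  rw [e1, e2]

variable (L)

/-! ### Independence and periodicity of the increments -/

/-- It suffices to consider finitely many times. On a grid through all of them and through s = w κ,
the past values are sums of increments with index below κ and the future ones are sums of increments
with index at least κ. -/
lemma indepFun_pastX_futureX (s : ℝ≥0) : IndepFun (L.pastX s) (L.futureX s) P := by
  classical
  refine IndepFun.process_indepFun_process (fun t => L.measurable_X (min t s).coe_nonneg)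
    (fun t => (L.measurable_X (s + t).coe_nonneg).sub (L.measurable_X s.coe_nonneg)) fun I J => ?_
  obtain ⟨G, hG0, hG⟩ := L.exists_grid
    (insert s (I.image (fun t => min t s) ∪ J.image (fun t => s + t)))
  obtain ⟨κ, hκ⟩ := hG s (Finset.mem_insert_self _ _)
  -- Grid points may repeat, so an index found for a time up to s can exceed κ. In that case the
  -- time equals s and κ itself serves.
  have hI : ∀ t : I, ∃ k, k ≤ κ ∧ G.w k = min t.1 s := by
    intro t
    obtain ⟨k, hk⟩ := hG (min t.1 s) (Finset.mem_insert_of_mem (Finset.mem_union_left _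
      (Finset.mem_image_of_mem _ t.2)))
    rcases le_total k κ with h | h
    · exact ⟨k, h, hk⟩
    · refine ⟨κ, le_rfl, ?_⟩
      have := G.mono h
      rw [hk, hκ] at this
      rw [hκ, le_antisymm (min_le_right _ _) this]
  have hJ : ∀ t : J, ∃ k, κ ≤ k ∧ G.w k = s + t.1 := by
    intro t
    obtain ⟨k, hk⟩ := hG (s + t.1) (Finset.mem_insert_of_mem (Finset.mem_union_right _
      (Finset.mem_image_of_mem _ t.2)))
    rcases le_total κ k with h | h
    · exact ⟨k, h, hk⟩
    · refine ⟨κ, le_rfl, ?_⟩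
      have := G.mono h
      rw [hk, hκ] at this
      rw [hκ]
      exact le_antisymm le_self_add this
  choose kI hkI hwI using hI
  choose kJ hkJ hwJ using hJ
  set M := ∑ t : J, kJ t with hM
  have hkM : ∀ t, kJ t ≤ M := fun t => Finset.single_le_sum (f := kJ) (fun _ _ => Nat.zero_le _)
    (Finset.mem_univ t)
  have hdisj : Disjoint (Finset.range κ) (Finset.Ico κ M) := by
    rw [Finset.disjoint_left]
    intro k h1 h2
    rw [Finset.mem_range] at h1
    rw [Finset.mem_Ico] at h2
    omega
  have hind := G.iIndepFun_X_sub.indepFun_finset (Finset.range κ) (Finset.Ico κ M) hdisj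
    G.measurable_X_sub
  let φ : (Finset.range κ → ℝ) → I → ℝ := fun x t =>
    ∑ k : Finset.range κ, if (k : ℕ) < kI t then x k else 0
  let ψ : (Finset.Ico κ M → ℝ) → J → ℝ := fun x t =>
    ∑ k : Finset.Ico κ M, if (k : ℕ) < kJ t then x k else 0
  have hφ : Measurable φ := measurable_pi_lambda _ fun t => Finset.measurable_sum _ fun k _ => by
    split_ifs
    · exact measurable_pi_apply _
    · exact measurable_const
  have hψ : Measurable ψ := measurable_pi_lambda _ fun t => Finset.measurable_sum _ fun k _ => by
    split_ifs
    · exact measurable_pi_apply _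
    · exact measurable_const
  have hcomp := hind.comp hφ hψ
  convert hcomp using 1
  · ext ω t
    simp only [Function.comp_apply, φ]
    rw [Finset.sum_coe_sort (Finset.range κ) (fun k => if k < kI t then
      L.X (G.w (k + 1)) ω - L.X (G.w k) ω else 0), ← Finset.sum_filter, pastX, ← hwI, G.X_eq_sum hG0]
    congr 1
    ext k
    have := hkI t
    simp only [Finset.mem_range, Finset.mem_filter]
    omega
  · ext ω t
    simp only [Function.comp_apply, ψ]
    rw [Finset.sum_coe_sort (Finset.Ico κ M) (fun k => if k < kJ t then
      L.X (G.w (k + 1)) ω - L.X (G.w k) ω else 0), ← Finset.sum_filter, futureX, ← hwJ, ← hκ,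
      G.X_eq_sum hG0, G.X_eq_sum hG0, ← Finset.sum_Ico_eq_sub _ (hkJ t)]
    congr 1
    ext k
    have := hkM t
    simp only [Finset.mem_Ico, Finset.mem_filter]
    omega

lemma identDistrib_futureX (m : ℕ) :
    IdentDistrib (L.futureX 0) (L.futureX (L.periods m)) P P := by
  classical
  refine (identDistrib_iff_forall_finset_identDistrib (X := fun t ω => L.futureX 0 ω t)
    (Y := fun t ω => L.futureX (L.periods m) ω t) (L.measurable_futureX _).aemeasurable
    (L.measurable_futureX _).aemeasurable).2 fun I => ?_
  obtain ⟨G, hG0, hG⟩ := L.exists_grid I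
  choose k hk using fun t : I => hG t t.2
  let φ : (ℕ → ℝ) → I → ℝ := fun x t => ∑ i ∈ Finset.range (k t), x i
  have hφ : Measurable φ := measurable_pi_lambda _ fun t => Finset.measurable_sum _ fun i _ =>
    measurable_pi_apply _
  have h := (G.identDistrib_X_sub m).comp hφ
  convert h using 1
  · ext ω t
    simp only [Function.comp_apply, φ, Finset.restrict, futureX]
    rw [zero_add, Finset.sum_range_sub (fun i => L.X (G.w i) ω), hk, hG0]
  · ext ω t
    simp only [Function.comp_apply, φ, Finset.restrict, futureX]
    rw [Finset.sum_range_sub (fun i => L.X ((G.shift m).w i) ω)]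
    simp only [Grid.shift, hk, hG0, zero_add]
    rw [add_comm]

end SSCogarch.SimpleSemiLevy

/-! ### The flow as a measurable functional of the path -/

section EulerPath

variable {𝔸 : Type*} [NormedRing 𝔸] [NormedAlgebra ℝ 𝔸]

lemma revProd_congr {M : Type*} [Monoid M] {A B : ℕ → M} {n : ℕ} (h : ∀ i < n, A i = B i) :
    revProd A n = revProd B n := by
  induction n with
  | zero => rfl
  | succ n ih =>
    rw [revProd, revProd, h n (Nat.lt_succ_self n), ih fun i hi => h i (hi.trans (Nat.lt_succ_self n))]

lemma measurable_revProd {X M : Type*} [Monoid M] [MeasurableSpace X] [MeasurableSpace M]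
    [MeasurableMul₂ M] {A : ℕ → X → M} (h : ∀ i, Measurable (A i)) (n : ℕ) :
    Measurable fun x => revProd (fun i => A i x) n := by
  induction n with
  | zero => exact measurable_const
  | succ n ih => exact (h n).mul ih

open SSCogarch.SimpleSemiLevy

lemma euler_congr (b c : 𝔸) {s t : ℝ} (hst : s ≤ t) (n : ℕ) {x y : ℝ → ℝ}
    (h : ∀ u ∈ Icc s t, x u = y u) : euler b c s t n x = euler b c s t n y := by
  refine revProd_congr fun i hi => ?_
  have hn : (0 : ℝ) < n := by exact_mod_cast (Nat.zero_le i).trans_lt hi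
  have hd : 0 ≤ (t - s) / n := div_nonneg (by linarith) hn.le
  have hmem : ∀ k : ℕ, k ≤ n → s + k * ((t - s) / n) ∈ Icc s t := by
    intro k hk
    have hk' : (k : ℝ) ≤ n := by exact_mod_cast hk
    have h1 : (k : ℝ) * ((t - s) / n) ≤ n * ((t - s) / n) := mul_le_mul_of_nonneg_right hk' hd
    rw [mul_div_cancel₀ _ hn.ne'] at h1
    have h2 : 0 ≤ (k : ℝ) * ((t - s) / n) := by positivity
    constructor <;> linarith
  rw [h _ (hmem i hi.le), h _ (hmem (i + 1) hi)]

/-- Only increments of the path enter, so time and value can both be counted from r. -/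
lemma euler_shift (b c : 𝔸) (s t r : ℝ) (n : ℕ) (x : ℝ → ℝ) :
    euler b c s t n x = euler b c (s - r) (t - r) n (fun u => x (r + u) - x r) := by
  unfold euler
  have e : t - r - (s - r) = t - s := by ring
  rw [e]
  congr 1
  ext i
  have e1 : ∀ y, r + (s - r + y) = s + y := fun y => by ring
  simp only [e1, sub_sub_sub_cancel_right]

/-- The multiplicative functional as a functional of the path. -/
def eulerLim (b c : 𝔸) (s t : ℝ) (x : ℝ≥0 → ℝ) : 𝔸 :=
  @limUnder _ _ _ ⟨0⟩ atTop fun n => euler b c s t n fun u => x u.toNNReal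

lemma measurable_eulerLim [CompleteSpace 𝔸] [MeasurableSpace 𝔸] [BorelSpace 𝔸]
    [SecondCountableTopology 𝔸] (b c : 𝔸) (s t : ℝ) : Measurable (eulerLim b c s t) := by
  have h : ∀ n, Measurable fun x : ℝ≥0 → ℝ => euler b c s t n fun u => x u.toNNReal := by
    intro n
    refine measurable_revProd (fun i => ?_) n
    have hx : ∀ r₁ r₂ : ℝ≥0, Measurable fun x : ℝ≥0 → ℝ => (x r₁ - x r₂) ^ 2 :=
      fun r₁ r₂ => by fun_prop
    exact (((hx _ _).smul_const c).const_add 1).mul_const _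
  exact (StronglyMeasurable.limUnder (hE := ⟨0⟩) fun n => (h n).stronglyMeasurable).measurable

end EulerPath

namespace SSCogarch.SimpleSemiLevy

variable {Ω : Type*} [MeasurableSpace Ω] {P : Measure Ω} (L : SimpleSemiLevy Ω P)
  [IsProbabilityMeasure P]
  {𝔸 : Type*} [NormedRing 𝔸] [NormedAlgebra ℝ 𝔸] [CompleteSpace 𝔸] [NormOneClass 𝔸]

/-- The Euler products over [u, v] see the path only up to v ≤ s. This makes the flow a function of
the past alone, and it is also the source of its measurability. -/
lemma ae_flow_eq_past (b c : 𝔸) {s : ℝ≥0} {u v : ℝ} (hu : 0 ≤ u) (huv : u ≤ v) (hvs : v ≤ s) :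
    ∀ᵐ ω ∂P, L.flow b c u v ω = eulerLim b c u v (L.pastX s ω) := by
  filter_upwards [L.ae_simple] with ω hω
  have h := L.tendsto_euler b c hu huv hω
  refine Eq.symm (@Tendsto.limUnder_eq _ _ _ _ _ _ _ _ (h.congr fun n => ?_))
  refine euler_congr b c huv n fun r hr => ?_
  have h0 : 0 ≤ r := hu.trans hr.1
  have : min r.toNNReal s = r.toNNReal :=
    min_eq_left (Real.toNNReal_le_iff_le_coe.2 (hr.2.trans hvs))
  rw [pastX, this, Real.coe_toNNReal r h0]

lemma ae_flow_eq_future (b c : 𝔸) {s : ℝ≥0} {u v : ℝ} (hsu : s ≤ u) (huv : u ≤ v) :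
    ∀ᵐ ω ∂P, L.flow b c u v ω = eulerLim b c (u - s) (v - s) (L.futureX s ω) := by
  filter_upwards [L.ae_simple] with ω hω
  have h := L.tendsto_euler b c (s.coe_nonneg.trans hsu) huv hω
  refine Eq.symm (@Tendsto.limUnder_eq _ _ _ _ _ _ _ _ (h.congr fun n => ?_))
  rw [euler_shift b c u v s]
  refine euler_congr b c (by linarith) n fun r hr => ?_
  have h0 : 0 ≤ r := (sub_nonneg.2 hsu).trans hr.1
  rw [futureX, NNReal.coe_add, Real.coe_toNNReal r h0]

end SSCogarch.SimpleSemiLevy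

/-! ### Regrouping independent random variables -/

/-- The joint law of A, B, C is the product of the three laws, which may be bracketed either way. -/
lemma indepFun_prodMk_left {Ω α β γ : Type*} [MeasurableSpace Ω] [MeasurableSpace α]
    [MeasurableSpace β] [MeasurableSpace γ] {μ : Measure Ω} [IsProbabilityMeasure μ]
    {A : Ω → α} {B : Ω → β} {C : Ω → γ} (hA : Measurable A) (hB : Measurable B)
    (hC : Measurable C) (h : IndepFun A (fun ω => (B ω, C ω)) μ) (hBC : IndepFun B C μ) :
    IndepFun (fun ω => (A ω, B ω)) C μ := by
  have hAB : IndepFun A B μ := h.comp measurable_id measurable_fst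
  rw [indepFun_iff_map_prod_eq_prod_map_map hA.aemeasurable (hB.prodMk hC).aemeasurable,
    (indepFun_iff_map_prod_eq_prod_map_map hB.aemeasurable hC.aemeasurable).1 hBC] at h
  rw [indepFun_iff_map_prod_eq_prod_map_map (hA.prodMk hB).aemeasurable hC.aemeasurable,
    (indepFun_iff_map_prod_eq_prod_map_map hA.aemeasurable hB.aemeasurable).1 hAB]
  have := Measure.isProbabilityMeasure_map (μ := μ) hA.aemeasurable
  have := Measure.isProbabilityMeasure_map (μ := μ) hB.aemeasurable
  have := Measure.isProbabilityMeasure_map (μ := μ) hC.aemeasurable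
  rw [← MeasurableEquiv.prodAssoc.map_measurableEquiv_injective.eq_iff, Measure.prodAssoc_prod, ← h,
    Measure.map_map MeasurableEquiv.prodAssoc.measurable ((hA.prodMk hB).prodMk hC)]
  rfl

namespace SSCogarch

variable {Ω : Type*} [MeasurableSpace Ω] {P : Measure Ω} {L : SimpleSemiLevy Ω P}
  [IsProbabilityMeasure P] {q : ℕ} {C : Params q}

/-- Subtracting the deterministic drift recovers the path of X from that of S, so the initial state
is independent of past and future jointly. Combined with the independence of past and future, this
allows the initial state to be grouped with the past. -/
lemma IsStateProcess.indepFun_past_future {Y : ℝ → Ω → Fin q → ℝ}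
    (hY : IsStateProcess L C Y) (s : ℝ≥0) :
    IndepFun (fun ω => (Y 0 ω, L.pastX s ω)) (L.futureX s) P := by
  refine indepFun_prodMk_left (hY.measurable 0 le_rfl) (L.measurable_pastX s)
    (L.measurable_futureX s) ?_ (L.indepFun_pastX_futureX s)
  let φ : (ℝ≥0 → ℝ) → (ℝ≥0 → ℝ) × (ℝ≥0 → ℝ) := fun x =>
    (fun t => x (min t s) - L.D (min t s : ℝ≥0),
      fun t => (x (s + t) - L.D (s + t : ℝ≥0)) - (x s - L.D s))
  have hφ : Measurable φ := by
    refine Measurable.prodMk (measurable_pi_lambda _ fun t => ?_) (measurable_pi_lambda _ fun t => ?_)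
    · exact (measurable_pi_apply _).sub_const _
    · exact ((measurable_pi_apply _).sub_const _).sub ((measurable_pi_apply _).sub_const _)
  have h := hY.indep.comp measurable_id hφ
  have e : (fun ω => (L.pastX s ω, L.futureX s ω)) = φ ∘ fun ω (t : ℝ≥0) => L.S t ω := by
    funext ω
    refine Prod.ext (funext fun t => ?_) (funext fun t => ?_)
    · simp only [φ, SimpleSemiLevy.pastX, L.S_eq, Function.comp_apply]
      ring
    · simp only [φ, SimpleSemiLevy.futureX, L.S_eq, Function.comp_apply]
      ring
  rw [e]
  exact h

end SSCogarch

/-! ### Powers against the Poisson law -/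

lemma hasSum_poisson_pow (r : ℝ≥0) (M : ℝ) :
    HasSum (fun n : ℕ => Real.exp (-r) * r ^ n / n.factorial * M ^ n) (Real.exp (r * (M - 1))) := by
  have h := (NormedSpace.expSeries_div_hasSum_exp (𝔸 := ℝ) (r * M)).mul_left (Real.exp (-r))
  rw [← Real.exp_eq_exp_ℝ, ← Real.exp_add] at h
  have e : (fun n : ℕ => Real.exp (-r) * ((r * M) ^ n / n.factorial))
      = fun n : ℕ => Real.exp (-r) * r ^ n / n.factorial * M ^ n := by
    funext n; rw [mul_pow]; ring
  rw [e] at h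
  rwa [show (r : ℝ) * (M - 1) = -r + r * M by ring]

lemma integrable_poisson_pow (r : ℝ≥0) (M : ℝ) :
    Integrable (fun n : ℕ => M ^ n) (poissonMeasure r) := by
  rw [integrable_poissonMeasure_iff]
  refine (hasSum_poisson_pow r |M|).summable.congr fun n => ?_
  simp

lemma integral_poisson_pow (r : ℝ≥0) (M : ℝ) :
    ∫ n, M ^ n ∂(poissonMeasure r) = Real.exp (r * (M - 1)) := by
  have h := hasSum_integral_poissonMeasure (integrable_poisson_pow r M)
  simp only [smul_eq_mul] at h
  exact h.unique (hasSum_poisson_pow r M)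

namespace SSCogarch.SimpleSemiLevy

variable {Ω : Type*} [MeasurableSpace Ω] {P : Measure Ω} (L : SimpleSemiLevy Ω P)

/-! ### Products over the jumps between two times -/

/-- The factor of an arrival sees the sizes of all types, not the cell of the arrival. For a frozen
counting path the factors are therefore i.i.d., and the product integrates to a power whose exponent
is the Poisson number of arrivals. -/
lemma lintegral_prod_jumps [IsProbabilityMeasure P] {g : (Fin L.l → ℝ) → ℝ≥0∞} (hg : Measurable g) {s t : ℝ} (hs : 0 ≤ s)
    (hst : s ≤ t) :
    ∫⁻ ω, ∏ n ∈ Finset.Ioc (L.N s ω) (L.N t ω), g (fun j => L.Z n j ω) ∂P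
      = ∫⁻ c, (∫⁻ ω, g (fun j => L.Z 0 j ω) ∂P) ^ c ∂(poissonMeasure (L.meanN s t)) := by
  let S : ℝ≥0 := ⟨s, hs⟩
  let T : ℝ≥0 := ⟨t, hs.trans hst⟩
  have hprod : Measurable fun p : (ℕ × ℕ) × (ℕ × Fin L.l → ℝ) =>
      ∏ n ∈ Finset.Ioc p.1.1 p.1.2, g (fun j => p.2 (n, j)) := by
    refine measurable_from_prod_countable_right fun m => ?_
    exact Finset.measurable_prod (Finset.Ioc m.1 m.2) fun n _ =>
      hg.comp (measurable_pi_lambda _ fun j => measurable_pi_apply _)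
  have hG : Measurable fun p : (ℝ≥0 → ℕ) × (ℕ × Fin L.l → ℝ) =>
      ∏ n ∈ Finset.Ioc (p.1 S) (p.1 T), g (fun j => p.2 (n, j)) := by
    have h : Measurable fun p : (ℝ≥0 → ℕ) × (ℕ × Fin L.l → ℝ) => ((p.1 S, p.1 T), p.2) := by
      fun_prop
    exact hprod.comp h
  have hZm : ∀ n, Measurable fun ω (j : Fin L.l) => L.Z n j ω := fun n =>
    measurable_pi_lambda _ fun j => L.Z_measurable n j
  have hind : iIndepFun (fun n ω => g fun j => L.Z n j ω) P := by
    classical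
    have hb := iIndepFun_blocks (fun x : ℕ × Fin L.l => L.Z_measurable x.1 x.2) L.Z_indep
      (fun n : ℕ => ({n} : Finset ℕ) ×ˢ (Finset.univ : Finset (Fin L.l))) (by
        intro n m hnm
        rw [Function.onFun, Finset.disjoint_left]
        rintro ⟨a, j⟩ h1 h2
        simp only [Finset.mem_product, Finset.mem_singleton, Finset.mem_univ, and_true] at h1 h2
        exact hnm (h1.symm.trans h2))
    exact hb.comp (fun n x => g fun j => x ⟨(n, j), by simp⟩) fun n =>
      hg.comp (measurable_pi_lambda _ fun j => measurable_pi_apply _)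
  have hlaw : ∀ n, ∫⁻ ω, g (fun j => L.Z n j ω) ∂P = ∫⁻ ω, g (fun j => L.Z 0 j ω) ∂P := by
    intro n
    have hinj : ∀ m : ℕ, Function.Injective fun j : Fin L.l => (m, j) := fun m x y h =>
      congrArg Prod.snd h
    have hid : IdentDistrib (fun ω (j : Fin L.l) => L.Z n j ω) (fun ω (j : Fin L.l) => L.Z 0 j ω)
        P P :=
      IdentDistrib.pi (fun k => ⟨(L.Z_measurable _ _).aemeasurable,
        (L.Z_measurable _ _).aemeasurable, by rw [L.Z_law, L.Z_law]⟩)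
        (L.Z_indep.precomp (g := fun j => (n, j)) (hinj n))
        (L.Z_indep.precomp (g := fun j => (0, j)) (hinj 0))
    exact (hid.comp hg).lintegral_eq
  have h1 := L.lintegral_N_Z hG
  refine h1.trans ?_
  have h2 : ∀ ω, ∫⁻ ω', ∏ n ∈ Finset.Ioc (L.N S ω) (L.N T ω), g (fun j => L.Z n j ω') ∂P
      = (∫⁻ ω, g (fun j => L.Z 0 j ω) ∂P) ^ (L.N T ω - L.N S ω) := by
    intro ω
    rw [lintegral_prod_eq_prod_lintegral_of_indepFun _ _ hind fun n => hg.comp (hZm n)]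
    simp only [hlaw, Finset.prod_const, Nat.card_Ioc]
  refine (lintegral_congr h2).trans ?_
  rw [meanN, ← L.N_law s t hs hst]
  exact (lintegral_map (f := fun c : ℕ => (∫⁻ ω, g (fun j => L.Z 0 j ω) ∂P) ^ c)
    (measurable_of_countable _) (L.measurable_N_sub hs (hs.trans hst))).symm

lemma measurable_prod_jumps {g : (Fin L.l → ℝ) → ℝ} (hg : Measurable g) {s t : ℝ} (hs : 0 ≤ s)
    (ht : 0 ≤ t) :
    Measurable fun ω => ∏ n ∈ Finset.Ioc (L.N s ω) (L.N t ω), g (fun j => L.Z n j ω) := by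
  have hprod : Measurable fun p : (ℕ × ℕ) × Ω =>
      ∏ n ∈ Finset.Ioc p.1.1 p.1.2, g (fun j => L.Z n j p.2) := by
    refine measurable_from_prod_countable_right fun m => ?_
    exact Finset.measurable_prod (Finset.Ioc m.1 m.2) fun n _ =>
      hg.comp (measurable_pi_lambda _ fun j => L.Z_measurable n j)
  exact hprod.comp (((L.N_measurable s hs).prodMk (L.N_measurable t ht)).prodMk measurable_id)

lemma integrable_prod_jumps [IsProbabilityMeasure P] {g : (Fin L.l → ℝ) → ℝ} (hg : Measurable g) (hg0 : ∀ x, 0 ≤ g x)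
    (hint : Integrable (fun ω => g fun j => L.Z 0 j ω) P) {s t : ℝ} (hs : 0 ≤ s) (hst : s ≤ t) :
    Integrable (fun ω => ∏ n ∈ Finset.Ioc (L.N s ω) (L.N t ω), g (fun j => L.Z n j ω)) P ∧
    ∫ ω, ∏ n ∈ Finset.Ioc (L.N s ω) (L.N t ω), g (fun j => L.Z n j ω) ∂P
      = Real.exp ((L.Lam t - L.Lam s) * (∫ ω, g (fun j => L.Z 0 j ω) ∂P - 1)) := by
  set M := ∫ ω, g (fun j => L.Z 0 j ω) ∂P with hM
  have hM0 : 0 ≤ M := integral_nonneg fun ω => hg0 _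
  have hMe : ∫⁻ ω, ENNReal.ofReal (g fun j => L.Z 0 j ω) ∂P = ENNReal.ofReal M :=
    (ofReal_integral_eq_lintegral_ofReal hint (Eventually.of_forall fun ω => hg0 _)).symm
  have h := L.lintegral_prod_jumps hg.ennreal_ofReal hs hst
  have hl : ∀ ω, ∏ n ∈ Finset.Ioc (L.N s ω) (L.N t ω), ENNReal.ofReal (g fun j => L.Z n j ω)
      = ENNReal.ofReal (∏ n ∈ Finset.Ioc (L.N s ω) (L.N t ω), g fun j => L.Z n j ω) := fun ω =>
    (ENNReal.ofReal_prod_of_nonneg fun n _ => hg0 _).symm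
  have hr : ∀ c : ℕ, ENNReal.ofReal M ^ c = ENNReal.ofReal (M ^ c) := fun c =>
    (ENNReal.ofReal_pow hM0 c).symm
  simp only [hMe, hl, hr] at h
  rw [← ofReal_integral_eq_lintegral_ofReal (integrable_poisson_pow _ M)
    (Eventually.of_forall fun c => pow_nonneg hM0 c), integral_poisson_pow,
    L.coe_meanN hs hst] at h
  have hnn : ∀ ω, 0 ≤ ∏ n ∈ Finset.Ioc (L.N s ω) (L.N t ω), g fun j => L.Z n j ω := fun ω =>
    Finset.prod_nonneg fun n _ => hg0 _
  have hm := L.measurable_prod_jumps hg hs (hs.trans hst)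
  refine ⟨?_, ?_⟩
  · refine (lintegral_ofReal_ne_top_iff_integrable hm.aestronglyMeasurable
      (Eventually.of_forall hnn)).1 ?_
    rw [h]; exact ENNReal.ofReal_ne_top
  · rw [integral_eq_lintegral_of_nonneg_ae (Eventually.of_forall hnn) hm.aestronglyMeasurable, h,
      ENNReal.toReal_ofReal (Real.exp_pos _).le]

/-! ### Moments of the multiplicative functional -/

/-- A bound for the factor of a jump, where `x j` is the size of the jump in cells of type `j`. -/
def jumpBound (κ : ℝ) (x : Fin L.l → ℝ) : ℝ := 1 + κ * (L.l * ∑ j, x j ^ 2)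

lemma measurable_jumpBound (κ : ℝ) : Measurable (L.jumpBound κ) := by
  unfold jumpBound; fun_prop

lemma jumpBound_nonneg {κ : ℝ} (hκ : 0 ≤ κ) (x : Fin L.l → ℝ) : 0 ≤ L.jumpBound κ x := by
  unfold jumpBound; positivity

/-- The Cauchy–Schwarz inequality over the types. The bound no longer depends on the arrival time,
as `lintegral_prod_jumps` requires. -/
lemma jumpSize_sq_le (n : ℕ) (ω : Ω) : L.jumpSize n ω ^ 2 ≤ L.l * ∑ j, L.Z n j ω ^ 2 := by
  classical
  refine (sq_sum_le_card_mul_sum_sq).trans ?_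
  rw [Finset.card_univ, Fintype.card_fin]
  refine mul_le_mul_of_nonneg_left (Finset.sum_le_sum fun j _ => ?_) (Nat.cast_nonneg _)
  split_ifs
  · exact le_rfl
  · simpa using sq_nonneg (L.Z n j ω)

/-- A bound for the multiplicative functional over `(s, t]`. -/
def flowBound (β κ s t : ℝ) (ω : Ω) : ℝ :=
  Real.exp ((t - s) * β)
    * ∏ n ∈ Finset.Ioc (L.N s ω) (L.N t ω), L.jumpBound κ (fun j => L.Z n j ω)

lemma flow_nearOne_flowBound {𝔸 : Type*} [NormedRing 𝔸] [NormedAlgebra ℝ 𝔸] [CompleteSpace 𝔸]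
    (b c : 𝔸) {s t : ℝ} (hs : 0 ≤ s) (hst : s ≤ t) (ω : Ω) :
    NearOne (L.flow b c s t ω) (L.flowBound ‖b‖ ‖c‖ s t ω) := by
  refine (L.flow_nearOne b c hs hst ω).mono ?_
  unfold flowBound
  refine mul_le_mul_of_nonneg_left (Finset.prod_le_prod (fun n _ => by positivity) fun n _ => ?_)
    (Real.exp_pos _).le
  unfold jumpBound
  rw [mul_comm]
  gcongr
  exact L.jumpSize_sq_le n ω

lemma integrable_Z_sq (j : Fin L.l) : Integrable (fun ω => L.Z 0 j ω ^ 2) P := by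
  have h := L.F_sq j
  rw [← L.Z_law 0 j] at h
  exact h.comp_measurable (L.Z_measurable 0 j)

lemma integrable_jumpBound [IsProbabilityMeasure P] (κ : ℝ) : Integrable (fun ω => L.jumpBound κ fun j => L.Z 0 j ω) P := by
  unfold jumpBound
  exact (integrable_const _).add
    (((integrable_finsetSum _ fun j _ => L.integrable_Z_sq j).const_mul _).const_mul _)

/-- The logarithmic growth rate of the mean of `flowBound` in the mean number of jumps. -/
def growth (κ : ℝ) : ℝ := ∫ ω, L.jumpBound κ (fun j => L.Z 0 j ω) ∂P - 1

lemma integrable_flowBound [IsProbabilityMeasure P] (β : ℝ) {κ : ℝ} (hκ : 0 ≤ κ) {s t : ℝ} (hs : 0 ≤ s) (hst : s ≤ t) :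
    Integrable (L.flowBound β κ s t) P :=
  (L.integrable_prod_jumps (L.measurable_jumpBound κ) (L.jumpBound_nonneg hκ)
    (L.integrable_jumpBound κ) hs hst).1.const_mul _

lemma integral_flowBound [IsProbabilityMeasure P] (β : ℝ) {κ : ℝ} (hκ : 0 ≤ κ) {s t : ℝ} (hs : 0 ≤ s) (hst : s ≤ t) :
    ∫ ω, L.flowBound β κ s t ω ∂P
      = Real.exp ((t - s) * β + (L.Lam t - L.Lam s) * L.growth κ) := by
  unfold flowBound
  rw [integral_const_mul, (L.integrable_prod_jumps (L.measurable_jumpBound κ)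
    (L.jumpBound_nonneg hκ) (L.integrable_jumpBound κ) hs hst).2, ← Real.exp_add]
  rfl

/-- The square of the product is the product of the squares, so the first moment formula applies to
the squared factors; their integrability is the fourth moment condition on the jump laws. -/
lemma memLp_two_flowBound [IsProbabilityMeasure P]
    (h4 : ∀ j, Integrable (fun z => z ^ 4) (L.F j)) (β κ : ℝ)
    {s t : ℝ} (hs : 0 ≤ s) (hst : s ≤ t) : MemLp (L.flowBound β κ s t) 2 P := by
  have hm := L.measurable_prod_jumps (L.measurable_jumpBound κ) hs (hs.trans hst)
  have hZ : ∀ j, MemLp (fun ω => L.Z 0 j ω ^ 2) 2 P := fun j => by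
    refine (memLp_two_iff_integrable_sq ((L.Z_measurable 0 j).pow_const 2).aestronglyMeasurable).2 ?_
    have h := h4 j
    rw [← L.Z_law 0 j] at h
    have h' := h.comp_measurable (L.Z_measurable 0 j)
    refine h'.congr (Eventually.of_forall fun ω => ?_)
    simp only [Function.comp_apply]
    ring
  have hB : MemLp (fun ω => L.jumpBound κ fun j => L.Z 0 j ω) 2 P := by
    have h1 : MemLp (fun ω => ∑ j, L.Z 0 j ω ^ 2) 2 P := memLp_finsetSum _ fun j _ => hZ j
    have h2 : MemLp (fun ω => κ * (L.l * ∑ j, L.Z 0 j ω ^ 2)) 2 P :=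
      (h1.const_mul (L.l : ℝ)).const_mul κ
    have h3 : MemLp (fun _ : Ω => (1 : ℝ)) 2 P := memLp_const 1
    exact h3.add h2
  have h := (L.integrable_prod_jumps (g := fun x => L.jumpBound κ x ^ 2)
    ((L.measurable_jumpBound κ).pow_const 2) (fun x => sq_nonneg _) hB.integrable_sq hs hst).1
  have h2 : MemLp (fun ω => ∏ n ∈ Finset.Ioc (L.N s ω) (L.N t ω),
      L.jumpBound κ (fun j => L.Z n j ω)) 2 P := by
    refine (memLp_two_iff_integrable_sq hm.aestronglyMeasurable).2 ?_
    refine h.congr (Eventually.of_forall fun ω => ?_)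
    simp only [Finset.prod_pow]
  exact h2.const_mul _

/-! ### Fourth moments of the jumps -/

lemma exists_grid_pair (i : ℕ) :
    ∃ G : L.Grid, (G.w 0 : ℝ) = L.part i ∧ (G.w (0 + 1) : ℝ) = L.part (i + 1) ∧ G.i 0 = i := by
  refine ⟨{ w := fun k => k.casesOn ⟨L.part i, L.part_nonneg i⟩
              fun _ => ⟨L.part (i + 1), L.part_nonneg (i + 1)⟩
            mono := monotone_nat_of_le_succ ?_
            i := fun k => k.casesOn i fun _ => i + 1
            part_le := ?_
            le_part := ?_ }, rfl, rfl, rfl⟩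
  · rintro (_ | k)
    · exact L.part_strictMono.monotone (Nat.le_succ i)
    · exact le_rfl
  · rintro (_ | k)
    · exact le_refl (L.part i)
    · exact le_refl (L.part (i + 1))
  · rintro (_ | k)
    · exact le_refl (L.part (i + 1))
    · exact L.part_strictMono.monotone (Nat.le_succ (i + 1))

/-- Over the j-th cell of the first period the increment of X has a finite fourth moment, since S
does and the drift is deterministic. Exactly one arrival falls there with positive probability
because λ > 0, and on that event the increment has law F_j. So the fourth moment of F_j, times that
probability, is finite. -/
lemma integrable_F_pow_four [IsProbabilityMeasure P] (hlam : ∀ s ∈ Ico 0 L.tau, 0 < L.lam s)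
    (hS : ∀ t, 0 ≤ t → MemLp (L.S t) 4 P) (j : Fin L.l) : Integrable (fun z => z ^ 4) (L.F j) := by
  obtain ⟨G, h0, h1, h2⟩ := L.exists_grid_pair j
  set a := G.w 0 with ha
  set b := G.w (0 + 1) with hb
  have hab : (a : ℝ) < b := by rw [h0, h1]; exact L.part_strictMono (Nat.lt_succ_self j)
  have hble : (b : ℝ) ≤ L.tau := by
    rw [h1]; exact L.part_strictMono.monotone (Nat.succ_le_of_lt j.2)
  have hf : Measurable fun x : ℝ => ENNReal.ofReal (x ^ 4) := by fun_prop
  have h := G.lintegral_comp 0 hf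
  have e2 : L.cellType (G.i 0) = j := by
    simp [h2, cellType, Nat.mod_eq_of_lt j.2]
  rw [e2, ← ha, ← hb] at h
  have hXS : ∀ ω, L.X b ω - L.X a ω = L.S b ω - L.S a ω - (L.D b - L.D a) := fun ω => by
    rw [L.S_eq, L.S_eq]; ring
  have hmem : MemLp (fun ω => L.X b ω - L.X a ω) 4 P := by
    simp only [hXS]
    exact ((hS b b.coe_nonneg).sub (hS a a.coe_nonneg)).sub (memLp_const _)
  have hfin : ∫⁻ ω, ENNReal.ofReal ((L.X b ω - L.X a ω) ^ 4) ∂P ≠ ⊤ := by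
    have h1 : Integrable (fun ω => (L.X b ω - L.X a ω) ^ 4) P := by
      refine (hmem.integrable_norm_pow (p := 4) (by norm_num)).congr (Eventually.of_forall fun ω => ?_)
      simp only [Real.norm_eq_abs]
      exact (Even.pow_abs (by decide) _)
    exact (lintegral_ofReal_ne_top_iff_integrable h1.1
      (Eventually.of_forall fun ω => by positivity)).2 h1
  rw [h] at hfin
  have hmu : 0 < L.meanN a b := by
    rw [meanN, Real.toNNReal_pos]
    have hii : IntervalIntegrable L.lam volume a b :=
      (L.lam_integrable a a.coe_nonneg).symm.trans (L.lam_integrable b b.coe_nonneg)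
    exact intervalIntegral.intervalIntegral_pos_of_pos_on hii
      (fun x hx => hlam x ⟨a.coe_nonneg.trans hx.1.le, hx.2.trans_le hble⟩) hab
  have hone : L.blockLaw j 1 = L.F j := by
    rw [blockLaw, ← L.Z_law 0 j]
    simp
  have hle : (poissonMeasure (L.meanN a b)) {1} * ∫⁻ x, ENNReal.ofReal (x ^ 4) ∂(L.F j)
      ≤ ∫⁻ c, ∫⁻ x, ENNReal.ofReal (x ^ 4) ∂(L.blockLaw j c) ∂(poissonMeasure (L.meanN a b)) := by
    calc _ = ∫⁻ c in {1}, ∫⁻ x, ENNReal.ofReal (x ^ 4) ∂(L.blockLaw j c)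
          ∂(poissonMeasure (L.meanN a b)) := by
          rw [lintegral_singleton, hone, mul_comm]
      _ ≤ _ := setLIntegral_le_lintegral _ _
  have hpos : (poissonMeasure (L.meanN a b)) {1} ≠ 0 := by
    have := poissonMeasure_real_singleton_pos 1 hmu
    intro h0
    rw [measureReal_def, h0] at this
    simp at this
  have hfin2 : ∫⁻ x, ENNReal.ofReal (x ^ 4) ∂(L.F j) ≠ ⊤ := by
    intro htop
    rw [htop, ENNReal.mul_top hpos, top_le_iff] at hle
    exact hfin hle
  exact (lintegral_ofReal_ne_top_iff_integrable (by fun_prop)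
    (Eventually.of_forall fun ω => by positivity)).1 hfin2

end SSCogarch.SimpleSemiLevy

/-! ### Matrix-valued random variables -/

instance Matrix.instMeasurableSpacePi {m n α : Type*} [MeasurableSpace α] :
    MeasurableSpace (Matrix m n α) := MeasurableSpace.pi

lemma Matrix.measurable_apply {m n α : Type*} [MeasurableSpace α] (i : m) (j : n) :
    Measurable fun A : Matrix m n α => A i j :=
  (measurable_pi_apply j).comp (measurable_pi_apply i)

section Flow

attribute [local instance] Matrix.linftyOpNormedRing Matrix.linftyOpNormedAlgebra
  Matrix.linfty_opNormOneClass

variable {ι : Type*} [Fintype ι] [DecidableEq ι]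

instance Matrix.borelSpace_linfty :
    @BorelSpace (Matrix ι ι ℝ) PseudoMetricSpace.toUniformSpace.toTopologicalSpace _ :=
  inferInstanceAs (BorelSpace (ι → ι → ℝ))

instance Matrix.secondCountableTopology_linfty :
    @SecondCountableTopology (Matrix ι ι ℝ) PseudoMetricSpace.toUniformSpace.toTopologicalSpace :=
  inferInstanceAs (SecondCountableTopology (ι → ι → ℝ))

lemma Matrix.norm_apply_le_linfty (A : Matrix ι ι ℝ) (i j : ι) : |A i j| ≤ ‖A‖ := by
  rw [Matrix.linfty_opNorm_def]
  have h1 : ‖A i j‖₊ ≤ ∑ j, ‖A i j‖₊ :=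
    Finset.single_le_sum (f := fun j => ‖A i j‖₊) (fun _ _ => bot_le) (Finset.mem_univ j)
  have h2 : ∑ j, ‖A i j‖₊ ≤ Finset.univ.sup fun i => ∑ j, ‖A i j‖₊ :=
    Finset.le_sup (f := fun i => ∑ j, ‖A i j‖₊) (Finset.mem_univ i)
  have h3 : (‖A i j‖₊ : ℝ) ≤ (Finset.univ.sup fun i => ∑ j, ‖A i j‖₊ : ℝ≥0) :=
    NNReal.coe_le_coe.2 (h1.trans h2)
  simpa using h3

lemma Matrix.norm_le_of_row_sum {A : Matrix ι ι ℝ} {r : ℝ} (hr : 0 ≤ r)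
    (h : ∀ i, ∑ j, |A i j| ≤ r) : ‖A‖ ≤ r := by
  rw [Matrix.linfty_opNorm_def]
  lift r to ℝ≥0 using hr
  refine NNReal.coe_le_coe.2 (Finset.sup_le fun i _ => ?_)
  have := h i
  rw [← NNReal.coe_le_coe]
  simpa using this

lemma Matrix.row_sum_le_linfty (A : Matrix ι ι ℝ) (i : ι) : ∑ j, |A i j| ≤ ‖A‖ := by
  rw [Matrix.linfty_opNorm_def]
  have h2 : ∑ j, ‖A i j‖₊ ≤ Finset.univ.sup fun i => ∑ j, ‖A i j‖₊ :=
    Finset.le_sup (f := fun i => ∑ j, ‖A i j‖₊) (Finset.mem_univ i)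
  have h3 := NNReal.coe_le_coe.2 h2
  simpa using h3

/-! ### Moments and mean of the matrix-valued flow -/

namespace SSCogarch.SimpleSemiLevy

variable {Ω : Type*} [MeasurableSpace Ω] {P : Measure Ω} (L : SimpleSemiLevy Ω P)

lemma abs_flow_apply_le [Nonempty ι] (b c : Matrix ι ι ℝ) {s t : ℝ} (hs : 0 ≤ s) (hst : s ≤ t) (i j : ι)
    (ω : Ω) :
    |L.flow b c s t ω i j| ≤ L.flowBound ‖b‖ ‖c‖ s t ω :=
  (Matrix.norm_apply_le_linfty _ i j).trans (L.flow_nearOne_flowBound b c hs hst ω).norm_le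

/-- The entrywise mean of the multiplicative functional. -/
def meanFlow (b c : Matrix ι ι ℝ) (s t : ℝ) : Matrix ι ι ℝ :=
  Matrix.of fun i j => ∫ ω, L.flow b c s t ω i j ∂P

lemma meanFlow_self [IsProbabilityMeasure P] (b c : Matrix ι ι ℝ) (s : ℝ) : L.meanFlow b c s s = 1 := by
  ext i j
  simp [meanFlow, L.flow_self]

variable [IsProbabilityMeasure P] [Nonempty ι]

lemma aemeasurable_flow (b c : Matrix ι ι ℝ) {s t : ℝ} (hs : 0 ≤ s) (hst : s ≤ t) :
    AEMeasurable (L.flow b c s t) P := by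
  have h := L.ae_flow_eq_past b c (s := ⟨t, hs.trans hst⟩) hs hst le_rfl
  exact ⟨_, (measurable_eulerLim b c s t).comp (L.measurable_pastX _), h⟩

lemma aemeasurable_flow_apply (b c : Matrix ι ι ℝ) {s t : ℝ} (hs : 0 ≤ s) (hst : s ≤ t) (i j : ι) :
    AEMeasurable (fun ω => L.flow b c s t ω i j) P :=
  (Matrix.measurable_apply i j).comp_aemeasurable (L.aemeasurable_flow b c hs hst)

lemma integrable_flow_apply (b c : Matrix ι ι ℝ) {s t : ℝ} (hs : 0 ≤ s) (hst : s ≤ t) (i j : ι) :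
    Integrable (fun ω => L.flow b c s t ω i j) P :=
  (L.integrable_flowBound ‖b‖ (norm_nonneg c) hs hst).mono'
    (L.aemeasurable_flow_apply b c hs hst i j).aestronglyMeasurable
    (Eventually.of_forall fun ω => L.abs_flow_apply_le b c hs hst i j ω)

lemma memLp_two_flow_apply (h4 : ∀ j, Integrable (fun z => z ^ 4) (L.F j)) (b c : Matrix ι ι ℝ)
    {s t : ℝ} (hs : 0 ≤ s) (hst : s ≤ t) (i j : ι) :
    MemLp (fun ω => L.flow b c s t ω i j) 2 P :=
  (L.memLp_two_flowBound h4 ‖b‖ ‖c‖ hs hst).mono'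
    (L.aemeasurable_flow_apply b c hs hst i j).aestronglyMeasurable
    (Eventually.of_forall fun ω => L.abs_flow_apply_le b c hs hst i j ω)

/-- The law of two values of the multiplicative functional is periodic. -/
lemma identDistrib_flow_pair (b c : Matrix ι ι ℝ) {u v u' v' : ℝ} (hu : 0 ≤ u) (huv : u ≤ v)
    (hu' : 0 ≤ u') (huv' : u' ≤ v') (m : ℕ) :
    IdentDistrib (fun ω => (L.flow b c (u + m * L.tau) (v + m * L.tau) ω,
        L.flow b c (u' + m * L.tau) (v' + m * L.tau) ω))
      (fun ω => (L.flow b c u v ω, L.flow b c u' v' ω)) P P := by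
  have hφ : Measurable fun x : ℝ≥0 → ℝ => (eulerLim b c u v x, eulerLim b c u' v' x) :=
    (measurable_eulerLim b c u v).prodMk (measurable_eulerLim b c u' v')
  have key : ∀ k : ℕ, ∀ᵐ ω ∂P, (L.flow b c (u + k * L.tau) (v + k * L.tau) ω,
        L.flow b c (u' + k * L.tau) (v' + k * L.tau) ω)
      = (fun x => (eulerLim b c u v x, eulerLim b c u' v' x)) (L.futureX (L.periods k) ω) := by
    intro k
    have hk := L.coe_periods k
    filter_upwards [L.ae_flow_eq_future b c (s := L.periods k) (u := u + k * L.tau)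
      (v := v + k * L.tau) (by rw [hk]; linarith) (by linarith),
      L.ae_flow_eq_future b c (s := L.periods k) (u := u' + k * L.tau)
      (v := v' + k * L.tau) (by rw [hk]; linarith) (by linarith)] with ω h1 h2
    rw [h1, h2, hk]
    simp only [add_sub_cancel_right]
  have h0 := key 0
  simp only [Nat.cast_zero, zero_mul, add_zero] at h0
  have hp0 : L.periods 0 = 0 := by simp [periods]
  rw [hp0] at h0
  have hid := (L.identDistrib_futureX m).comp hφ
  have e1 : IdentDistrib (fun ω => (L.flow b c u v ω, L.flow b c u' v' ω)) _ P P :=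
    IdentDistrib.of_ae_eq
      (((L.aemeasurable_flow b c hu huv).prodMk (L.aemeasurable_flow b c hu' huv'))) h0
  have hm : 0 ≤ m * L.tau := by have := L.tau_pos; positivity
  have e2 : IdentDistrib (fun ω => (L.flow b c (u + m * L.tau) (v + m * L.tau) ω,
        L.flow b c (u' + m * L.tau) (v' + m * L.tau) ω)) _ P P :=
    IdentDistrib.of_ae_eq
      ((L.aemeasurable_flow b c (by linarith) (by linarith)).prodMk
        (L.aemeasurable_flow b c (by linarith) (by linarith))) (key m)
  exact (e1.trans (hid.trans e2.symm)).symm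

/-- Values of the multiplicative functional over adjacent intervals are independent. -/
lemma indepFun_flow (b c : Matrix ι ι ℝ) {s u t : ℝ} (hs : 0 ≤ s) (hsu : s ≤ u) (hut : u ≤ t) :
    IndepFun (L.flow b c s u) (L.flow b c u t) P := by
  have h := (L.indepFun_pastX_futureX ⟨u, hs.trans hsu⟩).comp (measurable_eulerLim b c s u)
    (measurable_eulerLim b c (u - u) (t - u))
  refine h.congr ?_ ?_
  · exact (L.ae_flow_eq_past b c (s := ⟨u, hs.trans hsu⟩) hs hsu le_rfl).mono fun ω h => h.symm
  · exact (L.ae_flow_eq_future b c (s := ⟨u, hs.trans hsu⟩) le_rfl hut).mono fun ω h => h.symm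

/-- The cocycle property together with independence over adjacent intervals: the mean of a product
of independent matrices is the product of the means. -/
lemma meanFlow_mul (b c : Matrix ι ι ℝ) {s u t : ℝ} (hs : 0 ≤ s) (hsu : s ≤ u) (hut : u ≤ t) :
    L.meanFlow b c s t = L.meanFlow b c u t * L.meanFlow b c s u := by
  ext i j
  have hind : ∀ k, IndepFun (fun ω => L.flow b c u t ω i k) (fun ω => L.flow b c s u ω k j) P :=
    fun k => ((L.indepFun_flow b c hs hsu hut).comp
      (Matrix.measurable_apply k j) (Matrix.measurable_apply i k)).symm
  have h1 := fun k => L.integrable_flow_apply b c (hs.trans hsu) hut i k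
  have h2 := fun k => L.integrable_flow_apply b c hs hsu k j
  simp only [meanFlow, Matrix.of_apply, Matrix.mul_apply, L.flow_mul b c hs hsu hut]
  refine (integral_finsetSum _ fun k _ => (hind k).integrable_mul (h1 k) (h2 k)).trans ?_
  exact Finset.sum_congr rfl fun k _ =>
    (hind k).integral_fun_mul_eq_mul_integral (h1 k).1 (h2 k).1

lemma meanFlow_shift (b c : Matrix ι ι ℝ) {u v : ℝ} (hu : 0 ≤ u) (huv : u ≤ v) (m : ℕ) :
    L.meanFlow b c (u + m * L.tau) (v + m * L.tau) = L.meanFlow b c u v := by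
  ext i j
  exact ((L.identDistrib_flow_pair b c hu huv hu huv m).comp
    ((Matrix.measurable_apply i j).comp measurable_fst)).integral_eq

/-- Row sums of absolute values pass under the expectation without loss. The pathwise bound ‖flow -
1‖ ≤ `flowBound` - 1 thus becomes the same bound for the means, and the right side tends to 0 on
short intervals. -/
lemma norm_meanFlow_sub_one_le (b c : Matrix ι ι ℝ) {s t : ℝ} (hs : 0 ≤ s) (hst : s ≤ t) :
    ‖L.meanFlow b c s t - 1‖
      ≤ Real.exp ((t - s) * ‖b‖ + (L.Lam t - L.Lam s) * L.growth ‖c‖) - 1 := by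
  have hint := fun i j => (L.integrable_flow_apply b c hs hst i j).sub
    (integrable_const ((1 : Matrix ι ι ℝ) i j))
  have hb := L.integrable_flowBound ‖b‖ (norm_nonneg c) hs hst
  have hrow : ∀ i, ∑ j, |(L.meanFlow b c s t - 1) i j|
      ≤ Real.exp ((t - s) * ‖b‖ + (L.Lam t - L.Lam s) * L.growth ‖c‖) - 1 := by
    intro i
    calc ∑ j, |(L.meanFlow b c s t - 1) i j|
        = ∑ j, |∫ ω, (L.flow b c s t ω i j - (1 : Matrix ι ι ℝ) i j) ∂P| := by
          refine Finset.sum_congr rfl fun j _ => ?_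
          rw [integral_sub (L.integrable_flow_apply b c hs hst i j) (integrable_const _)]
          simp [meanFlow]
      _ ≤ ∑ j, ∫ ω, |L.flow b c s t ω i j - (1 : Matrix ι ι ℝ) i j| ∂P :=
          Finset.sum_le_sum fun j _ => abs_integral_le_integral_abs
      _ = ∫ ω, ∑ j, |L.flow b c s t ω i j - (1 : Matrix ι ι ℝ) i j| ∂P :=
          (integral_finsetSum _ fun j _ => (hint i j).abs).symm
      _ ≤ ∫ ω, (L.flowBound ‖b‖ ‖c‖ s t ω - 1) ∂P := by
          refine integral_mono (integrable_finsetSum _ fun j _ => (hint i j).abs)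
            (hb.sub (integrable_const 1)) fun ω => ?_
          exact (Matrix.row_sum_le_linfty (L.flow b c s t ω - 1) i).trans
            (L.flow_nearOne_flowBound b c hs hst ω)
      _ = _ := by
          rw [integral_sub hb (integrable_const _), L.integral_flowBound ‖b‖ (norm_nonneg c) hs hst]
          simp
  obtain ⟨i⟩ := ‹Nonempty ι›
  exact Matrix.norm_le_of_row_sum
    ((Finset.sum_nonneg fun j _ => abs_nonneg _).trans (hrow i)) hrow

/-- Cutting [0, t] into short pieces writes the mean as a product of matrices at distance less than
1 from the identity, each of which is invertible by the Neumann series. -/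
lemma isUnit_meanFlow (b c : Matrix ι ι ℝ) {t : ℝ} (ht : 0 ≤ t) : IsUnit (L.meanFlow b c 0 t) := by
  set g : ℝ → ℝ := fun u => u * ‖b‖ + L.Lam u * L.growth ‖c‖ with hg
  have hgc : ContinuousOn g (Icc 0 t) :=
    (by fun_prop : Continuous fun u : ℝ => u * ‖b‖).continuousOn.add
      ((L.continuousOn_Lam t).mul_const _)
  have hu := isCompact_Icc.uniformContinuousOn_of_continuous hgc
  rw [Metric.uniformContinuousOn_iff] at hu
  -- An exponent below log 2 gives e^x - 1 < 1.
  obtain ⟨δ, hδ, hδ'⟩ := hu (Real.log 2) (Real.log_pos one_lt_two)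
  obtain ⟨n, hn⟩ := exists_nat_gt (t / δ)
  have hn0 : (0 : ℝ) < n := (div_nonneg ht hδ.le).trans_lt hn
  have hstep : t / n < δ := by rw [div_lt_iff₀ hn0]; rwa [div_lt_iff₀ hδ, mul_comm] at hn
  have hstep0 : 0 ≤ t / n := div_nonneg ht hn0.le
  have hle : ∀ k : ℕ, k ≤ n → k * (t / n) ≤ t := fun k hk => by
    have : (k : ℝ) ≤ n := by exact_mod_cast hk
    calc (k : ℝ) * (t / n) ≤ n * (t / n) := mul_le_mul_of_nonneg_right this hstep0
      _ = t := mul_div_cancel₀ _ hn0.ne'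
  have key : ∀ k : ℕ, k ≤ n → IsUnit (L.meanFlow b c 0 (k * (t / n))) := by
    intro k hk
    induction k with
    | zero => simp [meanFlow_self]
    | succ k ih =>
      have h0 : 0 ≤ (k : ℝ) * (t / n) := by positivity
      have h1 : (k : ℝ) * (t / n) ≤ (k + 1 : ℕ) * (t / n) := by push_cast; linarith
      rw [L.meanFlow_mul b c le_rfl h0 h1]
      refine IsUnit.mul ?_ (ih (by omega))
      have hd := hδ' _ ⟨h0.trans h1, hle _ hk⟩ _ ⟨h0, hle k (by omega)⟩ (by
        rw [Real.dist_eq, abs_of_nonneg (by linarith)]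
        push_cast
        linarith)
      rw [Real.dist_eq] at hd
      have hlt := (le_abs_self _).trans_lt hd
      have hnorm := L.norm_meanFlow_sub_one_le b c h0 h1
      have hexp : Real.exp (((k + 1 : ℕ) * (t / n) - k * (t / n)) * ‖b‖
          + (L.Lam ((k + 1 : ℕ) * (t / n)) - L.Lam (k * (t / n))) * L.growth ‖c‖) < 2 := by
        rw [← Real.lt_log_iff_exp_lt two_pos]
        refine lt_of_eq_of_lt ?_ hlt
        simp only [hg]
        ring
      have h : ‖1 - L.meanFlow b c (k * (t / n)) ((k + 1 : ℕ) * (t / n))‖ < 1 := by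
        rw [norm_sub_rev]; linarith
      have := isUnit_one_sub_of_norm_lt_one h
      rwa [sub_sub_cancel] at this
  have := key n le_rfl
  rwa [mul_div_cancel₀ _ hn0.ne'] at this

end SSCogarch.SimpleSemiLevy

end Flow

/-! ### Affine recursions as linear flows in homogeneous coordinates -/

namespace SSCogarch

section Affine

attribute [local instance] Matrix.linftyOpNormedRing Matrix.linftyOpNormedAlgebra
  Matrix.linfty_opNormOneClass

variable {q : ℕ}

/-- The matrix of the affine map `y ↦ A y + k` in homogeneous coordinates. -/
def affine (A : Matrix (Fin q) (Fin q) ℝ) (k : Fin q → ℝ) :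
    Matrix (Fin q ⊕ Unit) (Fin q ⊕ Unit) ℝ :=
  Matrix.fromBlocks A (Matrix.replicateCol Unit k) 0 1

lemma affine_mul (A A' : Matrix (Fin q) (Fin q) ℝ) (k k' : Fin q → ℝ) :
    affine A k * affine A' k' = affine (A * A') (A *ᵥ k' + k) := by
  rw [affine, affine, Matrix.fromBlocks_multiply, affine]
  congr 1
  · simp
  · ext i j; simp [Matrix.mul_apply, Matrix.mulVec, dotProduct]
  · simp
  · simp

/-- The generator of the homogeneous flow between the jumps. -/
def Params.augB (C : Params q) : Matrix (Fin q ⊕ Unit) (Fin q ⊕ Unit) ℝ :=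
  Matrix.fromBlocks C.B 0 0 0

/-- The direction of the jumps of the homogeneous flow. -/
def Params.augC (C : Params q) : Matrix (Fin q ⊕ Unit) (Fin q ⊕ Unit) ℝ :=
  Matrix.fromBlocks C.ea (Matrix.replicateCol Unit (C.α₀ • C.e)) 0 0

/-- The embedding of block diagonal matrices is a continuous ring homomorphism, so it commutes with
the exponential. -/
lemma exp_fromBlocks_zero (A : Matrix (Fin q) (Fin q) ℝ) :
    NormedSpace.exp (Matrix.fromBlocks A 0 0 (0 : Matrix Unit Unit ℝ)) = affine (NormedSpace.exp A) 0 := by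
  let _ : NormedAlgebra ℚ (Matrix (Fin q) (Fin q) ℝ) := NormedAlgebra.restrictScalars ℚ ℝ _
  let _ : NormedAlgebra ℚ (Matrix Unit Unit ℝ) := NormedAlgebra.restrictScalars ℚ ℝ _
  let f : Matrix (Fin q) (Fin q) ℝ × Matrix Unit Unit ℝ →+*
      Matrix (Fin q ⊕ Unit) (Fin q ⊕ Unit) ℝ :=
    { toFun := fun x => Matrix.fromBlocks x.1 0 0 x.2
      map_one' := Matrix.fromBlocks_one
      map_mul' := fun x y => by simp [Matrix.fromBlocks_multiply]
      map_zero' := Matrix.fromBlocks_zero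
      map_add' := fun x y => by simp [Matrix.fromBlocks_add] }
  have hf : Continuous f := by
    have : Continuous fun x : Matrix (Fin q) (Fin q) ℝ × Matrix Unit Unit ℝ =>
        Matrix.fromBlocks x.1 0 0 x.2 :=
      continuous_fst.matrix_fromBlocks continuous_const continuous_const continuous_snd
    exact this
  have h := NormedSpace.map_exp f hf (A, 0)
  have h1 : (NormedSpace.exp (A, (0 : Matrix Unit Unit ℝ))).1 = NormedSpace.exp A := Prod.fst_exp _
  have h2 : (NormedSpace.exp (A, (0 : Matrix Unit Unit ℝ))).2 = NormedSpace.exp 0 := Prod.snd_exp _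
  rw [NormedSpace.exp_zero] at h2
  refine h.symm.trans ?_
  refine (congrArg₂ (fun x y => Matrix.fromBlocks x 0 0 y) h1 h2).trans ?_
  rw [affine]
  congr 1

lemma exp_smul_augB (C : Params q) (r : ℝ) :
    NormedSpace.exp (r • C.augB) = affine (NormedSpace.exp (r • C.B)) 0 := by
  rw [← exp_fromBlocks_zero, Params.augB, Matrix.fromBlocks_smul]
  simp

lemma one_add_smul_augC (C : Params q) (z : ℝ) :
    1 + z • C.augC = affine (1 + z • C.ea) ((C.α₀ * z) • C.e) := by
  rw [Params.augC, Matrix.fromBlocks_smul, ← Matrix.fromBlocks_one, Matrix.fromBlocks_add, affine]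
  congr 1
  · ext i j; simp; ring
  · simp
  · simp

variable {Ω : Type*} [MeasurableSpace Ω] {P : Measure Ω} (L : SimpleSemiLevy Ω P) (C : Params q)

lemma flowStep_aug (s : ℝ) (ω : Ω) (k : ℕ) :
    L.flowStep C.augB C.augC s ω k = affine (stepJ L C s ω k) (stepK L C s ω k) := by
  induction k with
  | zero =>
    simp only [SimpleSemiLevy.flowStep, stepJ, stepK, affine]
    rw [← Matrix.fromBlocks_one]
    congr 1
  | succ k ih =>
    rw [SimpleSemiLevy.flowStep, ih, one_add_smul_augC]
    refine (congrArg (fun x => affine _ _ * x * affine _ _) (exp_smul_augB C _)).trans ?_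
    rw [affine_mul, affine_mul, stepJ, stepK]
    simp

/-- This places 𝔍 and 𝔎 jointly under the theory of `flow`: cocycle property, independence,
periodicity and moments hold for the pair without further work. -/
lemma flow_aug (s t : ℝ) (ω : Ω) :
    L.flow C.augB C.augC s t ω = affine (J L C s t ω) (K L C s t ω) := by
  rw [SimpleSemiLevy.flow, flowStep_aug]
  refine (congrArg (fun x => x * affine _ _) (exp_smul_augB C _)).trans ?_
  rw [affine_mul, J, K]
  simp

lemma flowStep_eq_stepJ (s : ℝ) (ω : Ω) (k : ℕ) :
    L.flowStep C.B C.ea s ω k = stepJ L C s ω k := by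
  induction k with
  | zero => rfl
  | succ k ih =>
    rw [SimpleSemiLevy.flowStep, ih, stepJ]
    rfl

lemma flow_eq_J (s t : ℝ) (ω : Ω) : L.flow C.B C.ea s t ω = J L C s t ω := by
  rw [SimpleSemiLevy.flow, flowStep_eq_stepJ, J]
  rfl

lemma meanFlow_eq_matE (s t : ℝ) : L.meanFlow C.B C.ea s t = matE P (J L C s t) := by
  ext i j
  simp only [SimpleSemiLevy.meanFlow, matE, Matrix.of_apply, flow_eq_J]

/-- The random matrix `𝔍_{s,t}` and the random vector `𝔎_{s,t}` in homogeneous coordinates. -/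
def Phi (s t : ℝ) (ω : Ω) : Matrix (Fin q ⊕ Unit) (Fin q ⊕ Unit) ℝ :=
  affine (J L C s t ω) (K L C s t ω)

lemma Phi_eq (s t : ℝ) : Phi L C s t = L.flow C.augB C.augC s t :=
  funext fun ω => (flow_aug L C s t ω).symm

lemma Phi_mul {s u t : ℝ} (hs : 0 ≤ s) (hsu : s ≤ u) (hut : u ≤ t) (ω : Ω) :
    Phi L C s t ω = Phi L C u t ω * Phi L C s u ω := by
  simp only [Phi_eq]
  exact L.flow_mul _ _ hs hsu hut ω

variable [IsProbabilityMeasure P]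

lemma aemeasurable_Phi {s t : ℝ} (hs : 0 ≤ s) (hst : s ≤ t) : AEMeasurable (Phi L C s t) P := by
  rw [Phi_eq]
  exact L.aemeasurable_flow _ _ hs hst

lemma integrable_Phi {s t : ℝ} (hs : 0 ≤ s) (hst : s ≤ t) (i j : Fin q ⊕ Unit) :
    Integrable (fun ω => Phi L C s t ω i j) P := by
  rw [Phi_eq]
  exact L.integrable_flow_apply _ _ hs hst i j

lemma memLp_two_Phi (h4 : ∀ j, Integrable (fun z => z ^ 4) (L.F j)) {s t : ℝ} (hs : 0 ≤ s)
    (hst : s ≤ t) (i j : Fin q ⊕ Unit) : MemLp (fun ω => Phi L C s t ω i j) 2 P := by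
  rw [Phi_eq]
  exact L.memLp_two_flow_apply h4 _ _ hs hst i j

lemma identDistrib_Phi_pair {u v u' v' : ℝ} (hu : 0 ≤ u) (huv : u ≤ v)
    (hu' : 0 ≤ u') (huv' : u' ≤ v') (m : ℕ) :
    IdentDistrib (fun ω => (Phi L C (u + m * L.tau) (v + m * L.tau) ω,
        Phi L C (u' + m * L.tau) (v' + m * L.tau) ω))
      (fun ω => (Phi L C u v ω, Phi L C u' v' ω)) P P := by
  simp only [Phi_eq]
  exact L.identDistrib_flow_pair _ _ hu huv hu' huv' m

lemma matE_J_mul (hq : 0 < q) {s u t : ℝ} (hs : 0 ≤ s) (hsu : s ≤ u) (hut : u ≤ t) :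
    matE P (J L C s t) = matE P (J L C u t) * matE P (J L C s u) := by
  have : Nonempty (Fin q) := ⟨⟨0, hq⟩⟩
  simp only [← meanFlow_eq_matE]
  exact L.meanFlow_mul _ _ hs hsu hut

lemma matE_J_shift (hq : 0 < q) {u v : ℝ} (hu : 0 ≤ u) (huv : u ≤ v) (m : ℕ) :
    matE P (J L C (u + m * L.tau) (v + m * L.tau)) = matE P (J L C u v) := by
  have : Nonempty (Fin q) := ⟨⟨0, hq⟩⟩
  simp only [← meanFlow_eq_matE]
  exact L.meanFlow_shift _ _ hu huv m

lemma isUnit_matE_J (hq : 0 < q) {t : ℝ} (ht : 0 ≤ t) : IsUnit (matE P (J L C 0 t)) := by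
  have : Nonempty (Fin q) := ⟨⟨0, hq⟩⟩
  rw [← meanFlow_eq_matE]
  exact L.isUnit_meanFlow _ _ ht

/-! ### The state process in homogeneous coordinates -/

/-- Homogeneous coordinates of a vector. -/
def hom (y : Fin q → ℝ) : Fin q ⊕ Unit → ℝ := Sum.elim y 1

lemma measurable_hom : Measurable (hom (q := q)) := by
  refine measurable_pi_lambda _ fun i => ?_
  cases i with
  | inl i => exact measurable_pi_apply i
  | inr i => exact measurable_const

lemma affine_mulVec_hom (A : Matrix (Fin q) (Fin q) ℝ) (k y : Fin q → ℝ) :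
    affine A k *ᵥ hom y = hom (A *ᵥ y + k) := by
  rw [affine, hom, Matrix.fromBlocks_mulVec, hom]
  congr 1
  · ext i; simp [Matrix.mulVec, dotProduct]
  · ext i; simp

variable {L C} {Y : ℝ → Ω → Fin q → ℝ}

lemma IsStateProcess.ae_hom_eq (hY : IsStateProcess L C Y) {s t : ℝ} (hs : 0 ≤ s) (hst : s ≤ t) :
    ∀ᵐ ω ∂P, hom (Y t ω) = Phi L C s t ω *ᵥ hom (Y s ω) := by
  filter_upwards [L.ae_simple, hY.rightCont, hY.leftLimits, hY.sde] with ω h1 h2 h3 h4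
  rw [state_eq L C h1 h2 h3 h4 hs, state_eq L C h1 h2 h3 h4 (hs.trans hst), ← affine_mulVec_hom,
    ← affine_mulVec_hom]
  change Phi L C 0 t ω *ᵥ _ = Phi L C s t ω *ᵥ (Phi L C 0 s ω *ᵥ _)
  rw [Matrix.mulVec_mulVec, ← Phi_mul L C le_rfl hs hst]

/-- The states up to s are functions of the initial state and the past of X, and the matrices from s
on are functions of its future. Pairs are kept on both sides, since mixed moments involve two states
and two matrices. -/
lemma IsStateProcess.indepFun_state_Phi (hY : IsStateProcess L C Y) {u s v w : ℝ} (hu : 0 ≤ u)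
    (hus : u ≤ s) (hsv : s ≤ v) (hsw : s ≤ w) :
    IndepFun (fun ω => (hom (Y s ω), hom (Y u ω))) (fun ω => (Phi L C s v ω, Phi L C s w ω)) P := by
  obtain ⟨s, rfl⟩ : ∃ s' : ℝ≥0, (s' : ℝ) = s := ⟨⟨s, hu.trans hus⟩, rfl⟩
  have hs : (0 : ℝ) ≤ s := s.coe_nonneg
  let b := C.augB
  let c := C.augC
  have hφ : Measurable fun p : (Fin q → ℝ) × (ℝ≥0 → ℝ) =>
      (eulerLim b c 0 s p.2 *ᵥ hom p.1, eulerLim b c 0 u p.2 *ᵥ hom p.1) := by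
    have hE : ∀ r, Measurable fun p : (Fin q → ℝ) × (ℝ≥0 → ℝ) => eulerLim b c 0 r p.2 *ᵥ hom p.1 := by
      intro r
      refine measurable_pi_lambda _ fun i => ?_
      change Measurable fun p : (Fin q → ℝ) × (ℝ≥0 → ℝ) =>
        ∑ j, eulerLim b c 0 r p.2 i j * hom p.1 j
      refine Finset.measurable_sum _ fun j _ => ?_
      exact ((Matrix.measurable_apply i j).comp ((measurable_eulerLim b c 0 r).comp
        measurable_snd)).mul ((measurable_pi_apply j).comp (measurable_hom.comp measurable_fst))
    exact (hE s).prodMk (hE u)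
  have hψ : Measurable fun x : ℝ≥0 → ℝ => (eulerLim b c (s - s) (v - s) x,
      eulerLim b c (s - s) (w - s) x) :=
    (measurable_eulerLim b c _ _).prodMk (measurable_eulerLim b c _ _)
  have h := (hY.indepFun_past_future s).comp hφ hψ
  refine h.congr ?_ ?_
  · filter_upwards [hY.ae_hom_eq le_rfl hs, hY.ae_hom_eq le_rfl hu,
      L.ae_flow_eq_past b c (s := s) le_rfl hs le_rfl,
      L.ae_flow_eq_past b c (s := s) le_rfl hu hus] with ω h1 h2 h3 h4
    rw [h1, h2, Phi_eq, Phi_eq]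
    simp only [Function.comp_apply]
    rw [← h3, ← h4]
  · filter_upwards [L.ae_flow_eq_future b c (s := s) le_rfl hsv,
      L.ae_flow_eq_future b c (s := s) le_rfl hsw] with ω h1 h2
    simp only [Function.comp_apply]
    rw [Phi_eq, Phi_eq, h1, h2]

end Affine

end SSCogarch

namespace SSCogarch

variable {Ω : Type*} [MeasurableSpace Ω] {P : Measure Ω} [IsProbabilityMeasure P]
  {L : SimpleSemiLevy Ω P} {q : ℕ} {C : Params q} {Y : ℝ → Ω → Fin q → ℝ}

/-! ### Mixed moments of the state process -/

/-- The later state is a random matrix applied to the state at s, and this matrix is independent of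
both states involved. Taking b to be the constant coordinate recovers the statement for first
moments. -/
lemma IsStateProcess.integral_hom_mul (hY : IsStateProcess L C Y) {u s t : ℝ} (hu : 0 ≤ u)
    (hus : u ≤ s) (hst : s ≤ t) (a b : Fin q ⊕ Unit)
    (hint : ∀ c, Integrable (fun ω => hom (Y s ω) c * hom (Y u ω) b) P) :
    Integrable (fun ω => hom (Y t ω) a * hom (Y u ω) b) P ∧
    ∫ ω, hom (Y t ω) a * hom (Y u ω) b ∂P
      = ∑ c, (∫ ω, Phi L C s t ω a c ∂P) * ∫ ω, hom (Y s ω) c * hom (Y u ω) b ∂P := by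
  have hind : ∀ c, IndepFun (fun ω => Phi L C s t ω a c)
      (fun ω => hom (Y s ω) c * hom (Y u ω) b) P := fun c =>
    ((hY.indepFun_state_Phi hu hus hst hst).comp
      (φ := fun p : (Fin q ⊕ Unit → ℝ) × (Fin q ⊕ Unit → ℝ) => p.1 c * p.2 b)
      (by fun_prop) ((Matrix.measurable_apply a c).comp measurable_fst)).symm
  have hΦ := fun c => integrable_Phi L C (hu.trans hus) hst a c
  have hprod := fun c => (hind c).integrable_mul (hΦ c) (hint c)
  have he : (fun ω => hom (Y t ω) a * hom (Y u ω) b)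
      =ᵐ[P] fun ω => ∑ c, Phi L C s t ω a c * (hom (Y s ω) c * hom (Y u ω) b) := by
    filter_upwards [hY.ae_hom_eq (hu.trans hus) hst] with ω h
    rw [h]
    simp only [Matrix.mulVec, dotProduct, Finset.sum_mul, mul_assoc]
  refine ⟨(integrable_finsetSum _ fun c _ => hprod c).congr he.symm, ?_⟩
  rw [integral_congr_ae he]
  refine (integral_finsetSum _ fun c _ => hprod c).trans ?_
  exact Finset.sum_congr rfl fun c _ =>
    (hind c).integral_fun_mul_eq_mul_integral (hΦ c).1 (hint c).1

/-- Both states are developed from the common earlier time s. The two matrices cover overlapping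
intervals and need not be independent of each other, so their mixed moments stay together; only the
state at s separates. -/
lemma IsStateProcess.integral_hom_mul_hom (hY : IsStateProcess L C Y) {s v w : ℝ} (hs : 0 ≤ s)
    (hsv : s ≤ v) (hsw : s ≤ w) (a b : Fin q ⊕ Unit)
    (hint : ∀ c d, Integrable (fun ω => hom (Y s ω) c * hom (Y s ω) d) P)
    (hΦ : ∀ c d, Integrable (fun ω => Phi L C s v ω a c * Phi L C s w ω b d) P) :
    ∫ ω, hom (Y v ω) a * hom (Y w ω) b ∂P
      = ∑ c, ∑ d, (∫ ω, Phi L C s v ω a c * Phi L C s w ω b d ∂P)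
        * ∫ ω, hom (Y s ω) c * hom (Y s ω) d ∂P := by
  have hind : ∀ c d, IndepFun (fun ω => Phi L C s v ω a c * Phi L C s w ω b d)
      (fun ω => hom (Y s ω) c * hom (Y s ω) d) P := fun c d =>
    ((hY.indepFun_state_Phi hs le_rfl hsv hsw).comp
      (φ := fun p : (Fin q ⊕ Unit → ℝ) × (Fin q ⊕ Unit → ℝ) => p.1 c * p.2 d)
      (by fun_prop) (((Matrix.measurable_apply a c).comp measurable_fst).mul
        ((Matrix.measurable_apply b d).comp measurable_snd))).symm
  have hprod := fun c d => (hind c d).integrable_mul (hΦ c d) (hint c d)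
  have he : (fun ω => hom (Y v ω) a * hom (Y w ω) b)
      =ᵐ[P] fun ω => ∑ c, ∑ d, (Phi L C s v ω a c * Phi L C s w ω b d)
        * (hom (Y s ω) c * hom (Y s ω) d) := by
    filter_upwards [hY.ae_hom_eq hs hsv, hY.ae_hom_eq hs hsw] with ω h h'
    rw [h, h']
    simp only [Matrix.mulVec, dotProduct, Finset.sum_mul_sum]
    exact Finset.sum_congr rfl fun c _ => Finset.sum_congr rfl fun d _ => by ring
  rw [integral_congr_ae he]
  refine (integral_finsetSum _ fun c _ => integrable_finsetSum _ fun d _ => hprod c d).trans ?_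
  refine Finset.sum_congr rfl fun c _ => ?_
  refine (integral_finsetSum _ fun d _ => hprod c d).trans ?_
  exact Finset.sum_congr rfl fun d _ =>
    (hind c d).integral_fun_mul_eq_mul_integral (hΦ c d).1 (hint c d).1

lemma IsStateProcess.memLp_two_hom (hY : IsStateProcess L C Y)
    (h4 : ∀ j, Integrable (fun z => z ^ 4) (L.F j)) {s t : ℝ} (hs : 0 ≤ s) (hst : s ≤ t)
    (h : ∀ c, MemLp (fun ω => hom (Y s ω) c) 2 P) (a : Fin q ⊕ Unit) :
    MemLp (fun ω => hom (Y t ω) a) 2 P := by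
  have hterm : ∀ c, MemLp (fun ω => Phi L C s t ω a c * hom (Y s ω) c) 2 P := by
    intro c
    have hΦ := memLp_two_Phi L C h4 hs hst a c
    have hind : IndepFun (fun ω => Phi L C s t ω a c ^ 2) (fun ω => hom (Y s ω) c ^ 2) P :=
      ((hY.indepFun_state_Phi hs le_rfl hst hst).comp
        (φ := fun p : (Fin q ⊕ Unit → ℝ) × (Fin q ⊕ Unit → ℝ) => p.1 c ^ 2)
        (by fun_prop) (((Matrix.measurable_apply a c).comp measurable_fst).pow_const 2)).symm
    refine (memLp_two_iff_integrable_sq (hΦ.1.mul (h c).1)).2 ?_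
    refine (hind.integrable_mul hΦ.integrable_sq (h c).integrable_sq).congr
      (Eventually.of_forall fun ω => ?_)
    simp only [Pi.mul_apply]
    ring
  refine (memLp_finsetSum Finset.univ fun c _ => hterm c).ae_eq ?_
  filter_upwards [hY.ae_hom_eq hs hst] with ω h
  rw [h]
  rfl

lemma IsStateProcess.integrable_apply (hY : IsStateProcess L C Y)
    (h0 : ∀ i, Integrable (fun ω => Y 0 ω i) P) {t : ℝ} (ht : 0 ≤ t) (i : Fin q) :
    Integrable (fun ω => Y t ω i) P := by
  have h := (hY.integral_hom_mul le_rfl le_rfl ht (Sum.inl i) (Sum.inr ()) (by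
    rintro (c | c)
    · simpa [hom] using h0 c
    · simp [hom])).1
  simpa [hom] using h

lemma IsStateProcess.vecE_eq (hY : IsStateProcess L C Y) {s t : ℝ} (hs : 0 ≤ s) (hst : s ≤ t)
    (h : ∀ i, Integrable (fun ω => Y s ω i) P) :
    vecE P (Y t) = matE P (J L C s t) *ᵥ vecE P (Y s) + vecE P (K L C s t) := by
  ext i
  have h := (hY.integral_hom_mul hs le_rfl hst (Sum.inl i) (Sum.inr ()) (by
    rintro (c | c)
    · simpa [hom] using h c
    · simp [hom])).2
  simpa [hom, Phi, affine, vecE, matE, Matrix.mulVec, dotProduct] using h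

lemma IsStateProcess.memLp_two_apply (hY : IsStateProcess L C Y)
    (h4 : ∀ j, Integrable (fun z => z ^ 4) (L.F j)) (h0 : ∀ i, MemLp (fun ω => Y 0 ω i) 2 P)
    {t : ℝ} (ht : 0 ≤ t) (i : Fin q) : MemLp (fun ω => Y t ω i) 2 P := by
  refine hY.memLp_two_hom h4 le_rfl ht ?_ (Sum.inl i)
  rintro (c | c)
  · exact h0 c
  · exact memLp_const 1

lemma crossCov_apply {X Z : Ω → Fin q → ℝ} (hX : ∀ i, MemLp (fun ω => X ω i) 2 P)
    (hZ : ∀ i, MemLp (fun ω => Z ω i) 2 P) (i j : Fin q) :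
    crossCov P X Z i j = ∫ ω, X ω i * Z ω j ∂P - vecE P X i * vecE P Z j := by
  rw [crossCov, Matrix.of_apply, covariance_eq_sub (hX i) (hZ j)]
  rfl

/-- Moving the later time from s to t, the inhomogeneous part 𝔎 contributes the product of its mean
with the mean of Y_u. The product of means removes exactly this term. -/
lemma IsStateProcess.crossCov_mul (hY : IsStateProcess L C Y)
    (h2 : ∀ t, 0 ≤ t → ∀ i, MemLp (fun ω => Y t ω i) 2 P) {u s t : ℝ} (hu : 0 ≤ u) (hus : u ≤ s)
    (hst : s ≤ t) :
    crossCov P (Y t) (Y u) = matE P (J L C s t) * crossCov P (Y s) (Y u) := by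
  have hs := hu.trans hus
  have ht := hs.trans hst
  ext i j
  have h := (hY.integral_hom_mul hu hus hst (Sum.inl i) (Sum.inl j) (by
    rintro (c | c)
    · exact (h2 s hs c).integrable_mul (h2 u hu j)
    · simpa [hom] using (h2 u hu j).integrable one_le_two)).2
  have hm := congrFun (hY.vecE_eq hs hst fun i => (h2 s hs i).integrable one_le_two) i
  have h' : ∫ ω, Y t ω i * Y u ω j ∂P = ∑ k, matE P (J L C s t) i k * ∫ ω, Y s ω k * Y u ω j ∂P
      + vecE P (K L C s t) i * vecE P (Y u) j := by
    simpa [hom, Phi, affine, vecE, matE] using h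
  rw [crossCov_apply (h2 t ht) (h2 u hu), h', hm, Matrix.mul_apply]
  simp only [crossCov_apply (h2 s hs) (h2 u hu), mul_sub, Finset.sum_sub_distrib, Pi.add_apply,
    Matrix.mulVec, dotProduct, add_mul, Finset.sum_mul, mul_assoc]
  ring

/-! ### Periodicity of the law of the state process -/

/-- Over one period the state is transformed by an independent copy of the affine map of the first
period, so its law is mapped as in the random equation, which fixes the law of U. -/
lemma IsStateProcess.identDistrib_periods (hY : IsStateProcess L C Y) {Ω' : Type*}
    [MeasurableSpace Ω'] {P' : Measure Ω'} [IsProbabilityMeasure P'] {U : Ω' → Fin q → ℝ}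
    (hU : SolvesRandomEquation L C P' U) (hY0 : IdentDistrib (Y 0) U P P') (m : ℕ) :
    IdentDistrib (Y (m * L.tau)) U P P' := by
  have hτ := L.tau_pos
  induction m with
  | zero => simpa using hY0
  | succ m ih =>
    have hm : 0 ≤ m * L.tau := by positivity
    have hle : (m : ℝ) * L.tau ≤ (m + 1 : ℕ) * L.tau := by push_cast; nlinarith
    let f : (Fin q → ℝ) × Matrix (Fin q ⊕ Unit) (Fin q ⊕ Unit) ℝ → Fin q → ℝ :=
      fun p i => (p.2 *ᵥ hom p.1) (Sum.inl i)
    have hf : Measurable f := by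
      refine measurable_pi_lambda _ fun i => ?_
      change Measurable fun p : (Fin q → ℝ) × Matrix (Fin q ⊕ Unit) (Fin q ⊕ Unit) ℝ =>
        ∑ j, p.2 (Sum.inl i) j * hom p.1 j
      exact Finset.measurable_sum _ fun j _ =>
        ((Matrix.measurable_apply (Sum.inl i) j).comp measurable_snd).mul
          ((measurable_pi_apply j).comp (measurable_hom.comp measurable_fst))
    have hΦ0 := aemeasurable_Phi L C le_rfl hτ.le
    have hid : IdentDistrib (fun ω => Phi L C (m * L.tau) ((m + 1 : ℕ) * L.tau) ω)
        (fun x : Ω' × Ω => Phi L C 0 L.tau x.2) P (P'.prod P) := by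
      have h1 := (identDistrib_Phi_pair L C le_rfl hτ.le le_rfl hτ.le m).comp measurable_fst
      have e1 : (0 : ℝ) + m * L.tau = m * L.tau := zero_add _
      have e2 : L.tau + m * L.tau = (m + 1 : ℕ) * L.tau := by push_cast; ring
      rw [e1, e2] at h1
      refine IdentDistrib.trans h1 ⟨hΦ0, hΦ0.comp_snd, ?_⟩
      rw [show (fun x : Ω' × Ω => Phi L C 0 L.tau x.2) = Phi L C 0 L.tau ∘ Prod.snd from rfl,
        ← AEMeasurable.map_map_of_aemeasurable (by simpa using hΦ0) measurable_snd.aemeasurable]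
      simp
      rfl
    have hU' : IdentDistrib (Y (m * L.tau)) (fun x : Ω' × Ω => U x.1) P (P'.prod P) := by
      refine ih.trans ⟨ih.aemeasurable_snd, ih.aemeasurable_snd.comp_fst, ?_⟩
      rw [show (fun x : Ω' × Ω => U x.1) = U ∘ Prod.fst from rfl,
        ← AEMeasurable.map_map_of_aemeasurable (by simpa using ih.aemeasurable_snd)
          measurable_fst.aemeasurable]
      simp
    have hi1 : IndepFun (Y (m * L.tau)) (fun ω => Phi L C (m * L.tau) ((m + 1 : ℕ) * L.tau) ω) P :=
      (hY.indepFun_state_Phi hm le_rfl hle hle).comp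
        (φ := fun p : (Fin q ⊕ Unit → ℝ) × (Fin q ⊕ Unit → ℝ) => fun i => p.1 (Sum.inl i))
        (by fun_prop) measurable_fst
    have hi2 : IndepFun (fun x : Ω' × Ω => U x.1) (fun x : Ω' × Ω => Phi L C 0 L.tau x.2)
        (P'.prod P) := indepFun_prod₀ ih.aemeasurable_snd hΦ0
    have h := (hU'.prodMk hid hi1 hi2).comp hf
    have hstep : IdentDistrib (Y ((m + 1 : ℕ) * L.tau))
        (f ∘ fun ω => (Y (m * L.tau) ω, Phi L C (m * L.tau) ((m + 1 : ℕ) * L.tau) ω)) P P := by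
      refine IdentDistrib.of_ae_eq (hY.measurable _ (hm.trans hle)).aemeasurable ?_
      filter_upwards [hY.ae_hom_eq hm hle] with ω hω
      funext i
      exact congrFun hω (Sum.inl i)
    refine (hstep.trans h).trans ?_
    have e : (f ∘ fun x : Ω' × Ω => (U x.1, Phi L C 0 L.tau x.2))
        = fun x : Ω' × Ω => J L C 0 L.tau x.2 *ᵥ U x.1 + K L C 0 L.tau x.2 := by
      funext x i
      simp only [f, Function.comp_apply, Phi, affine_mulVec_hom]
      rfl
    rw [e]
    exact hU.symm

end SSCogarch

namespace SSCogarch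

variable {Ω : Type*} [MeasurableSpace Ω] {P : Measure Ω}
  {L : SimpleSemiLevy Ω P} {q : ℕ} {C : Params q} {Y : ℝ → Ω → Fin q → ℝ}

/-- The intensity is positive on a period as soon as the stability condition holds. -/
lemma IsStable.lam_pos (h : IsStable L C) {s : ℝ} (hs : s ∈ Ico 0 L.tau) : 0 < L.lam s := by
  obtain ⟨T, η, -, -, -, r, -, hr⟩ := h
  refine lt_of_le_of_ne (L.lam_nonneg s hs.1) fun h0 => ?_
  have hz : L.localLevy s = 0 := by
    refine Finset.sum_eq_zero fun j _ => ?_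
    rw [← h0]
    simp
  have := hr s hs
  rw [hz] at this
  simp at this

/-! ### Expectations of products of matrices -/

lemma matE_mul_mul_transpose {A A' : Ω → Matrix (Fin q) (Fin q) ℝ}
    (h : ∀ i k j l, Integrable (fun ω => A ω i k * A' ω j l) P) (M : Matrix (Fin q) (Fin q) ℝ)
    (i j : Fin q) :
    matE P (fun ω => A ω * M * (A' ω)ᵀ) i j
      = ∑ k, ∑ l, (∫ ω, A ω i k * A' ω j l ∂P) * M k l := by
  simp only [matE, Matrix.of_apply, Matrix.mul_apply, Matrix.transpose_apply, Finset.sum_mul]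
  rw [Finset.sum_comm]
  have e : ∀ (k l : Fin q) (ω : Ω), A ω i k * M k l * A' ω j l = A ω i k * A' ω j l * M k l :=
    fun k l ω => by ring
  simp only [e]
  rw [integral_finsetSum _ fun l _ => integrable_finsetSum _ fun k _ => (h i k j l).mul_const _]
  refine Finset.sum_congr rfl fun l _ => ?_
  rw [integral_finsetSum _ fun k _ => (h i k j l).mul_const _]
  exact Finset.sum_congr rfl fun k _ => integral_mul_const _ _

lemma matE_vecMulVec_mulVec {A : Ω → Matrix (Fin q) (Fin q) ℝ} {k : Ω → Fin q → ℝ}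
    (h : ∀ i l j, Integrable (fun ω => A ω i l * k ω j) P) (v : Fin q → ℝ) (i j : Fin q) :
    matE P (fun ω => Matrix.vecMulVec (A ω *ᵥ v) (k ω)) i j
      = ∑ l, (∫ ω, A ω i l * k ω j ∂P) * v l := by
  simp only [matE, Matrix.of_apply, Matrix.vecMulVec_apply, Matrix.mulVec, dotProduct,
    Finset.sum_mul]
  have e : ∀ (l : Fin q) (ω : Ω), A ω i l * v l * k ω j = A ω i l * k ω j * v l :=
    fun l ω => by ring
  simp only [e]
  rw [integral_finsetSum _ fun l _ => (h i l j).mul_const _]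
  exact Finset.sum_congr rfl fun l _ => integral_mul_const _ _

lemma matE_vecMulVec_mul_transpose {A : Ω → Matrix (Fin q) (Fin q) ℝ} {k : Ω → Fin q → ℝ}
    (h : ∀ i j l, Integrable (fun ω => k ω i * A ω j l) P) (v : Fin q → ℝ) (i j : Fin q) :
    matE P (fun ω => Matrix.vecMulVec (k ω) v * (A ω)ᵀ) i j
      = ∑ l, (∫ ω, k ω i * A ω j l ∂P) * v l := by
  simp only [matE, Matrix.of_apply, Matrix.vecMulVec_apply, Matrix.mul_apply,
    Matrix.transpose_apply]
  have e : ∀ (l : Fin q) (ω : Ω), k ω i * v l * A ω j l = k ω i * A ω j l * v l :=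
    fun l ω => by ring
  simp only [e]
  rw [integral_finsetSum _ fun l _ => (h i j l).mul_const _]
  exact Finset.sum_congr rfl fun l _ => integral_mul_const _ _

/-- The covariances of two affine functions of a random vector with mean `v` and matrix of second
moments `M`, where the vector is independent of the coefficients `(A, k)` and `(A', k')`. -/
def affineCov (P : Measure Ω) (A A' : Ω → Matrix (Fin q) (Fin q) ℝ) (k k' : Ω → Fin q → ℝ)
    (v : Fin q → ℝ) (M : Matrix (Fin q) (Fin q) ℝ) : Matrix (Fin q) (Fin q) ℝ :=
  matE P (fun ω => A ω * M * (A' ω)ᵀ)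
    - matE P A * Matrix.vecMulVec v v * (matE P A')ᵀ
    + matE P (fun ω => Matrix.vecMulVec (A ω *ᵥ v) (k' ω))
    - Matrix.vecMulVec (matE P A *ᵥ v) (vecE P k')
    + matE P (fun ω => Matrix.vecMulVec (k ω) v * (A' ω)ᵀ)
    - Matrix.vecMulVec (vecE P k) v * (matE P A')ᵀ
    + matE P (fun ω => Matrix.vecMulVec (k ω) (k' ω))
    - Matrix.vecMulVec (vecE P k) (vecE P k')

lemma affineCov_apply {A A' : Ω → Matrix (Fin q) (Fin q) ℝ} {k k' : Ω → Fin q → ℝ}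
    (hA : ∀ i j, MemLp (fun ω => A ω i j) 2 P) (hA' : ∀ i j, MemLp (fun ω => A' ω i j) 2 P)
    (hk : ∀ i, MemLp (fun ω => k ω i) 2 P) (hk' : ∀ i, MemLp (fun ω => k' ω i) 2 P)
    (v : Fin q → ℝ) (M : Matrix (Fin q) (Fin q) ℝ) (i j : Fin q) :
    affineCov P A A' k k' v M i j
      = ∑ a, ∑ b, (∫ ω, A ω i a * A' ω j b ∂P) * M a b
        + ∑ a, (∫ ω, A ω i a * k' ω j ∂P) * v a
        + ∑ b, (∫ ω, k ω i * A' ω j b ∂P) * v b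
        + ∫ ω, k ω i * k' ω j ∂P
        - (matE P A *ᵥ v + vecE P k) i * (matE P A' *ᵥ v + vecE P k') j := by
  have e1 : (matE P A * Matrix.vecMulVec v v * (matE P A')ᵀ) i j
      = (matE P A *ᵥ v) i * (matE P A' *ᵥ v) j := by
    rw [Matrix.mul_vecMulVec, Matrix.vecMulVec_mul, Matrix.vecMul_transpose,
      Matrix.vecMulVec_apply]
  have e2 : (Matrix.vecMulVec (vecE P k) v * (matE P A')ᵀ) i j
      = vecE P k i * (matE P A' *ᵥ v) j := by
    rw [Matrix.vecMulVec_mul, Matrix.vecMul_transpose, Matrix.vecMulVec_apply]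
  have e3 : matE P (fun ω => Matrix.vecMulVec (k ω) (k' ω)) i j = ∫ ω, k ω i * k' ω j ∂P := rfl
  simp only [affineCov, Matrix.sub_apply, Matrix.add_apply, e1, e2, e3, Matrix.vecMulVec_apply]
  rw [matE_mul_mul_transpose (fun i k j l => (hA i k).integrable_mul (hA' j l)),
    matE_vecMulVec_mulVec (fun i l j => (hA i l).integrable_mul (hk' j)),
    matE_vecMulVec_mul_transpose (fun i j l => (hk i).integrable_mul (hA' j l))]
  simp only [Pi.add_apply]
  ring

variable [IsProbabilityMeasure P]

/-- Both states are affine images of Y_s with coefficients independent of it. The eight terms of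
`affineCov` arise by splitting each homogeneous index into its linear and its constant part. -/
lemma IsStateProcess.crossCov_eq_affineCov (hY : IsStateProcess L C Y)
    (h4 : ∀ j, Integrable (fun z => z ^ 4) (L.F j))
    (h2 : ∀ t, 0 ≤ t → ∀ i, MemLp (fun ω => Y t ω i) 2 P) {s v w : ℝ} (hs : 0 ≤ s) (hsv : s ≤ v)
    (hsw : s ≤ w) :
    crossCov P (Y v) (Y w) = affineCov P (J L C s v) (J L C s w) (K L C s v) (K L C s w)
      (vecE P (Y s)) (matE P fun ω => Matrix.vecMulVec (Y s ω) (Y s ω)) := by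
  have hJ : ∀ {t}, s ≤ t → ∀ i j, MemLp (fun ω => J L C s t ω i j) 2 P := fun ht i j =>
    memLp_two_Phi L C h4 hs ht (Sum.inl i) (Sum.inl j)
  have hK : ∀ {t}, s ≤ t → ∀ i, MemLp (fun ω => K L C s t ω i) 2 P := fun ht i =>
    memLp_two_Phi L C h4 hs ht (Sum.inl i) (Sum.inr ())
  have hone : ∀ c, MemLp (fun ω => hom (Y s ω) c) 2 P := by
    rintro (c | c)
    · exact h2 s hs c
    · exact memLp_const 1
  ext i j
  have h := hY.integral_hom_mul_hom hs hsv hsw (Sum.inl i) (Sum.inl j)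
    (fun c d => (hone c).integrable_mul (hone d))
    (fun c d => (memLp_two_Phi L C h4 hs hsv _ c).integrable_mul (memLp_two_Phi L C h4 hs hsw _ d))
  have h' : ∫ ω, Y v ω i * Y w ω j ∂P
      = ∑ a, (∑ b, (∫ ω, J L C s v ω i a * J L C s w ω j b ∂P) * ∫ ω, Y s ω a * Y s ω b ∂P
          + (∫ ω, J L C s v ω i a * K L C s w ω j ∂P) * ∫ ω, Y s ω a ∂P)
        + (∑ b, (∫ ω, K L C s v ω i * J L C s w ω j b ∂P) * ∫ ω, Y s ω b ∂P
          + ∫ ω, K L C s v ω i * K L C s w ω j ∂P) := by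
    simpa [hom, Phi, affine] using h
  have hint := fun i => (h2 s hs i).integrable one_le_two
  rw [crossCov_apply (h2 v (hs.trans hsv)) (h2 w (hs.trans hsw)), h',
    affineCov_apply (hJ hsv) (hJ hsw) (hK hsv) (hK hsw), hY.vecE_eq hs hsv hint,
    hY.vecE_eq hs hsw hint, Finset.sum_add_distrib]
  simp only [matE, vecE, Matrix.of_apply, Matrix.vecMulVec_apply, add_assoc]

/-- The expression depends only on the joint law of the two affine maps, which is periodic by
`identDistrib_Phi_pair`. -/
lemma affineCov_shift (h4 : ∀ j, Integrable (fun z => z ^ 4) (L.F j)) {u v w : ℝ}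
    (hu : 0 ≤ u) (huv : u ≤ v) (huw : u ≤ w) (m : ℕ) (y : Fin q → ℝ)
    (M : Matrix (Fin q) (Fin q) ℝ) :
    affineCov P (J L C (u + m * L.tau) (v + m * L.tau)) (J L C (u + m * L.tau) (w + m * L.tau))
        (K L C (u + m * L.tau) (v + m * L.tau)) (K L C (u + m * L.tau) (w + m * L.tau)) y M
      = affineCov P (J L C u v) (J L C u w) (K L C u v) (K L C u w) y M := by
  have hm : 0 ≤ m * L.tau := by have := L.tau_pos; positivity
  have hid := identDistrib_Phi_pair L C hu huv hu huw m
  have h1 : ∀ a b, ∫ ω, Phi L C (u + m * L.tau) (v + m * L.tau) ω a b ∂P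
      = ∫ ω, Phi L C u v ω a b ∂P := fun a b =>
    (hid.comp ((Matrix.measurable_apply a b).comp measurable_fst)).integral_eq
  have h2 : ∀ a b, ∫ ω, Phi L C (u + m * L.tau) (w + m * L.tau) ω a b ∂P
      = ∫ ω, Phi L C u w ω a b ∂P := fun a b =>
    (hid.comp ((Matrix.measurable_apply a b).comp measurable_snd)).integral_eq
  have h3 : ∀ a b c d, ∫ ω, Phi L C (u + m * L.tau) (v + m * L.tau) ω a b
        * Phi L C (u + m * L.tau) (w + m * L.tau) ω c d ∂P
      = ∫ ω, Phi L C u v ω a b * Phi L C u w ω c d ∂P := fun a b c d =>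
    (hid.comp (((Matrix.measurable_apply a b).comp measurable_fst).mul
      ((Matrix.measurable_apply c d).comp measurable_snd))).integral_eq
  have hJ : ∀ {s t}, 0 ≤ s → s ≤ t → ∀ i j, MemLp (fun ω => J L C s t ω i j) 2 P :=
    fun hs ht i j => memLp_two_Phi L C h4 hs ht (Sum.inl i) (Sum.inl j)
  have hK : ∀ {s t}, 0 ≤ s → s ≤ t → ∀ i, MemLp (fun ω => K L C s t ω i) 2 P := fun hs ht i =>
    memLp_two_Phi L C h4 hs ht (Sum.inl i) (Sum.inr ())
  have hum : 0 ≤ u + m * L.tau := by linarith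
  have huvm : u + m * L.tau ≤ v + m * L.tau := by linarith
  have huwm : u + m * L.tau ≤ w + m * L.tau := by linarith
  have eJv : matE P (J L C (u + m * L.tau) (v + m * L.tau)) = matE P (J L C u v) := by
    ext i j; exact h1 (Sum.inl i) (Sum.inl j)
  have eJw : matE P (J L C (u + m * L.tau) (w + m * L.tau)) = matE P (J L C u w) := by
    ext i j; exact h2 (Sum.inl i) (Sum.inl j)
  have eKv : vecE P (K L C (u + m * L.tau) (v + m * L.tau)) = vecE P (K L C u v) := by
    ext i; exact h1 (Sum.inl i) (Sum.inr ())
  have eKw : vecE P (K L C (u + m * L.tau) (w + m * L.tau)) = vecE P (K L C u w) := by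
    ext i; exact h2 (Sum.inl i) (Sum.inr ())
  ext i j
  rw [affineCov_apply (hJ hum huvm) (hJ hum huwm) (hK hum huvm) (hK hum huwm),
    affineCov_apply (hJ hu huv) (hJ hu huw) (hK hu huv) (hK hu huw), eJv, eJw, eKv, eKw]
  have k1 := fun a b => h3 (Sum.inl i) (Sum.inl a) (Sum.inl j) (Sum.inl b)
  have k2 := fun a => h3 (Sum.inl i) (Sum.inl a) (Sum.inl j) (Sum.inr ())
  have k3 := fun b => h3 (Sum.inl i) (Sum.inr ()) (Sum.inl j) (Sum.inl b)
  have k4 := h3 (Sum.inl i) (Sum.inr ()) (Sum.inl j) (Sum.inr ())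
  simp only [Phi, affine, Matrix.fromBlocks_apply₁₁, Matrix.fromBlocks_apply₁₂,
    Matrix.replicateCol_apply] at k1 k2 k3 k4
  simp only [k1, k2, k3, k4]

lemma matE_J_pow (hq : 0 < q) (m k : ℕ) :
    matE P (J L C (m * L.tau) ((m + k : ℕ) * L.tau)) = matE P (J L C 0 L.tau) ^ k := by
  have hτ := L.tau_pos
  have hm : 0 ≤ m * L.tau := by positivity
  induction k with
  | zero =>
    ext i j
    simp [matE, ← flow_eq_J, L.flow_self]
  | succ k ih =>
    have h1 : (m : ℝ) * L.tau ≤ (m + k : ℕ) * L.tau := by push_cast; gcongr; linarith [k.cast_nonneg (α := ℝ)]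
    have h2 : ((m + k : ℕ) : ℝ) * L.tau ≤ (m + (k + 1) : ℕ) * L.tau := by push_cast; gcongr; linarith
    have h3 := matE_J_shift L C hq le_rfl hτ.le (m + k)
    have e : L.tau + (m + k : ℕ) * L.tau = (m + (k + 1) : ℕ) * L.tau := by push_cast; ring
    rw [zero_add, e] at h3
    rw [matE_J_mul L C hq hm h1 h2, ih, h3, pow_succ']

end SSCogarch

/-! ### The mean and covariance formulas -/

theorem lemma4p2 {Ω : Type*} [MeasurableSpace Ω] (P : Measure Ω) [IsProbabilityMeasure P]
    {Ω' : Type*} [MeasurableSpace Ω'] (P' : Measure Ω') [IsProbabilityMeasure P']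
    (L : SSCogarch.SimpleSemiLevy Ω P) {q : ℕ} (C : SSCogarch.Params q)
    (Y : ℝ → Ω → Fin q → ℝ) (U : Ω' → Fin q → ℝ)
    (hY : SSCogarch.IsStateProcess L C Y)
    (hstable : SSCogarch.IsStable L C)
    (hU : SSCogarch.SolvesRandomEquation L C P' U)
    (hY0 : IdentDistrib (Y 0) U P P')
    (hY0_moment : MemLp (Y 0) 1 P ∧ MemLp (Y 0) 2 P)
    (hS2 : ∀ t, 0 ≤ t → MemLp (L.S t) 2 P) :
    -- the expectations exist, and the mean of `𝔍` over a period is invertible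
    (∀ i, Integrable (fun ω => U ω i) P') ∧
    (∀ s ∈ Icc 0 L.tau, (∀ i j, Integrable (fun ω => SSCogarch.J L C 0 s ω i j) P) ∧
      ∀ i, Integrable (fun ω => SSCogarch.K L C 0 s ω i) P) ∧
    IsUnit (SSCogarch.matE P (SSCogarch.J L C 0 L.tau)).det ∧
    -- under the fourth moment condition all second moments are finite
    ((∀ t, 0 ≤ t → MemLp (L.S t) 4 P) →
      (∀ i, MemLp (fun ω => U ω i) 2 P') ∧
      (∀ s ∈ Icc 0 L.tau, (∀ i j, MemLp (fun ω => SSCogarch.J L C 0 s ω i j) 2 P) ∧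
        ∀ i, MemLp (fun ω => SSCogarch.K L C 0 s ω i) 2 P) ∧
      ∀ t, 0 ≤ t → ∀ i, MemLp (fun ω => Y t ω i) 2 P) ∧
    -- the formulas for the mean and the covariance
    ∀ t h : ℝ, 0 ≤ t → 0 ≤ h → ∃ (m n : ℕ) (t₁ t₂ : ℝ),
      t₁ ∈ Ico 0 L.tau ∧ t₂ ∈ Ico 0 L.tau ∧
      t ∈ Ico (m * L.tau) ((m + 1) * L.tau) ∧ t + h ∈ Ico (n * L.tau) ((n + 1) * L.tau) ∧
      t = t₁ + m * L.tau ∧ t + h = t₂ + n * L.tau ∧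
      (∀ i, Integrable (fun ω => Y t ω i) P) ∧
      SSCogarch.vecE P (Y t)
        = SSCogarch.matE P (SSCogarch.J L C 0 t₁) *ᵥ SSCogarch.vecE P' U
          + SSCogarch.vecE P (SSCogarch.K L C 0 t₁) ∧
      ((∀ t, 0 ≤ t → MemLp (L.S t) 4 P) →
        SSCogarch.crossCov P (Y (t + h)) (Y t)
          = SSCogarch.matE P (SSCogarch.J L C 0 t₂)
            * SSCogarch.matE P (SSCogarch.J L C 0 L.tau) ^ ((n : ℤ) - (m : ℤ) - 1)
            * (SSCogarch.matE P (fun ω => SSCogarch.J L C 0 L.tau ω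
                  * SSCogarch.matE P' (fun ω' => Matrix.vecMulVec (U ω') (U ω'))
                  * (SSCogarch.J L C 0 t₁ ω)ᵀ)
              - SSCogarch.matE P (SSCogarch.J L C 0 L.tau)
                  * Matrix.vecMulVec (SSCogarch.vecE P' U) (SSCogarch.vecE P' U)
                  * (SSCogarch.matE P (SSCogarch.J L C 0 t₁))ᵀ
              + SSCogarch.matE P (fun ω => Matrix.vecMulVec
                  (SSCogarch.J L C 0 L.tau ω *ᵥ SSCogarch.vecE P' U) (SSCogarch.K L C 0 t₁ ω))
              - Matrix.vecMulVec
                  (SSCogarch.matE P (SSCogarch.J L C 0 L.tau) *ᵥ SSCogarch.vecE P' U)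
                  (SSCogarch.vecE P (SSCogarch.K L C 0 t₁))
              + SSCogarch.matE P (fun ω => Matrix.vecMulVec
                  (SSCogarch.K L C 0 L.tau ω) (SSCogarch.vecE P' U)
                  * (SSCogarch.J L C 0 t₁ ω)ᵀ)
              - Matrix.vecMulVec (SSCogarch.vecE P (SSCogarch.K L C 0 L.tau))
                  (SSCogarch.vecE P' U) * (SSCogarch.matE P (SSCogarch.J L C 0 t₁))ᵀ
              + SSCogarch.matE P (fun ω => Matrix.vecMulVec
                  (SSCogarch.K L C 0 L.tau ω) (SSCogarch.K L C 0 t₁ ω))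
              - Matrix.vecMulVec (SSCogarch.vecE P (SSCogarch.K L C 0 L.tau))
                  (SSCogarch.vecE P (SSCogarch.K L C 0 t₁)))) := by
  have hq : 0 < q := C.one_le_p.trans C.p_le_q
  have hτ := L.tau_pos
  have h0int : ∀ i, Integrable (fun ω => Y 0 ω i) P := fun i =>
    memLp_one_iff_integrable.1 (hY0_moment.1.eval i)
  have h0sq : ∀ i, MemLp (fun ω => Y 0 ω i) 2 P := fun i => hY0_moment.2.eval i
  have hYint : ∀ t, 0 ≤ t → ∀ i, Integrable (fun ω => Y t ω i) P := fun t ht i =>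
    hY.integrable_apply h0int ht i
  have hF : (∀ t, 0 ≤ t → MemLp (L.S t) 4 P) → ∀ j, Integrable (fun z => z ^ 4) (L.F j) :=
    fun h j => L.integrable_F_pow_four (fun s hs => hstable.lam_pos hs) h j
  have hper := fun m => hY.identDistrib_periods hU hY0 m
  have happ : ∀ i, Measurable fun y : Fin q → ℝ => y i := fun i => measurable_pi_apply i
  refine ⟨fun i => (hY0.comp (happ i)).integrable_snd (h0int i), fun s hs => ⟨fun i j => ?_, fun i => ?_⟩,
    ?_, fun h => ⟨fun i => (hY0.comp (happ i)).memLp_snd (h0sq i),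
      fun s hs => ⟨fun i j => ?_, fun i => ?_⟩, fun t ht i => ?_⟩, ?_⟩
  · exact integrable_Phi L C le_rfl hs.1 (Sum.inl i) (Sum.inl j)
  · exact integrable_Phi L C le_rfl hs.1 (Sum.inl i) (Sum.inr ())
  · exact (Matrix.isUnit_iff_isUnit_det _).1 (isUnit_matE_J L C hq hτ.le)
  · exact memLp_two_Phi L C (hF h) le_rfl hs.1 (Sum.inl i) (Sum.inl j)
  · exact memLp_two_Phi L C (hF h) le_rfl hs.1 (Sum.inl i) (Sum.inr ())
  · exact hY.memLp_two_apply (hF h) h0sq ht i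
  intro t h ht hh
  have hperiod : ∀ u : ℝ, 0 ≤ u → ∃ k : ℕ, u ∈ Ico (k * L.tau) ((k + 1) * L.tau) := by
    intro u hu
    refine ⟨⌊u / L.tau⌋₊, ?_, ?_⟩
    · exact (le_div_iff₀ hτ).1 (Nat.floor_le (div_nonneg hu hτ.le))
    · exact (div_lt_iff₀ hτ).1 (Nat.lt_floor_add_one _)
  obtain ⟨m, hm⟩ := hperiod t ht
  obtain ⟨n, hn⟩ := hperiod (t + h) (add_nonneg ht hh)
  have ht₁ : t - m * L.tau ∈ Ico 0 L.tau := ⟨sub_nonneg.2 hm.1, by linarith [hm.2]⟩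
  have ht₂ : t + h - n * L.tau ∈ Ico 0 L.tau := ⟨sub_nonneg.2 hn.1, by linarith [hn.2]⟩
  have hm0 : 0 ≤ m * L.tau := by positivity
  have hmn : m ≤ n := by
    have h1 : (m : ℝ) * L.tau < (n + 1) * L.tau := by linarith [hm.1, hn.2]
    have h2 : (m : ℝ) < n + 1 := lt_of_mul_lt_mul_right h1 hτ.le
    exact Nat.lt_succ_iff.1 (by exact_mod_cast h2)
  have hmeanU : vecE P (Y (m * L.tau)) = vecE P' U := by
    ext i; exact ((hper m).comp (happ i)).integral_eq
  have hsqU : (matE P fun ω => Matrix.vecMulVec (Y (m * L.tau) ω) (Y (m * L.tau) ω))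
      = matE P' fun ω' => Matrix.vecMulVec (U ω') (U ω') := by
    ext i j; exact ((hper m).comp ((happ i).mul (happ j))).integral_eq
  set t₁ := t - m * L.tau with ht₁_def
  set t₂ := t + h - n * L.tau with ht₂_def
  have e₁ : t = t₁ + m * L.tau := by rw [ht₁_def]; ring
  have e₂ : t + h = t₂ + n * L.tau := by rw [ht₂_def]; ring
  refine ⟨m, n, t₁, t₂, ht₁, ht₂, hm, hn, e₁, e₂, hYint t ht, ?_, fun hS4 => ?_⟩
  · have hid := identDistrib_Phi_pair L C le_rfl ht₁.1 le_rfl ht₁.1 m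
    have hΦ : ∀ a b, ∫ ω, Phi L C (m * L.tau) t ω a b ∂P = ∫ ω, Phi L C 0 t₁ ω a b ∂P := by
      intro a b
      have := (hid.comp ((Matrix.measurable_apply a b).comp measurable_fst)).integral_eq
      rwa [zero_add, ← e₁] at this
    have hJ : matE P (J L C (m * L.tau) t) = matE P (J L C 0 t₁) := by
      ext i j; exact hΦ (Sum.inl i) (Sum.inl j)
    have hK : vecE P (K L C (m * L.tau) t) = vecE P (K L C 0 t₁) := by
      ext i; exact hΦ (Sum.inl i) (Sum.inr ())
    rw [hY.vecE_eq hm0 hm.1 (hYint _ hm0), hmeanU, hJ, hK]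
  have h4 := hF hS4
  have h2 : ∀ t, 0 ≤ t → ∀ i, MemLp (fun ω => Y t ω i) 2 P := fun t ht i =>
    hY.memLp_two_apply h4 h0sq ht i
  -- The bracket of the formula is the covariance of Y_t with the state at the next multiple of τ,
  -- both developed from mτ, where the state has the law of U.
  have hbase : crossCov P (Y (L.tau + m * L.tau)) (Y t)
      = affineCov P (J L C 0 L.tau) (J L C 0 t₁) (K L C 0 L.tau) (K L C 0 t₁) (vecE P' U)
        (matE P' fun ω' => Matrix.vecMulVec (U ω') (U ω')) := by
    have h1 := hY.crossCov_eq_affineCov h4 h2 hm0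
      (show (m : ℝ) * L.tau ≤ L.tau + m * L.tau by linarith) hm.1
    have h3 := affineCov_shift (C := C) h4 le_rfl hτ.le ht₁.1 m (vecE P' U)
      (matE P' fun ω' => Matrix.vecMulVec (U ω') (U ω'))
    rw [zero_add, ← e₁] at h3
    rw [h1, hmeanU, hsqU, h3]
  refine Eq.trans ?_ (congrArg _ hbase)
  -- For m = n the time t + h precedes (m+1)τ, so the bracket equals G cov(Y_{t+h}, Y_t) with G the
  -- mean of 𝔍 over [t₂, τ]. With E the mean over [0, t₂], the mean over the period is GE, and E
  -- (GE)⁻¹ G = 1.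
  rcases Nat.eq_or_lt_of_le hmn with rfl | hlt
  · have hle : t + h ≤ L.tau + m * L.tau := by linarith [hn.2]
    have h1 := hY.crossCov_mul h2 ht (by linarith : t ≤ t + h) hle
    have h3 := matE_J_shift L C hq ht₂.1 ht₂.2.le m
    rw [← e₂] at h3
    have h5 := matE_J_mul L C hq le_rfl ht₂.1 ht₂.2.le
    have hE := (Matrix.isUnit_iff_isUnit_det _).1 (isUnit_matE_J L C hq ht₂.1)
    have hM := (Matrix.isUnit_iff_isUnit_det _).1 (isUnit_matE_J L C hq hτ.le)
    -- G starts at t₂ rather than 0, so its invertibility is read off from the determinant of the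
    -- product over the whole period.
    have hG : IsUnit (matE P (J L C t₂ L.tau)).det := by
      rw [h5, Matrix.det_mul] at hM
      exact isUnit_of_mul_isUnit_left hM
    rw [h1, h3, sub_self, zero_sub, Matrix.zpow_neg_one, h5, Matrix.mul_inv_rev, mul_assoc,
      mul_assoc, Matrix.nonsing_inv_mul_cancel_left _ _ hG, Matrix.mul_nonsing_inv_cancel_left _ _ hE]
  -- With n = m + 1 + k, the covariance is carried from (m+1)τ over k whole periods to nτ and then
  -- on to t + h, one mean factor for each stretch.
  · obtain ⟨k, rfl⟩ := Nat.exists_eq_add_of_le (Nat.succ_le_of_lt hlt)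
    have eτ : L.tau + m * L.tau = (m + 1 : ℕ) * L.tau := by push_cast; ring
    have hle : t ≤ (m + 1 : ℕ) * L.tau := by push_cast; exact hm.2.le
    have hle2 : ((m + 1 : ℕ) : ℝ) * L.tau ≤ (m + 1 + k : ℕ) * L.tau :=
      mul_le_mul_of_nonneg_right (by push_cast; linarith [k.cast_nonneg (α := ℝ)]) hτ.le
    have h1 := hY.crossCov_mul h2 ht (hle.trans hle2) hn.1
    have h3 := hY.crossCov_mul h2 ht hle hle2
    have h5 := matE_J_shift L C hq le_rfl ht₂.1 (m + 1 + k)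
    rw [zero_add, ← e₂] at h5
    have hexp : ((m + 1 + k : ℕ) : ℤ) - (m : ℤ) - 1 = (k : ℤ) := by push_cast; ring
    rw [h1, h3, h5, matE_J_pow hq, hexp, zpow_natCast, eτ, mul_assoc]
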